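/- Let $W$ be the Weyl group of type $A_{n-1}$, of type $B_n$ ($n\ge 2$) or of type $D_n$ ($n\ge 4$), with simple reflections $s_1,\dots,s_{n-1}$ (the transpositions $(a,a+1)$) and, in types $B_n$, $D_n$, one more simple reflection $s_n$ (the sign change at $n$ in type $B_n$; the transposition $(n-1,n)$ combined with the sign changes at $n-1,n$ in type $D_n$); let $(m_{ab})$ be its Coxeter matrix. Let $\widetilde W$ be the group generated by $z$ and the $\tilde t_a$ (one for each $s_a$) with the relations: $z$ is central, $z^2=1$, $\tilde t_a^2=1$, $\tilde t_a\tilde t_b=z\tilde t_b\tilde t_a$ if $m_{ab}=2$, $\tilde t_a\tilde t_b\tilde t_a=\tilde t_b\tilde t_a\tilde t_b$ if $m_{ab}=3$, $(\tilde t_a\tilde t_b)^2=z(\tilde t_b\tilde t_a)^2$ if $m_{ab}=4$. Let $\mathbb CW^-=\mathbb C\widetilde W/\langle z+1\rangle$ be the spin Weyl group algebra and $t_a\in\mathbb CW^-$ the image of $\tilde t_a$. For $1\le i<j\le n$ put $$[i,j]=(-1)^{j-i-1}t_{j-1}\cdots t_{i+1}t_it_{i+1}\cdots t_{j-1},\qquad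 [j,i]=-[i,j],$$ $$\overline{[i,j]}=\overline{[j,i]}=(-1)^{j-i-1}(t_j\cdots t_{n-1})(t_i\cdots t_{n-2})\,r\,(t_{n-2}\cdots t_i)(t_{n-1}\cdots t_j),$$ where $r=t_n$ in type $D_n$ and $r=-t_nt_{n-1}t_n$ in type $B_n$ (empty products are $1$), and in type $B_n$, for $1\le i\le n$, $$\overline{[i]}=(-1)^{n-i}t_i\cdots t_{n-1}t_nt_{n-1}\cdots t_i .$$ Let $u,v\in\mathbb C$. The rational spin double affine Hecke algebra $\mathfrak H_W$ is the algebra generated by $\xi_i,y_i$ ($1\le i\le n$) and $\mathbb CW^-$ subject to $y_iy_j=y_jy_i$; $\xi_i\xi_j=-\xi_j\xi_i$ ($i\ne j$); for $1\le a\le n-1$: $t_ay_a=y_{a+1}t_a$, $t_a\xi_a=-\xi_{a+1}t_a$, and $t_ay_j=y_jt_a$, $t_a\xi_j=-\xi_jt_a$ for $j\ne a,a+1$; and, where $[a,b]=ab-ba$ on the left-hand sides: * type $A_{n-1}$: $[y_j,\xi_i]=-u[i,j]$ ($i\neq j$), $[y_i,\xi_i]=u\sum_{k\ne i}[i,k]$;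 * type $D_n$: $t_ny_n=-y_{n-1}t_n$, $t_n\xi_n=-\xi_{n-1}t_n$, $t_ny_j=y_jt_n$ and $t_n\xi_j=-\xi_jt_n$ ($j\ne n-1,n$), $[y_j,\xi_i]=-u[i,j]+u\overline{[i,j]}$ ($i\ne j$), $[y_i,\xi_i]=u\sum_{k\ne i}([i,k]+\overline{[i,k]})$; * type $B_n$: $t_ny_n=-y_nt_n$, $t_n\xi_n=-\xi_nt_n$, $t_ny_j=y_jt_n$ and $t_n\xi_j=-\xi_jt_n$ ($j\ne n$), $[y_j,\xi_i]=-u[i,j]+u\overline{[i,j]}$ ($i\ne j$), $[y_i,\xi_i]=u\sum_{k\ne i}([i,k]+\overline{[i,k]})+v\overline{[i]}$. Let $V$ be a $\mathbb CW^-$-module, and let $\mathfrak h_\xi\subseteq\mathfrak H_W$ be the subalgebra generated by the $\xi_i$ and $\mathbb CW^-$. Then the $\mathbb CW^-$-action on $V$ extends uniquely to an $\mathfrak h_\xi$-action in which every $\xi_i$ acts as $0$; the canonical map $\mathbb C[y_1,\dots,y_n]\otimes V\to V_\xi:=\mathfrak H_W\otimes_{\mathfrak h_\xi}V$, $f\otimes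 w\mapsto f\otimes w$, is bijective; and, with $V_\xi$ identified with $\mathbb C[y_1,\dots,y_n]\otimes V$ by this map, each $\xi_i$ acts by a Dunkl operator: for all $f\in\mathbb C[y_1,\dots,y_n]$ and $w\in V$, * in type $A_{n-1}$: $$\xi_i\circ(f\otimes w)=u\sum_{k\ne i}\frac{f-f^{s_{ki}}}{y_i-y_k}\otimes[k,i]w;$$ * in type $B_n$: $$\xi_i\circ(f\otimes w)=u\sum_{k\ne i}\frac{f-f^{s_{ki}}}{y_i-y_k}\otimes[k,i]w-u\sum_{k\ne i}\frac{f-f^{\overline s_{ki}}}{y_i+y_k}\otimes\overline{[k,i]}w-v\,\frac{f-f^{\tau_i}}{2y_i}\otimes\overline{[i]}w;$$ * in type $D_n$: $$\xi_i\circ(f\otimes w)=u\sum_{k\ne i}\frac{f-f^{s_{ki}}}{y_i-y_k}\otimes[k,i]w-u\sum_{k\ne i}\frac{f-f^{\overline s_{ki}}}{y_i+y_k}\otimes\overline{[k,i]}w.$$ Here $f^{s_{ki}}$ is $f$ with $y_k$ and $y_i$ exchanged, $f^{\overline s_{ki}}$ is $f$ with $y_k\mapsto-y_i$ and $y_i\mapsto-y_k$,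 $f^{\tau_i}$ is $f$ with $y_i\mapsto-y_i$, and all quotients are polynomials. -/

import Mathlib

open scoped TensorProduct

noncomputable section

namespace SpinDaHa

/-- The classical families. For `n` variables, `A` stands for the Weyl group of type `A_{n-1}`
(the symmetric group `S_n`), `B` for type `B_n` and `D` for type `D_n`. -/
inductive WeylType
  | A
  | B
  | D
  deriving DecidableEq

/-- The number of simple reflections. The simple reflections, the variables `y_i` and the
variables `ξ_i` are numbered from `0`. -/
def rank : WeylType → ℕ → ℕ
  | .A, n => n - 1
  | .B, n => n
  | .D, n => n

/-- The entry `m_{ab}` of the Coxeter matrix, for two simple reflections `a`, `b` (numbered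
from `0`). In each type the nodes `0, …, n-2` form a chain with simple edges. In type `B` the last
node `n-1` is joined to `n-2` by an edge marked `4`; in type `D` the last node `n-1` is joined to
`n-3` by a simple edge. -/
def coxeterEntry (X : WeylType) (n a b : ℕ) : ℕ :=
  if a = b then 1
  else if X = .B ∧ (a + 2 = n ∧ b + 1 = n ∨ b + 2 = n ∧ a + 1 = n) then 4
  else if X = .D ∧ (a + 1 = n ∨ b + 1 = n) then
    (if a + 3 = n ∨ b + 3 = n then 3 else 2)
  else if a + 1 = b ∨ b + 1 = a then 3
  else 2

/-- Relators of the double cover `W~` on the generators `z` (which is `none`) and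
`t~_a` (which is `some a`). -/
inductive CoverRel (X : WeylType) (n : ℕ) : FreeGroup (Option (Fin (rank X n))) → Prop
  | z_sq : CoverRel X n (.of none * .of none)
  | z_central (a : Fin (rank X n)) :
      CoverRel X n (.of none * .of (some a) * (.of (some a) * .of none)⁻¹)
  | t_sq (a : Fin (rank X n)) : CoverRel X n (.of (some a) * .of (some a))
  | two (a b : Fin (rank X n)) (h : coxeterEntry X n a b = 2) :
      CoverRel X n (.of (some a) * .of (some b) *
        (.of none * .of (some b) * .of (some a))⁻¹)
  | three (a b : Fin (rank X n)) (h : coxeterEntry X n a b = 3) :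
      CoverRel X n (.of (some a) * .of (some b) * .of (some a) *
        (.of (some b) * .of (some a) * .of (some b))⁻¹)
  | four (a b : Fin (rank X n)) (h : coxeterEntry X n a b = 4) :
      CoverRel X n ((.of (some a) * .of (some b)) ^ 2 *
        (.of none * (.of (some b) * .of (some a)) ^ 2)⁻¹)

/-- The distinguished double cover `W~` of the Weyl group, by generators and relations. -/
abbrev Cover (X : WeylType) (n : ℕ) : Type :=
  PresentedGroup {w | CoverRel X n w}

/-- The relation `z + 1 = 0` in the group algebra of `W~`. -/
inductive SpinRel (X : WeylType) (n : ℕ) :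
    MonoidAlgebra ℂ (Cover X n) → MonoidAlgebra ℂ (Cover X n) → Prop
  | z_add_one : SpinRel X n
      (MonoidAlgebra.of ℂ (Cover X n) (PresentedGroup.of none) + 1) 0

/-- The spin Weyl group algebra `ℂW⁻ = ℂW~ / ⟨z + 1⟩`. -/
def SpinWeyl (X : WeylType) (n : ℕ) : Type := RingQuot (SpinRel X n)

instance (X : WeylType) (n : ℕ) : Ring (SpinWeyl X n) :=
  inferInstanceAs (Ring (RingQuot (SpinRel X n)))

instance (X : WeylType) (n : ℕ) : Algebra ℂ (SpinWeyl X n) :=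
  inferInstanceAs (Algebra ℂ (RingQuot (SpinRel X n)))

/-- The quotient map `ℂW~ → ℂW⁻`. -/
def spinMk (X : WeylType) (n : ℕ) : MonoidAlgebra ℂ (Cover X n) →ₐ[ℂ] SpinWeyl X n :=
  RingQuot.mkAlgHom ℂ (SpinRel X n)

/-- The generator `t_a` of `ℂW⁻`, the image of `t~_a`, for `a = 0, …, rank - 1`
(and `1`, never used, for other `a`). -/
def t (X : WeylType) (n a : ℕ) : SpinWeyl X n :=
  if h : a < rank X n then
    spinMk X n (MonoidAlgebra.of ℂ (Cover X n) (PresentedGroup.of (some ⟨a, h⟩)))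
  else 1

/-- The ascending product `t_a t_{a+1} ⋯ t_{b-1}` (equal to `1` if `b ≤ a`). -/
def tUp (X : WeylType) (n a b : ℕ) : SpinWeyl X n :=
  ((List.range' a (b - a)).map (t X n)).prod

/-- The descending product `t_{b-1} ⋯ t_{a+1} t_a` (equal to `1` if `b ≤ a`). -/
def tDown (X : WeylType) (n a b : ℕ) : SpinWeyl X n :=
  ((List.range' a (b - a)).reverse.map (t X n)).prod

/-- `[i,j] = (-1)^{j-i-1} t_{j-1} ⋯ t_{i+1} t_i t_{i+1} ⋯ t_{j-1}` for `i < j`,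
and `[j,i] = -[i,j]`. -/
def brk (X : WeylType) (n : ℕ) (i j : Fin n) : SpinWeyl X n :=
  let pos (a b : ℕ) : SpinWeyl X n :=
    (-1) ^ (b - a - 1) * (tDown X n (a + 1) b * t X n a * tUp X n (a + 1) b)
  if i < j then pos i j else if j < i then -pos j i else 0

/-- The elements `\overline{[i,j]} = \overline{[j,i]}` of `ℂW⁻` in types `D` and `B`. For `i < j`,
and with generators numbered from `0`, it is
`(-1)^{j-i-1} (t_j ⋯ t_{n-2}) (t_i ⋯ t_{n-3}) t_{n-1} (t_{n-3} ⋯ t_i) (t_{n-2} ⋯ t_j)` in type `D`,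
and in type `B` the sign is `(-1)^{j-i}` and the middle factor is `t_{n-1} t_{n-2} t_{n-1}`.
(No such element exists in type `A`; the value there is `0` and is not used.) -/
def barBrk (X : WeylType) (n : ℕ) (i j : Fin n) : SpinWeyl X n :=
  let mid : SpinWeyl X n :=
    match X with
    | .A => 0
    | .B => -(t .B n (n - 1) * t .B n (n - 2) * t .B n (n - 1))
    | .D => t .D n (n - 1)
  let pos (a b : ℕ) : SpinWeyl X n :=
    (-1) ^ (b - a - 1) * (tUp X n b (n - 1) * tUp X n a (n - 2) * mid *
      tDown X n a (n - 2) * tDown X n b (n - 1))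
  if i < j then pos i j else if j < i then pos j i else 0

/-- The element `\overline{[i]} = (-1)^{n-1-i} t_i ⋯ t_{n-2} t_{n-1} t_{n-2} ⋯ t_i` of `ℂW⁻` in
type `B`, with `i` and the generators numbered from `0`. -/
def barOne (n : ℕ) (i : Fin n) : SpinWeyl .B n :=
  (-1) ^ (n - 1 - (i : ℕ)) * (tUp .B n i (n - 1) * t .B n (n - 1) * tDown .B n i (n - 1))

/-- Symbols for the generators `ξ_i`, `y_i` and for the elements of `ℂW⁻`. -/
inductive Gen (X : WeylType) (n : ℕ) : Type
  | xi (i : Fin n)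
  | y (i : Fin n)
  | w (s : SpinWeyl X n)

/-- The free algebra on these symbols. -/
abbrev Free (X : WeylType) (n : ℕ) : Type := FreeAlgebra ℂ (Gen X n)

/-- The free generator `ξ_i`. -/
abbrev fxi (X : WeylType) (n : ℕ) (i : Fin n) : Free X n := FreeAlgebra.ι ℂ (.xi i)
/-- The free generator `y_i`. -/
abbrev fy (X : WeylType) (n : ℕ) (i : Fin n) : Free X n := FreeAlgebra.ι ℂ (.y i)
/-- The symbol of `s ∈ ℂW⁻`. -/
abbrev fw {X : WeylType} {n : ℕ} (s : SpinWeyl X n) : Free X n := FreeAlgebra.ι ℂ (.w s)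

/-- Defining relations, common to the three types: `ℂW⁻` maps to the algebra by a homomorphism,
the relations among the `y_i` and among the `ξ_i`, and the relations of the `y_i` and `ξ_i` with
`t_a` for the simple transpositions (numbers `a` with `a + 1 < n`, exchanging `a` and `a + 1`). -/
inductive CommonRel (X : WeylType) (n : ℕ) : Free X n → Free X n → Prop
  | w_add (r s : SpinWeyl X n) : CommonRel X n (fw (r + s)) (fw r + fw s)
  | w_mul (r s : SpinWeyl X n) : CommonRel X n (fw (r * s)) (fw r * fw s)
  | w_scalar (c : ℂ) :
      CommonRel X n (fw (algebraMap ℂ (SpinWeyl X n) c)) (algebraMap ℂ (Free X n) c)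
  | y_comm (i j : Fin n) : CommonRel X n (fy X n i * fy X n j) (fy X n j * fy X n i)
  | xi_anti (i j : Fin n) (h : i ≠ j) :
      CommonRel X n (fxi X n i * fxi X n j) (-(fxi X n j * fxi X n i))
  | t_y (i j : Fin n) (h : (i : ℕ) + 1 = j) :
      CommonRel X n (fw (t X n i) * fy X n i) (fy X n j * fw (t X n i))
  | t_xi (i j : Fin n) (h : (i : ℕ) + 1 = j) :
      CommonRel X n (fw (t X n i) * fxi X n i) (-(fxi X n j * fw (t X n i)))
  | t_y_far (a : ℕ) (j : Fin n) (ha : a + 1 < n) (h : (j : ℕ) ≠ a) (h' : (j : ℕ) ≠ a + 1) :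
      CommonRel X n (fw (t X n a) * fy X n j) (fy X n j * fw (t X n a))
  | t_xi_far (a : ℕ) (j : Fin n) (ha : a + 1 < n) (h : (j : ℕ) ≠ a) (h' : (j : ℕ) ≠ a + 1) :
      CommonRel X n (fw (t X n a) * fxi X n j) (-(fxi X n j * fw (t X n a)))

/-- Defining relations in type `A_{n-1}`. Throughout, `⁅a, b⁆ = a * b - b * a`. -/
inductive RelA (n : ℕ) (u : ℂ) : Free .A n → Free .A n → Prop
  | common {a b : Free .A n} (h : CommonRel .A n a b) : RelA n u a b
  | cross (i j : Fin n) (h : i ≠ j) :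
      RelA n u ⁅fy .A n j, fxi .A n i⁆ (-(u • fw (brk .A n i j)))
  | diag (i : Fin n) :
      RelA n u ⁅fy .A n i, fxi .A n i⁆ (u • ∑ k ∈ Finset.univ.erase i, fw (brk .A n i k))

/-- Defining relations in type `B_n`; the last generator is `t_{n-1}`. -/
inductive RelB (n : ℕ) (u v : ℂ) : Free .B n → Free .B n → Prop
  | common {a b : Free .B n} (h : CommonRel .B n a b) : RelB n u v a b
  | tn_y (i : Fin n) (h : (i : ℕ) + 1 = n) :
      RelB n u v (fw (t .B n (n - 1)) * fy .B n i) (-(fy .B n i * fw (t .B n (n - 1))))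
  | tn_xi (i : Fin n) (h : (i : ℕ) + 1 = n) :
      RelB n u v (fw (t .B n (n - 1)) * fxi .B n i) (-(fxi .B n i * fw (t .B n (n - 1))))
  | tn_y_far (j : Fin n) (h : (j : ℕ) + 1 ≠ n) :
      RelB n u v (fw (t .B n (n - 1)) * fy .B n j) (fy .B n j * fw (t .B n (n - 1)))
  | tn_xi_far (j : Fin n) (h : (j : ℕ) + 1 ≠ n) :
      RelB n u v (fw (t .B n (n - 1)) * fxi .B n j) (-(fxi .B n j * fw (t .B n (n - 1))))
  | cross (i j : Fin n) (h : i ≠ j) :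
      RelB n u v ⁅fy .B n j, fxi .B n i⁆
        (-(u • fw (brk .B n i j)) + u • fw (barBrk .B n i j))
  | diag (i : Fin n) :
      RelB n u v ⁅fy .B n i, fxi .B n i⁆
        (u • ∑ k ∈ Finset.univ.erase i, (fw (brk .B n i k) + fw (barBrk .B n i k)) +
          v • fw (barOne n i))

/-- Defining relations in type `D_n`; the last generator is `t_{n-1}`. -/
inductive RelD (n : ℕ) (u : ℂ) : Free .D n → Free .D n → Prop
  | common {a b : Free .D n} (h : CommonRel .D n a b) : RelD n u a b
  | tn_y (i j : Fin n) (hi : (i : ℕ) + 1 = n) (hj : (j : ℕ) + 2 = n) :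
      RelD n u (fw (t .D n (n - 1)) * fy .D n i) (-(fy .D n j * fw (t .D n (n - 1))))
  | tn_xi (i j : Fin n) (hi : (i : ℕ) + 1 = n) (hj : (j : ℕ) + 2 = n) :
      RelD n u (fw (t .D n (n - 1)) * fxi .D n i) (-(fxi .D n j * fw (t .D n (n - 1))))
  | tn_y_far (j : Fin n) (h : (j : ℕ) + 1 ≠ n) (h' : (j : ℕ) + 2 ≠ n) :
      RelD n u (fw (t .D n (n - 1)) * fy .D n j) (fy .D n j * fw (t .D n (n - 1)))
  | tn_xi_far (j : Fin n) (h : (j : ℕ) + 1 ≠ n) (h' : (j : ℕ) + 2 ≠ n) :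
      RelD n u (fw (t .D n (n - 1)) * fxi .D n j) (-(fxi .D n j * fw (t .D n (n - 1))))
  | cross (i j : Fin n) (h : i ≠ j) :
      RelD n u ⁅fy .D n j, fxi .D n i⁆
        (-(u • fw (brk .D n i j)) + u • fw (barBrk .D n i j))
  | diag (i : Fin n) :
      RelD n u ⁅fy .D n i, fxi .D n i⁆
        (u • ∑ k ∈ Finset.univ.erase i, (fw (brk .D n i k) + fw (barBrk .D n i k)))

/-- Type and parameters of a rational spin double affine Hecke algebra. -/
inductive Datum : WeylType → Type
  | A (u : ℂ) : Datum .A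
  | B (u v : ℂ) : Datum .B
  | D (u : ℂ) : Datum .D

/-- All defining relations, for each type and parameters. -/
def Rel {X : WeylType} (n : ℕ) : Datum X → Free X n → Free X n → Prop
  | .A u => RelA n u
  | .B u v => RelB n u v
  | .D u => RelD n u

theorem Rel.of_common {X : WeylType} {n : ℕ} (d : Datum X) {a b : Free X n}
    (h : CommonRel X n a b) : Rel n d a b := by
  cases d
  · exact RelA.common h
  · exact RelB.common h
  · exact RelD.common h

/-- The rational spin double affine Hecke algebra: the algebra generated by `ξ_i`, `y_i` and
`ℂW⁻` subject to the defining relations. -/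
def SDaHa {X : WeylType} (n : ℕ) (d : Datum X) : Type := RingQuot (Rel n d)

/-- Evaluation of polynomials at pairwise commuting elements of an algebra (it takes values in the
commutative subalgebra that these elements generate). -/
def commEval {n : ℕ} {H : Type} [Ring H] [Algebra ℂ H] (y : Fin n → H)
    (hy : ∀ i j, y i * y j = y j * y i) : MvPolynomial (Fin n) ℂ →ₐ[ℂ] H :=
  haveI : IsMulCommutative (Algebra.adjoin ℂ (Set.range y)) :=
    Algebra.isMulCommutative_adjoin ℂ (by
      rintro _ ⟨i, rfl⟩ _ ⟨j, rfl⟩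
      exact hy i j)
  letI : CommSemiring (Algebra.adjoin ℂ (Set.range y)) :=
    { (Algebra.adjoin ℂ (Set.range y)).toSemiring with mul_comm := fun a b => this.1.1 a b }
  (Algebra.adjoin ℂ (Set.range y)).val.comp
    (MvPolynomial.aeval (R := ℂ) (S₁ := Algebra.adjoin ℂ (Set.range y)) fun i : Fin n =>
      (⟨y i, Algebra.subset_adjoin ⟨i, rfl⟩⟩ : Algebra.adjoin ℂ (Set.range y)))

theorem commEval_X {n : ℕ} {H : Type} [Ring H] [Algebra ℂ H] (y : Fin n → H)
    (hy : ∀ i j, y i * y j = y j * y i) (i : Fin n) :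
    commEval y hy (MvPolynomial.X i) = y i := by
  simp [commEval]

section Algebra

variable {X : WeylType} {n : ℕ} (d : Datum X)

instance : Ring (SDaHa n d) := inferInstanceAs (Ring (RingQuot (Rel n d)))

instance : Algebra ℂ (SDaHa n d) := inferInstanceAs (Algebra ℂ (RingQuot (Rel n d)))

/-- The quotient map from the free algebra. -/
def mk : Free X n →ₐ[ℂ] SDaHa n d := RingQuot.mkAlgHom ℂ (Rel n d)

theorem mk_eq {a b : Free X n} (h : Rel n d a b) : mk d a = mk d b :=
  RingQuot.mkAlgHom_rel ℂ h

/-- The element `ξ_i`. -/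
def xi (i : Fin n) : SDaHa n d := mk d (fxi X n i)

/-- The element `y_i`. -/
def y (i : Fin n) : SDaHa n d := mk d (fy X n i)

/-- The canonical homomorphism from `ℂW⁻`. -/
def ofSpin : SpinWeyl X n →ₐ[ℂ] SDaHa n d where
  toFun s := mk d (fw s)
  map_one' := by
    have h := mk_eq d (Rel.of_common d (CommonRel.w_scalar (X := X) (n := n) 1))
    simpa only [map_one] using h
  map_mul' r s := by
    simpa only [map_mul] using mk_eq d (Rel.of_common d (CommonRel.w_mul r s))
  map_zero' := by
    have h := mk_eq d (Rel.of_common d (CommonRel.w_scalar (X := X) (n := n) 0))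
    simpa only [map_zero] using h
  map_add' r s := by
    simpa only [map_add] using mk_eq d (Rel.of_common d (CommonRel.w_add r s))
  commutes' c := by
    simpa only [AlgHom.commutes] using
      mk_eq d (Rel.of_common d (CommonRel.w_scalar (X := X) (n := n) c))

theorem y_comm (i j : Fin n) : y d i * y d j = y d j * y d i := by
  simpa only [map_mul, y] using mk_eq d (Rel.of_common d (CommonRel.y_comm i j))

/-- The subalgebra generated by the `ξ_i` and `ℂW⁻`. -/
def hXi (n : ℕ) (d : Datum X) : Subalgebra ℂ (SDaHa n d) :=
  Algebra.adjoin ℂ (Set.range (xi d) ∪ Set.range (ofSpin d))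

theorem xi_mem (i : Fin n) : xi d i ∈ hXi n d :=
  Algebra.subset_adjoin (Or.inl ⟨i, rfl⟩)

theorem ofSpin_mem (s : SpinWeyl X n) : ofSpin d s ∈ hXi n d :=
  Algebra.subset_adjoin (Or.inr ⟨s, rfl⟩)

/-- The canonical algebra homomorphism `ℂ[y_1, …, y_n] → SDaHa`, sending `y_i` to `y_i`. -/
def polyHom : MvPolynomial (Fin n) ℂ →ₐ[ℂ] SDaHa n d :=
  commEval (y d) (y_comm d)

theorem polyHom_X (i : Fin n) : polyHom d (MvPolynomial.X i) = y d i :=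
  commEval_X _ _ i

section Induced

variable {V : Type*} [AddCommGroup V] [Module ℂ V] [Module (SpinWeyl X n) V]
  [IsScalarTower ℂ (SpinWeyl X n) V]

/-- An action `ρ` of the subalgebra generated by the `ξ_i` and `ℂW⁻` on the `ℂW⁻`-module `V`
extends the given action of `ℂW⁻`, and each `ξ_i` acts by zero. -/
def IsTrivialExtension (ρ : hXi n d →ₐ[ℂ] Module.End ℂ V) : Prop :=
  (∀ (s : SpinWeyl X n) (w : V), ρ ⟨ofSpin d s, ofSpin_mem d s⟩ w = s • w) ∧
    ∀ i : Fin n, ρ ⟨xi d i, xi_mem d i⟩ = 0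

end Induced

section Induction

variable {d}
variable {V : Type*} [AddCommGroup V] [Module ℂ V]

/-- The relations `(h a) ⊗ w = h ⊗ (a w)` of the balanced tensor product, with `a` in the
subalgebra. -/
def balanced (ρ : hXi n d →ₐ[ℂ] Module.End ℂ V) : Submodule (SDaHa n d) (SDaHa n d ⊗[ℂ] V) :=
  Submodule.span (SDaHa n d)
    {x | ∃ (h : SDaHa n d) (a : hXi n d) (w : V),
      x = (h * (a : SDaHa n d)) ⊗ₜ[ℂ] w - h ⊗ₜ[ℂ] (ρ a w)}

/-- The induced module `SDaHa ⊗ V`, the tensor product being over the subalgebra generated by the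
`ξ_i` and `ℂW⁻`, which acts on `V` by `ρ`; it is a left module over `SDaHa`. -/
abbrev Induced (ρ : hXi n d →ₐ[ℂ] Module.End ℂ V) : Type _ :=
  (SDaHa n d ⊗[ℂ] V) ⧸ balanced ρ

/-- The canonical linear map `ℂ[y_1, …, y_n] ⊗ V → SDaHa ⊗ V`, `f ⊗ w ↦ f ⊗ w`, to the induced
module. -/
def canon (ρ : hXi n d →ₐ[ℂ] Module.End ℂ V) :
    MvPolynomial (Fin n) ℂ ⊗[ℂ] V →ₗ[ℂ] Induced ρ :=
  ((balanced ρ).mkQ.restrictScalars ℂ).comp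
    (TensorProduct.map (polyHom d).toLinearMap LinearMap.id)

end Induction

end Algebra

section Reflections

open MvPolynomial

variable {n : ℕ}

/-- `f ↦ f^{s_{ki}}`: exchange `y_k` and `y_i`. -/
def actS (k i : Fin n) : MvPolynomial (Fin n) ℂ →ₐ[ℂ] MvPolynomial (Fin n) ℂ :=
  rename (Equiv.swap k i)

/-- `f ↦ f^{\overline{s}_{ki}}`: `y_k ↦ -y_i` and `y_i ↦ -y_k`, other variables fixed. -/
def actSbar (k i : Fin n) : MvPolynomial (Fin n) ℂ →ₐ[ℂ] MvPolynomial (Fin n) ℂ :=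
  aeval fun j => if j = k then -X i else if j = i then -X k else X j

/-- `f ↦ f^{τ_i}`: `y_i ↦ -y_i`, other variables fixed. -/
def actTau (i : Fin n) : MvPolynomial (Fin n) ℂ →ₐ[ℂ] MvPolynomial (Fin n) ℂ :=
  aeval fun j => if j = i then -X i else X j

theorem dvd_sub_algHom (φ : MvPolynomial (Fin n) ℂ →ₐ[ℂ] MvPolynomial (Fin n) ℂ)
    (p : MvPolynomial (Fin n) ℂ) (h : ∀ j, p ∣ X j - φ (X j)) (f : MvPolynomial (Fin n) ℂ) :
    p ∣ f - φ f := by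
  induction f using MvPolynomial.induction_on with
  | C a =>
    have : φ (C a) = C a := φ.commutes a
    simp [this]
  | add f g hf hg =>
    have : f + g - φ (f + g) = (f - φ f) + (g - φ g) := by rw [map_add]; ring
    rw [this]; exact dvd_add hf hg
  | mul_X f j hf =>
    have : f * X j - φ (f * X j) = f * (X j - φ (X j)) + (f - φ f) * φ (X j) := by
      rw [map_mul]; ring
    rw [this]; exact dvd_add (dvd_mul_of_dvd_right (h j) _) (dvd_mul_of_dvd_left hf _)

theorem dvd_sub_actS (k i : Fin n) (f : MvPolynomial (Fin n) ℂ) :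
    (X i - X k) ∣ f - actS k i f := by
  refine dvd_sub_algHom _ _ (fun j => ?_) f
  simp only [actS, rename_X]
  rcases eq_or_ne j k with rfl | hk
  · rw [Equiv.swap_apply_left]; exact ⟨-1, by ring⟩
  rcases eq_or_ne j i with rfl | hi
  · rw [Equiv.swap_apply_right]
  · rw [Equiv.swap_apply_of_ne_of_ne hk hi, sub_self]; exact dvd_zero _

theorem dvd_sub_actSbar (k i : Fin n) (f : MvPolynomial (Fin n) ℂ) :
    (X i + X k) ∣ f - actSbar k i f := by
  refine dvd_sub_algHom _ _ (fun j => ?_) f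
  simp only [actSbar, aeval_X]
  split_ifs with hk hi
  · subst hk; exact ⟨1, by ring⟩
  · subst hi; exact ⟨1, by ring⟩
  · simp

theorem dvd_sub_actTau (i : Fin n) (f : MvPolynomial (Fin n) ℂ) :
    (2 * X i) ∣ f - actTau i f := by
  refine dvd_sub_algHom _ _ (fun j => ?_) f
  simp only [actTau, aeval_X]
  split_ifs with hi
  · subst hi; exact ⟨1, by ring⟩
  · simp

/-- The polynomial `(f - f^{s_{ki}}) / (y_i - y_k)`, for `k ≠ i`. -/
def quotS (k i : Fin n) (f : MvPolynomial (Fin n) ℂ) : MvPolynomial (Fin n) ℂ :=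
  (dvd_sub_actS k i f).choose

/-- The polynomial `(f - f^{\overline{s}_{ki}}) / (y_i + y_k)`, for `k ≠ i`. -/
def quotSbar (k i : Fin n) (f : MvPolynomial (Fin n) ℂ) : MvPolynomial (Fin n) ℂ :=
  (dvd_sub_actSbar k i f).choose

/-- The polynomial `(f - f^{τ_i}) / (2 y_i)`. -/
def quotTau (i : Fin n) (f : MvPolynomial (Fin n) ℂ) : MvPolynomial (Fin n) ℂ :=
  (dvd_sub_actTau i f).choose

theorem quotS_spec (k i : Fin n) (f : MvPolynomial (Fin n) ℂ) :
    (X i - X k) * quotS k i f = f - actS k i f :=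
  (dvd_sub_actS k i f).choose_spec.symm

theorem quotSbar_spec (k i : Fin n) (f : MvPolynomial (Fin n) ℂ) :
    (X i + X k) * quotSbar k i f = f - actSbar k i f :=
  (dvd_sub_actSbar k i f).choose_spec.symm

theorem quotTau_spec (i : Fin n) (f : MvPolynomial (Fin n) ℂ) :
    (2 * X i) * quotTau i f = f - actTau i f :=
  (dvd_sub_actTau i f).choose_spec.symm

end Reflections

end SpinDaHa

end

open SpinDaHa

/-! Everything follows from one representation. On `ℂ[y] ⊗ V` let `y_j` act by multiplication, `t_a`
diagonally by `s_a ⊗ t_a`, and `ξ_i` by the Dunkl operator `D_i = dunkl V d i`. These operators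
satisfy the defining relations (`dunkl_realization`), so the whole algebra acts (`dunklRep`); no PBW
theorem is needed.

Every `D_i` kills `1 ⊗ V` and `ℂW⁻` preserves it, so `1 ⊗ V` is a copy of `V` stable under the
subalgebra of the `ξ_i` and `ℂW⁻`. This is the required extension; it is unique because it is
prescribed on generators. The map `h ⊗ w ↦ h (1 ⊗ w)` vanishes on the balanced relations and is a
left inverse of `canon`, which is therefore injective. Conversely `canon` is linear over the algebra
(`canon_dunklRep`), so the class of `h ⊗ w` is `canon` of `h (1 ⊗ w)` and `canon` is surjective.
Linearity for `h = ξ_i` is the Dunkl formula.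

Among the relations, `[y_j, D_i] = [y_j, ξ_i]` is the twisted Leibniz rule for divided differences
(`mulY_dunkl`). The expressions `t_a D_i + D_{π i} t_a` and `D_i D_j + D_j D_i` kill `1 ⊗ V` and are
intertwined by multiplications by the variables, hence vanish (`eq_zero_of_mulY`). The intertwining
needs two facts about the commutators `[y_j, ξ_i]`, which lie in `ℂW⁻`: generators permute them up
to sign (`GenAct.twist_crossComm`), and they satisfy a Jacobi-type identity (`crossComm_anticomm`).
Both come down to how `t_a` anticommutes past `[i,j]`, `\overline{[i,j]}` and `\overline{[i]}`,
which is computed from the braid relations of a chain with an extra last node.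

The three types are handled together: the barred elements are `0` in type `A`, the short ones `0`
outside type `B`. -/

noncomputable section

namespace SpinDaHa

/-! ### The spin Weyl group algebra: relations, universal property, induction. -/

section SpinAlgebra

variable {X : WeylType} {n : ℕ}

/-- The image of the central element `z` in the spin Weyl group algebra is `-1`. -/
theorem spinMk_z : spinMk X n (MonoidAlgebra.of ℂ (Cover X n) (PresentedGroup.of none)) = -1 := by
  have h : spinMk X n (MonoidAlgebra.of ℂ (Cover X n) (PresentedGroup.of none) + 1) =
      spinMk X n 0 := RingQuot.mkAlgHom_rel ℂ SpinRel.z_add_one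
  rw [map_add, map_one, map_zero] at h
  exact eq_neg_of_add_eq_zero_left h

theorem t_of_lt {a : ℕ} (h : a < rank X n) : t X n a =
    spinMk X n (MonoidAlgebra.of ℂ (Cover X n) (PresentedGroup.of (some ⟨a, h⟩))) :=
  dif_pos h

/-- The multiplicative map from the double cover to the spin Weyl group algebra. -/
def coverHom (X : WeylType) (n : ℕ) : Cover X n →* SpinWeyl X n :=
  (spinMk X n : MonoidAlgebra ℂ (Cover X n) →* SpinWeyl X n).comp
    (MonoidAlgebra.of ℂ (Cover X n))

theorem coverHom_none : coverHom X n (PresentedGroup.of none) = -1 := spinMk_z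

theorem coverHom_some (a : Fin (rank X n)) :
    coverHom X n (PresentedGroup.of (some a)) = t X n a := (t_of_lt a.2).symm

theorem cover_rel {v w : FreeGroup (Option (Fin (rank X n)))} (h : CoverRel X n (v * w⁻¹)) :
    PresentedGroup.mk {w | CoverRel X n w} v = PresentedGroup.mk {w | CoverRel X n w} w := by
  have := PresentedGroup.one_of_mem (rels := {w | CoverRel X n w}) h
  rw [map_mul, map_inv] at this
  exact mul_inv_eq_one.1 this

theorem mk_freeGroup_of (o : Option (Fin (rank X n))) :
    PresentedGroup.mk {w | CoverRel X n w} (FreeGroup.of o) = PresentedGroup.of o := rfl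

theorem t_sq {a : ℕ} (h : a < rank X n) : t X n a * t X n a = 1 := by
  have := PresentedGroup.one_of_mem (rels := {w | CoverRel X n w}) (CoverRel.t_sq ⟨a, h⟩)
  have := congrArg (coverHom X n) this
  simpa only [map_mul, mk_freeGroup_of, coverHom_some, map_one] using this

theorem t_two {a b : ℕ} (ha : a < rank X n) (hb : b < rank X n) (h : coxeterEntry X n a b = 2) :
    t X n a * t X n b = -(t X n b * t X n a) := by
  have := congrArg (coverHom X n) (cover_rel (CoverRel.two ⟨a, ha⟩ ⟨b, hb⟩ h))
  simpa only [map_mul, mk_freeGroup_of, coverHom_some, coverHom_none, neg_mul, one_mul] using this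

theorem t_three {a b : ℕ} (ha : a < rank X n) (hb : b < rank X n) (h : coxeterEntry X n a b = 3) :
    t X n a * t X n b * t X n a = t X n b * t X n a * t X n b := by
  have := congrArg (coverHom X n) (cover_rel (CoverRel.three ⟨a, ha⟩ ⟨b, hb⟩ h))
  simpa only [map_mul, mk_freeGroup_of, coverHom_some, coverHom_none] using this

theorem t_four {a b : ℕ} (ha : a < rank X n) (hb : b < rank X n) (h : coxeterEntry X n a b = 4) :
    (t X n a * t X n b) ^ 2 = -(t X n b * t X n a) ^ 2 := by
  have := congrArg (coverHom X n) (cover_rel (CoverRel.four ⟨a, ha⟩ ⟨b, hb⟩ h))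
  simpa only [map_mul, map_pow, mk_freeGroup_of, coverHom_some, coverHom_none, neg_mul,
    one_mul] using this

/-- Two homomorphisms from the spin Weyl group algebra that agree on the `t_a` are equal. -/
theorem spin_hom_ext {B : Type*} [Ring B] [Algebra ℂ B] {φ ψ : SpinWeyl X n →ₐ[ℂ] B}
    (h : ∀ a < rank X n, φ (t X n a) = ψ (t X n a)) : φ = ψ := by
  refine RingQuot.ringQuot_ext' (s := SpinRel X n) ℂ φ ψ ?_
  -- Extensionality on a presented group needs a group as target, so each homomorphism is restricted
  -- to the cover with values in the units of `B`.
  have key : ∀ χ : SpinWeyl X n →ₐ[ℂ] B, ∃ χ' : Cover X n →* Bˣ,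
      (∀ g, (χ' g : B) = χ (coverHom X n g)) := fun χ =>
    ⟨((χ : SpinWeyl X n →* B).comp (coverHom X n)).toHomUnits, fun g => rfl⟩
  obtain ⟨φ', hφ⟩ := key φ
  obtain ⟨ψ', hψ⟩ := key ψ
  have e : φ' = ψ' := by
    refine PresentedGroup.ext fun o => ?_
    ext
    rw [hφ, hψ]
    cases o with
    | none => rw [coverHom_none, map_neg, map_neg, map_one, map_one]
    | some a => rw [coverHom_some]; exact h a a.2
  refine MonoidAlgebra.algHom_ext (M := Cover X n) (R := ℂ) (B := B) (fun g => ?_) (by ext)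
  exact (hφ g).symm.trans ((congrArg (fun χ : Cover X n →* Bˣ => (χ g : B)) e).trans (hψ g))

/-- Elements of an algebra that satisfy the spin Coxeter relations. -/
structure SpinFamily (X : WeylType) (n : ℕ) {B : Type*} [Ring B] (τ : ℕ → B) : Prop where
  sq : ∀ a < rank X n, τ a * τ a = 1
  two : ∀ a < rank X n, ∀ b < rank X n, coxeterEntry X n a b = 2 → τ a * τ b = -(τ b * τ a)
  three : ∀ a < rank X n, ∀ b < rank X n, coxeterEntry X n a b = 3 →
    τ a * τ b * τ a = τ b * τ a * τ b
  four : ∀ a < rank X n, ∀ b < rank X n, coxeterEntry X n a b = 4 →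
    (τ a * τ b) ^ 2 = -(τ b * τ a) ^ 2

/-- The units attached to the generators of the double cover by a spin family. -/
def SpinFamily.unit {B : Type*} [Ring B] {τ : ℕ → B} (h : SpinFamily X n τ) :
    Option (Fin (rank X n)) → Bˣ
  | none => -1
  | some a => ⟨τ a, τ a, h.sq a a.2, h.sq a a.2⟩

theorem SpinFamily.unit_rel {B : Type*} [Ring B] {τ : ℕ → B} (h : SpinFamily X n τ) :
    ∀ r ∈ {w | CoverRel X n w}, FreeGroup.lift h.unit r = 1 := by
  intro r hr
  have e : ∀ a : Fin (rank X n), (h.unit (some a) : B) = τ a := fun _ => rfl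
  have e' : (h.unit none : B) = -1 := rfl
  cases hr with
  | z_sq => ext; simp [e']
  | z_central a =>
    rw [map_mul, map_inv, mul_inv_eq_one]; ext; simp [e, e']
  | t_sq a => ext; simp [e, h.sq a a.2]
  | two a b hab =>
    rw [map_mul _ _ (_)⁻¹, map_inv, mul_inv_eq_one]; ext
    simpa [e, e'] using h.two a a.2 b b.2 hab
  | three a b hab =>
    rw [map_mul _ _ (_)⁻¹, map_inv, mul_inv_eq_one]; ext
    simpa [e, e'] using h.three a a.2 b b.2 hab
  | four a b hab =>
    rw [map_mul _ _ (_)⁻¹, map_inv, mul_inv_eq_one]; ext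
    simpa [e, e'] using h.four a a.2 b b.2 hab

/-- The homomorphism from the spin Weyl group algebra given by a spin family. -/
def SpinFamily.lift {B : Type*} [Ring B] [Algebra ℂ B] {τ : ℕ → B} (h : SpinFamily X n τ) :
    SpinWeyl X n →ₐ[ℂ] B :=
  RingQuot.liftAlgHom ℂ ⟨MonoidAlgebra.lift ℂ B (Cover X n)
    ((Units.coeHom B).comp (PresentedGroup.toGroup h.unit_rel)), by
      intro x y hxy
      cases hxy
      simp [SpinFamily.unit]⟩

theorem SpinFamily.lift_t {B : Type*} [Ring B] [Algebra ℂ B] {τ : ℕ → B} (h : SpinFamily X n τ)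
    {a : ℕ} (ha : a < rank X n) : h.lift (t X n a) = τ a := by
  rw [t_of_lt ha]
  refine (RingQuot.liftAlgHom_mkAlgHom_apply _ _ _ _).trans ?_
  simp [SpinFamily.unit]

/-- Induction on elements of the spin Weyl group algebra. -/
theorem spin_induction (A : Subalgebra ℂ (SpinWeyl X n)) (h : ∀ a < rank X n, t X n a ∈ A)
    (s : SpinWeyl X n) : s ∈ A := by
  let τ : ℕ → A := fun a => if ha : a < rank X n then ⟨t X n a, h a ha⟩ else 1
  have e : ∀ a < rank X n, (τ a : SpinWeyl X n) = t X n a := fun a ha => by simp [τ, ha]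
  have hτ : SpinFamily X n τ :=
    { sq := fun a ha => Subtype.ext (by simpa [e a ha] using t_sq ha)
      two := fun a ha b hb hab => Subtype.ext (by simpa [e a ha, e b hb] using t_two ha hb hab)
      three := fun a ha b hb hab => Subtype.ext (by simpa [e a ha, e b hb] using t_three ha hb hab)
      four := fun a ha b hb hab => Subtype.ext (by simpa [e a ha, e b hb] using t_four ha hb hab) }
  -- The generators, seen in `A`, define a homomorphism into `A`. Followed by the inclusion it fixes
  -- every `t_a`, so it is the identity, and its values lie in `A`.
  have : A.val.comp hτ.lift = AlgHom.id ℂ _ := spin_hom_ext fun a ha => by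
    rw [AlgHom.comp_apply, hτ.lift_t ha]; exact e a ha
  rw [← AlgHom.id_apply (R := ℂ) s, ← this]
  exact (hτ.lift s).2

end SpinAlgebra

/-! ### Twisted commutation and the elements attached to roots of a chain. -/

section Twisted

variable {R : Type*} [Ring R]

/-- `a` anticommutes past `x`, turning it into `x'`. -/
def TwistBy (a x x' : R) : Prop := a * x = -(x' * a)

theorem TwistBy.neg {a x x' : R} (h : TwistBy a x x') : TwistBy a (-x) (-x') := by
  unfold TwistBy at *
  rw [mul_neg, h, neg_mul]

theorem TwistBy.neg_left {a x x' : R} (h : TwistBy a x x') : TwistBy (-a) x x' := by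
  unfold TwistBy at *
  rw [neg_mul, h, mul_neg]

theorem TwistBy.add {a x x' y y' : R} (h : TwistBy a x x') (h' : TwistBy a y y') :
    TwistBy a (x + y) (x' + y') := by
  unfold TwistBy at *
  rw [mul_add, h, h', add_mul, neg_add]

theorem TwistBy.add_left {a b x x' : R} (h : TwistBy a x x') (h' : TwistBy b x x') :
    TwistBy (a + b) x x' := by
  unfold TwistBy at *
  rw [add_mul, h, h', mul_add, neg_add]

/-- Composition of twisted commutations along a product of three factors. -/
theorem TwistBy.mul_left₃ {a b c x x₁ x₂ x₃ : R} (hc : TwistBy c x x₁) (hb : TwistBy b x₁ x₂)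
    (ha : TwistBy a x₂ x₃) : TwistBy (a * b * c) x x₃ := by
  unfold TwistBy at *
  rw [mul_assoc, hc, mul_neg, ← mul_assoc, mul_assoc a, hb, mul_neg, ← mul_assoc, ha]
  simp only [neg_mul, neg_neg, mul_assoc]

theorem TwistBy.zero (a : R) : TwistBy a 0 0 := by simp [TwistBy]

theorem TwistBy.zero_left (x x' : R) : TwistBy 0 x x' := by simp [TwistBy]

theorem TwistBy.sum {ι : Type*} {a : R} {s : Finset ι} {f g : ι → R}
    (h : ∀ k ∈ s, TwistBy a (f k) (g k)) : TwistBy a (∑ k ∈ s, f k) (∑ k ∈ s, g k) := by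
  unfold TwistBy at *
  rw [Finset.mul_sum, Finset.sum_mul, ← Finset.sum_neg_distrib]
  exact Finset.sum_congr rfl h

theorem TwistBy.smul {S : Type*} [CommRing S] [Algebra S R] {a x x' : R} (c : S)
    (h : TwistBy a x x') :
    TwistBy a (c • x) (c • x') := by
  unfold TwistBy at *
  rw [mul_smul_comm, h, smul_mul_assoc, smul_neg]

/-- Conjugation preserves twisted commutation. -/
theorem TwistBy.conj {a s s' x x' : R} (hs : TwistBy a s s') (hx : TwistBy a x x') :
    TwistBy a (s * x * s) (s' * x' * s') := by
  unfold TwistBy at *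
  calc a * (s * x * s) = (a * s) * x * s := by simp only [mul_assoc]
    _ = -(s' * (a * x) * s) := by rw [hs]; simp only [neg_mul, mul_assoc]
    _ = s' * x' * (a * s) := by rw [hx]; simp only [neg_mul, mul_neg, neg_neg, mul_assoc]
    _ = _ := by rw [hs]; simp only [mul_neg, mul_assoc]

theorem TwistBy.symm {a x x' : R} (ha : a * a = 1) (h : TwistBy a x x') : TwistBy a x' x := by
  unfold TwistBy at *
  calc a * x' = a * (x' * a) * a := by simp only [mul_assoc, ha, mul_one]
    _ = a * (-(a * x)) * a := by rw [h, neg_neg]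
    _ = -((a * a) * x * a) := by simp only [mul_neg, neg_mul, mul_assoc]
    _ = _ := by rw [ha, one_mul]

theorem TwistBy.swap {a x : R} (h : TwistBy a x x) : TwistBy x a a := by
  unfold TwistBy at *
  rw [h, neg_neg]

/-- The elements twisted into `x` are the conjugates `-(a x a)`. -/
theorem twistBy_conj {a : R} (ha : a * a = 1) (x : R) : TwistBy a x (-(a * x * a)) := by
  unfold TwistBy
  rw [neg_mul, neg_neg, mul_assoc, ha, mul_one]

theorem TwistBy.eq {a x x' : R} (ha : a * a = 1) (h : TwistBy a x x') : x' = -(a * x * a) := by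
  unfold TwistBy at *
  rw [h, neg_mul, neg_neg, mul_assoc, ha, mul_one]

/-- If `a`, `s` satisfy the braid relation and `s` anticommutes with `x`, then `a` anticommutes
with `s a x a s`. -/
theorem TwistBy.braid {a s x : R} (h : a * s * a = s * a * s)
    (hx : TwistBy s x x) : TwistBy a (s * (a * x * a) * s) (s * (a * x * a) * s) := by
  unfold TwistBy at *
  calc a * (s * (a * x * a) * s) = (a * s * a) * x * a * s := by simp only [mul_assoc]
    _ = s * a * (s * x) * a * s := by rw [h]; simp only [mul_assoc]
    _ = -(s * a * x * (s * a * s)) := by rw [hx]; simp only [mul_assoc, mul_neg, neg_mul]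
    _ = _ := by rw [← h]; simp only [mul_assoc]

/-- Elements satisfying the spin Coxeter relations of a chain with `N` nodes. -/
structure SpinChain (N : ℕ) (t : ℕ → R) : Prop where
  sq : ∀ a < N, t a * t a = 1
  braid : ∀ a, a + 1 < N → t a * t (a + 1) * t a = t (a + 1) * t a * t (a + 1)
  far : ∀ a b, a + 1 < b → b < N → TwistBy (t a) (t b) (t b)

theorem SpinChain.far' {N : ℕ} {t : ℕ → R} (h : SpinChain N t) (a b : ℕ) (hab : a + 1 < b)
    (hb : b < N) : TwistBy (t b) (t a) (t a) :=
  (h.far a b hab hb).swap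

/-- The elements attached to the positive roots of a chain. -/
structure ChainRoots (N : ℕ) (t : ℕ → R) (p : ℕ → ℕ → R) : Prop extends SpinChain N t where
  base : ∀ i < N, p i (i + 1) = t i
  step : ∀ i j, i < j → j < N → p i (j + 1) = -(t j * p i j * t j)

namespace ChainRoots

variable {N : ℕ} {t : ℕ → R} {p : ℕ → ℕ → R} (h : ChainRoots N t p)
include h

/-- An element anticommuting with the generators involved anticommutes with `p i j`. -/
theorem twist_of_forall {x : R} {i j : ℕ} (hij : i < j) (hj : j ≤ N)
    (hx : ∀ b, i ≤ b → b < j → TwistBy x (t b) (t b)) : TwistBy x (p i j) (p i j) := by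
  induction j, hij using Nat.le_induction with
  | base => rw [h.base i hj]; exact hx i le_rfl (Nat.lt_succ_self i)
  | succ j hij ih =>
    rw [h.step i j hij hj]
    exact ((hx j (by omega) (by omega)).conj
      (ih (by omega) fun b h1 h2 => hx b h1 (by omega))).neg

theorem twist_far {a i j : ℕ} (hij : i < j) (hj : j ≤ N) (ha : a < N)
    (haij : a + 1 < i ∨ j < a) : TwistBy (t a) (p i j) (p i j) :=
  h.twist_of_forall hij hj fun b h1 h2 => by
    rcases haij with h' | h'
    · exact h.far a b (by omega) (by omega)
    · exact h.far' b a (by omega) (by omega)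

theorem twist_top {i j : ℕ} (hij : i < j) (hj : j < N) :
    TwistBy (t j) (p i j) (p i (j + 1)) := by
  rw [h.step i j hij hj]
  exact twistBy_conj (h.sq j hj) _

/-- For `j = a + 2` the element is `t_{a+1} t_a p_{ia} t_a t_{a+1}`, the form treated by
`TwistBy.braid`, since `t_{a+1}` anticommutes with `p_{ia}`. The later conjugations are by
generators far from `t_a`. -/
theorem twist_mid {a i j : ℕ} (hia : i < a) (haj : a + 1 < j) (hj : j ≤ N) :
    TwistBy (t a) (p i j) (p i j) := by
  induction j, (show a + 2 ≤ j from haj) using Nat.le_induction with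
  | base =>
    have e : p i (a + 2) = t (a + 1) * (t a * p i a * t a) * t (a + 1) := by
      rw [h.step i (a + 1) (by omega) (by omega), h.step i a hia (by omega), mul_neg, neg_mul,
        neg_neg]
    rw [e]
    exact TwistBy.braid (h.braid a (by omega))
      (h.twist_far hia (by omega) (by omega) (by omega))
  | succ j hj' ih =>
    rw [h.step i j (by omega) (by omega)]
    exact ((h.far a j (by omega) (by omega)).conj (ih (by omega) (by omega))).neg

theorem twist_bot {i j : ℕ} (hij : i + 1 < j) (hj : j ≤ N) :
    TwistBy (t i) (p i j) (p (i + 1) j) := by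
  induction j, (show i + 2 ≤ j from hij) using Nat.le_induction with
  | base =>
    unfold TwistBy
    rw [h.step i (i + 1) (by omega) (by omega), h.base i (by omega), h.base (i + 1) (by omega),
      ← h.braid i (by omega), mul_neg, ← mul_assoc, ← mul_assoc, h.sq i (by omega), one_mul]
  | succ j hj' ih =>
    rw [h.step i j (by omega) (by omega), h.step (i + 1) j (by omega) (by omega)]
    exact ((h.far i j (by omega) (by omega)).conj (ih (by omega) (by omega))).neg

/-- While `step` moves the upper index, this recursion moves the lower one. It has the same shape as
`ChainCoroots.step_last`, so that `p` and `q` can be compared by one induction. -/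
theorem step_bot {i j : ℕ} (hij : i + 1 < j) (hj : j ≤ N) :
    p i j = -(t i * p (i + 1) j * t i) :=
  ((h.twist_bot hij hj).symm (h.sq _ (by omega))).eq (h.sq _ (by omega))

theorem twist_self {i : ℕ} (hi : i < N) : TwistBy (t i) (p i (i + 1)) (-p i (i + 1)) := by
  rw [h.base i hi, TwistBy, neg_mul, neg_neg]

end ChainRoots

/-- The elements attached to the roots `y_i + y_j`, in a chain with `N` nodes. -/
structure ChainCoroots (N : ℕ) (t : ℕ → R) (q : ℕ → ℕ → R) : Prop extends SpinChain N t where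
  step : ∀ i j, i < j → j < N → q i j = -(t j * q i (j + 1) * t j)
  step_last : ∀ i, i + 1 < N → q i N = -(t i * q (i + 1) N * t i)
  base_near : ∀ a, a + 1 = N → TwistBy (t a) (q a N) (q a N)
  base_far : ∀ a b, b + 1 = N → a + 1 < b → TwistBy (t a) (q b N) (q b N)

namespace ChainCoroots

variable {N : ℕ} {t : ℕ → R} {q : ℕ → ℕ → R} (h : ChainCoroots N t q)
include h

/-- Descent in the first index, the second being `N`. Together with `twist_of_last`, which descends
in the second index, it reduces statements about `q i j` to a single base element. -/
theorem twist_last_of_forall {x : R} {i m : ℕ} (him : i ≤ m) (hm : m < N)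
    (hbase : TwistBy x (q m N) (q m N)) (hx : ∀ b, i ≤ b → b < m → TwistBy x (t b) (t b)) :
    TwistBy x (q i N) (q i N) := by
  induction him using Nat.decreasingInduction with
  | self => exact hbase
  | of_succ i hi ih =>
    rw [h.step_last i (by omega)]
    exact ((hx i le_rfl hi).conj (ih fun b h1 h2 => hx b (by omega) h2)).neg

/-- Twisted commutation with `q i j` follows from that with `q i N`, for an element that
anticommutes with the generators involved. -/
theorem twist_of_last {x : R} {i i' j m : ℕ} (hij : i < j) (hij' : i' < j) (hj : j ≤ m)
    (hm : m ≤ N)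
    (hbase : TwistBy x (q i m) (q i' m)) (hx : ∀ b, j ≤ b → b < m → TwistBy x (t b) (t b)) :
    TwistBy x (q i j) (q i' j) := by
  induction hj using Nat.decreasingInduction with
  | self => exact hbase
  | of_succ j hj ih =>
    rw [h.step i j hij (by omega), h.step i' j hij' (by omega)]
    exact ((hx j le_rfl hj).conj
      (ih (by omega) (by omega) fun b h1 h2 => hx b (by omega) h2)).neg

theorem twist_top {i j : ℕ} (hij : i < j) (hj : j < N) :
    TwistBy (t j) (q i (j + 1)) (q i j) := by
  rw [h.step i j hij hj]
  exact twistBy_conj (h.sq j hj) _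

theorem twist_bot {i j : ℕ} (hij : i + 1 < j) (hj : j ≤ N) :
    TwistBy (t i) (q (i + 1) j) (q i j) := by
  refine h.twist_of_last (m := N) hij (by omega) hj le_rfl ?_ fun b h1 h2 =>
    h.far i b (by omega) h2
  rw [h.step_last i (by omega)]
  exact twistBy_conj (h.sq i (by omega)) _

theorem twist_low {a i j : ℕ} (hij : i < j) (hj : j ≤ N) (ha : a + 1 < i) :
    TwistBy (t a) (q i j) (q i j) := by
  refine h.twist_of_last (m := N) hij hij hj le_rfl ?_ fun b h1 h2 =>
    h.far a b (by omega) h2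
  exact h.twist_last_of_forall (m := N - 1) (by omega) (by omega)
    (h.base_far a _ (by omega) (by omega)) fun b h1 h2 => h.far a b (by omega) (by omega)

/-- With `a = c + 1` the descent stops at `q_{cN} = t_c t_{c+1} q_{c+2,N} t_{c+1} t_c`. Since `t_c`
anticommutes with `q_{c+2,N}`, the braid relation makes `t_{c+1}` anticommute with the whole. -/
theorem twist_mid {a i j : ℕ} (hia : i < a) (haj : a + 1 < j) (hj : j ≤ N) :
    TwistBy (t a) (q i j) (q i j) := by
  refine h.twist_of_last (m := N) (by omega) (by omega) hj le_rfl ?_ fun b h1 h2 =>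
    h.far a b (by omega) h2
  obtain ⟨c, rfl⟩ : ∃ c, a = c + 1 := ⟨a - 1, by omega⟩
  refine h.twist_last_of_forall (m := c) (by omega) (by omega) ?_ fun b h1 h2 =>
    h.far' b _ (by omega) (by omega)
  have e : q c N = t c * (t (c + 1) * q (c + 2) N * t (c + 1)) * t c := by
    rw [h.step_last c (by omega), h.step_last (c + 1) (by omega), mul_neg, neg_mul, neg_neg]
  rw [e]
  exact TwistBy.braid (h.braid c (by omega)).symm
    (h.twist_low (by omega) (by omega) (by omega))

/-- Two conjugations carry `q_{i+1,i+2}` to `q_{i,i+1}`, and the braid relation turns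
anticommutation with `t_{i+1}` into anticommutation with `t_i`; the end of the chain is `base_near`.
-/
theorem twist_self {i : ℕ} (hi : i < N) : TwistBy (t i) (q i (i + 1)) (q i (i + 1)) := by
  have hi' : i ≤ N - 1 := by omega
  induction hi' using Nat.decreasingInduction with
  | self =>
    have e : N - 1 + 1 = N := by omega
    rw [e]; exact h.base_near _ e
  | of_succ i hi' ih =>
    have e : q i (i + 1) = t (i + 1) * (t i * q (i + 1) (i + 2) * t i) * t (i + 1) := by
      rw [h.step i (i + 1) (by omega) (by omega),
        ((h.twist_bot (i := i) (j := i + 2) (by omega) (by omega))).eq (h.sq _ (by omega)),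
        mul_neg, neg_mul, neg_neg]
    rw [e]
    exact TwistBy.braid (h.braid i (by omega)) (ih (by omega))

/-- The braid argument in the second index: `q_{ic}` is a double conjugate of `q_{i,c+2}`, with
which `t_c` anticommutes by `twist_mid`. -/
theorem twist_high {a i j : ℕ} (hij : i < j) (hja : j < a) (ha : a < N) :
    TwistBy (t a) (q i j) (q i j) := by
  obtain ⟨c, rfl⟩ : ∃ c, a = c + 1 := ⟨a - 1, by omega⟩
  refine h.twist_of_last (m := c) hij hij (by omega) (by omega) ?_ fun b h1 h2 =>
    h.far' b _ (by omega) (by omega)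
  have e : q i c = t c * (t (c + 1) * q i (c + 2) * t (c + 1)) * t c := by
    rw [h.step i c (by omega) (by omega), h.step i (c + 1) (by omega) (by omega), mul_neg,
      neg_mul, neg_neg]
  rw [e]
  refine TwistBy.braid (h.braid c (by omega)).symm ?_
  exact h.twist_mid (by omega) (by omega) (by omega)

end ChainCoroots

/-- The elements attached to the roots `y_i`, in a chain with `N` nodes. -/
structure ChainShort (N : ℕ) (t : ℕ → R) (b : ℕ → R) : Prop extends SpinChain N t where
  step : ∀ i < N, b i = -(t i * b (i + 1) * t i)
  base_far : ∀ a, a + 1 < N → TwistBy (t a) (b N) (b N)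

namespace ChainShort

variable {N : ℕ} {t : ℕ → R} {b : ℕ → R} (h : ChainShort N t b)
include h

theorem twist_of_forall {x : R} {i m : ℕ} (him : i ≤ m) (hm : m ≤ N)
    (hbase : TwistBy x (b m) (b m)) (hx : ∀ k, i ≤ k → k < m → TwistBy x (t k) (t k)) :
    TwistBy x (b i) (b i) := by
  induction him using Nat.decreasingInduction with
  | self => exact hbase
  | of_succ i hi ih =>
    rw [h.step i (by omega)]
    exact ((hx i le_rfl hi).conj (ih fun b h1 h2 => hx b (by omega) h2)).neg

theorem twist_low {a i : ℕ} (hi : i ≤ N) (ha : a + 1 < i) : TwistBy (t a) (b i) (b i) :=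
  h.twist_of_forall (m := N) hi le_rfl (h.base_far a (by omega)) fun k h1 h2 =>
    h.far a k (by omega) h2

theorem twist_near {i : ℕ} (hi : i < N) : TwistBy (t i) (b (i + 1)) (b i) := by
  rw [h.step i hi]
  exact twistBy_conj (h.sq i hi) _

theorem twist_high {a i : ℕ} (hia : i < a) (ha : a < N) : TwistBy (t a) (b i) (b i) := by
  obtain ⟨c, rfl⟩ : ∃ c, a = c + 1 := ⟨a - 1, by omega⟩
  refine h.twist_of_forall (m := c) (by omega) (by omega) ?_ fun k h1 h2 =>
    h.far' k _ (by omega) (by omega)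
  have e : b c = t c * (t (c + 1) * b (c + 2) * t (c + 1)) * t c := by
    rw [h.step c (by omega), h.step (c + 1) (by omega), mul_neg, neg_mul, neg_neg]
  rw [e]
  exact TwistBy.braid (h.braid c (by omega)).symm
    (h.twist_low (by omega) (by omega))

end ChainShort

end Twisted

/-! ### The extra generator of types B and D against the roots of the chain. -/

section LastNode

variable {R : Type*} [Ring R]

/-- The last node `c` of a chain of type `B`, with the elements attached to all roots. -/
structure LastNodeB (N : ℕ) (t : ℕ → R) (c : R) (p q : ℕ → ℕ → R) (b : ℕ → R) : Prop where
  roots : ChainRoots N t p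
  coroots : ChainCoroots N t q
  short : ChainShort N t b
  sq : c * c = 1
  far : ∀ a, a + 1 < N → TwistBy c (t a) (t a)
  quad : ∀ a, a + 1 = N → TwistBy c (t a * c * t a) (t a * c * t a)
  q_base : ∀ a, a + 1 = N → q a N = -(c * t a * c)
  b_base : b N = c

namespace LastNodeB

variable {N : ℕ} {t : ℕ → R} {c : R} {p q : ℕ → ℕ → R} {b : ℕ → R}
  (h : LastNodeB N t c p q b)
include h

theorem twist_root {i j : ℕ} (hij : i < j) (hj : j < N) : TwistBy c (p i j) (p i j) :=
  h.roots.twist_of_forall hij hj.le fun k _ h2 => h.far k (by omega)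

/-- Both families follow the same recursion in the lower index, and `c` anticommutes with the
generators occurring in it, so the base relation `q = -(c t c)` propagates. -/
theorem twist_root_last {i : ℕ} (hi : i < N) : TwistBy c (p i N) (q i N) := by
  have hi' : i ≤ N - 1 := by omega
  induction hi' using Nat.decreasingInduction with
  | self =>
    have e : N - 1 + 1 = N := by omega
    have e' := h.roots.base (N - 1) (by omega)
    rw [e] at e'
    rw [e', h.q_base _ e]
    exact twistBy_conj h.sq _
  | of_succ i hi' ih =>
    rw [h.roots.step_bot (i := i) (by omega) le_rfl, h.coroots.step_last i (by omega)]
    exact ((h.far i (by omega)).conj (ih (by omega))).neg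

/-- With `N = M + 1`, going from `q_{iM}` through `q_{iN}` and `p_{iN}` to `p_{iM}` exhibits
`q_{iM}` as minus the conjugate of `p_{iM}` by `t_M c t_M`. The element `c` anticommutes with both
factors, by the relation of order four and by distance. -/
theorem twist_coroot {i j : ℕ} (hij : i < j) (hj : j < N) : TwistBy c (q i j) (q i j) := by
  refine h.coroots.twist_of_last (m := N - 1) hij hij (by omega) (by omega) ?_ fun k _ h2 =>
    h.far k (by omega)
  obtain ⟨M, rfl⟩ : ∃ M, N = M + 1 := ⟨N - 1, by omega⟩
  have e : q i M = -((t M * c * t M) * p i M * (t M * c * t M)) := by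
    rw [h.coroots.step i M (by omega) (by omega),
      (h.twist_root_last (i := i) (by omega)).eq h.sq, h.roots.step i M (by omega) (by omega)]
    simp only [mul_neg, neg_mul, neg_neg, mul_assoc]
  rw [Nat.add_sub_cancel, e]
  exact ((h.quad M rfl).conj (h.twist_root (by omega) (by omega))).neg

theorem twist_short {i : ℕ} (hi : i < N) : TwistBy c (b i) (b i) := by
  refine h.short.twist_of_forall (m := N - 1) (by omega) (by omega) ?_ fun k _ h2 =>
    h.far k (by omega)
  have e : N - 1 + 1 = N := by omega
  rw [h.short.step _ (by omega), e, h.b_base]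
  exact (h.quad _ e).neg

theorem twist_short_last : TwistBy c (b N) (-b N) := by
  rw [h.b_base, TwistBy, neg_mul, neg_neg]

end LastNodeB

/-- The last node `c` of type `D`, with the elements attached to all roots. -/
structure LastNodeD (N : ℕ) (t : ℕ → R) (c : R) (p q : ℕ → ℕ → R) : Prop where
  roots : ChainRoots N t p
  coroots : ChainCoroots N t q
  sq : c * c = 1
  near : ∀ a, a + 1 = N → TwistBy c (t a) (t a)
  braid : ∀ a, a + 2 = N → c * t a * c = t a * c * t a
  far : ∀ a, a + 2 < N → TwistBy c (t a) (t a)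
  q_base : ∀ a, a + 1 = N → q a N = c

namespace LastNodeD

variable {N : ℕ} {t : ℕ → R} {c : R} {p q : ℕ → ℕ → R} (h : LastNodeD N t c p q)
include h

theorem twist_root {i j : ℕ} (hij : i < j) (hj : j + 1 < N) : TwistBy c (p i j) (p i j) :=
  h.roots.twist_of_forall hij (by omega) fun k _ h2 => h.far k (by omega)

theorem twist_root_near {i j : ℕ} (hij : i < j) (hj : j + 1 = N) :
    TwistBy c (p i j) (q i N) := by
  obtain ⟨M, rfl⟩ : ∃ M, j = M + 1 := ⟨j - 1, by omega⟩
  have hi' : i ≤ M := by omega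
  induction hi' using Nat.decreasingInduction with
  | self =>
    have e := h.coroots.step_last M (by omega)
    rw [h.q_base _ hj] at e
    rw [h.roots.base _ (by omega), e, ← h.braid M (by omega), TwistBy, neg_mul, neg_neg,
      mul_assoc, h.sq, mul_one]
  | of_succ i hi' ih =>
    rw [h.roots.step_bot (i := i) (by omega) (by omega), h.coroots.step_last i (by omega)]
    exact ((h.far i (by omega)).conj (ih (by omega))).neg

theorem twist_root_last {i j : ℕ} (hij : i < j) (hj : j + 1 = N) :
    TwistBy c (p i N) (q i j) := by
  subst hj
  rw [h.roots.step i j hij (by omega), h.coroots.step i j hij (by omega)]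
  exact ((h.near j rfl).conj (h.twist_root_near hij rfl)).neg

theorem twist_root_self {i : ℕ} (hi : i + 1 = N) : TwistBy c (p i N) (p i N) := by
  subst hi
  rw [h.roots.base i (by omega)]
  exact h.near i rfl

theorem twist_coroot_self {i : ℕ} (hi : i + 1 = N) : TwistBy c (q i N) (-q i N) := by
  rw [h.q_base i hi, TwistBy, neg_mul, neg_neg]

/-- With `N = M + 2`, write `q_{iM} = Y p_{iM} Z`. By the braid relations `c Y = Y t_{M+1}` and
`t_{M+1} Z = Z c`: moving through `Y` turns `c` into `t_{M+1}`, which changes sign at `p_{iM}`, and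
moving through `Z` turns it back into `c`. -/
theorem twist_coroot {i j : ℕ} (hij : i < j) (hj : j + 1 < N) : TwistBy c (q i j) (q i j) := by
  obtain ⟨M, rfl⟩ : ∃ M, N = M + 2 := ⟨N - 2, by omega⟩
  refine h.coroots.twist_of_last (m := M) hij hij (by omega) (by omega) ?_ fun k _ h2 =>
    h.far k (by omega)
  have e : q i M = t M * c * t (M + 1) * t M * p i M * (t M * t (M + 1) * c * t M) := by
    rw [h.coroots.step i M (by omega) (by omega),
      (h.twist_root_last (i := i) (j := M + 1) (by omega) rfl).eq h.sq,
      h.roots.step i (M + 1) (by omega) (by omega), h.roots.step i M (by omega) (by omega)]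
    simp only [mul_neg, neg_mul, neg_neg, mul_assoc]
  have hb := h.roots.braid M (by omega)
  have hc := h.braid M rfl
  have hX : TwistBy (t (M + 1)) (p i M) (p i M) :=
    h.roots.twist_far (by omega) (by omega) (by omega) (by omega)
  have h1 : c * (t M * c * t (M + 1) * t M) = t M * c * t (M + 1) * t M * t (M + 1) := by
    calc c * (t M * c * t (M + 1) * t M) = (c * t M * c) * t (M + 1) * t M := by
          simp only [mul_assoc]
      _ = t M * c * (t M * t (M + 1) * t M) := by rw [hc]; simp only [mul_assoc]
      _ = _ := by rw [hb]; simp only [mul_assoc]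
  have h2 : t (M + 1) * (t M * t (M + 1) * c * t M) = t M * t (M + 1) * c * t M * c := by
    calc t (M + 1) * (t M * t (M + 1) * c * t M) = (t (M + 1) * t M * t (M + 1)) * c * t M := by
          simp only [mul_assoc]
      _ = t M * t (M + 1) * (t M * c * t M) := by rw [← hb]; simp only [mul_assoc]
      _ = _ := by rw [← hc]; simp only [mul_assoc]
  rw [e]
  unfold TwistBy at hX ⊢
  generalize t M * c * t (M + 1) * t M = Y at *
  generalize t M * t (M + 1) * c * t M = Z at *
  calc c * (Y * p i M * Z) = (c * Y) * p i M * Z := by simp only [mul_assoc]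
    _ = Y * (t (M + 1) * p i M) * Z := by rw [h1]; simp only [mul_assoc]
    _ = -(Y * p i M * (t (M + 1) * Z)) := by rw [hX]; simp only [mul_assoc, mul_neg, neg_mul]
    _ = _ := by rw [h2]; simp only [mul_assoc]

end LastNodeD

end LastNode

/-! ### The brackets of the spin Weyl group algebra as chain elements. -/

section Roots

variable {X : WeylType} {n : ℕ}

/-- The element `[a,b]` for `a < b`, on natural numbers. -/
def posBrk (X : WeylType) (n a b : ℕ) : SpinWeyl X n :=
  (-1) ^ (b - a - 1) * (tDown X n (a + 1) b * t X n a * tUp X n (a + 1) b)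

/-- The middle factor of the elements `\overline{[a,b]}`. -/
def midBar (X : WeylType) (n : ℕ) : SpinWeyl X n :=
  match X with
  | .A => 0
  | .B => -(t .B n (n - 1) * t .B n (n - 2) * t .B n (n - 1))
  | .D => t .D n (n - 1)

/-- The element `\overline{[a,b]}` for `a < b`, on natural numbers. -/
def posBar (X : WeylType) (n a b : ℕ) : SpinWeyl X n :=
  (-1) ^ (b - a - 1) * (tUp X n b (n - 1) * tUp X n a (n - 2) * midBar X n *
      tDown X n a (n - 2) * tDown X n b (n - 1))

/-- The element `\overline{[a]}`, on natural numbers. -/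
def posShort (n a : ℕ) : SpinWeyl .B n :=
  (-1) ^ (n - 1 - a) * (tUp .B n a (n - 1) * t .B n (n - 1) * tDown .B n a (n - 1))

theorem brk_of_lt {i j : Fin n} (h : i < j) : brk X n i j = posBrk X n i j := if_pos h

theorem brk_of_gt {i j : Fin n} (h : j < i) : brk X n i j = -posBrk X n j i :=
  (if_neg h.le.not_gt).trans (if_pos h)

theorem barBrk_of_lt {i j : Fin n} (h : i < j) : barBrk X n i j = posBar X n i j := if_pos h

theorem barBrk_of_gt {i j : Fin n} (h : j < i) : barBrk X n i j = posBar X n j i :=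
  (if_neg h.le.not_gt).trans (if_pos h)

theorem barOne_eq (i : Fin n) : barOne n i = posShort n i := rfl

theorem brk_swap (i j : Fin n) : brk X n j i = -brk X n i j := by
  rcases lt_trichotomy i j with h | rfl | h
  · rw [brk_of_lt h, brk_of_gt h]
  · simp [brk]
  · rw [brk_of_lt h, brk_of_gt h, neg_neg]

theorem barBrk_swap (i j : Fin n) : barBrk X n j i = barBrk X n i j := by
  rcases lt_trichotomy i j with h | rfl | h
  · rw [barBrk_of_lt h, barBrk_of_gt h]
  · rfl
  · rw [barBrk_of_lt h, barBrk_of_gt h]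

theorem barBrk_A (i j : Fin n) : barBrk .A n i j = 0 := by
  simp [barBrk]

theorem tUp_self (a : ℕ) : tUp X n a a = 1 := by simp [tUp]

theorem tDown_self (a : ℕ) : tDown X n a a = 1 := by simp [tDown]

theorem tUp_bot {a b : ℕ} (h : a < b) : tUp X n a b = t X n a * tUp X n (a + 1) b := by
  obtain ⟨k, rfl⟩ : ∃ k, b = a + 1 + k := ⟨b - a - 1, by omega⟩
  have h1 : a + 1 + k - a = k + 1 := by omega
  have h2 : a + 1 + k - (a + 1) = k := by omega
  simp only [tUp, h1, h2, List.range'_succ, List.map_cons, List.prod_cons]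

theorem tDown_bot {a b : ℕ} (h : a < b) : tDown X n a b = tDown X n (a + 1) b * t X n a := by
  obtain ⟨k, rfl⟩ : ∃ k, b = a + 1 + k := ⟨b - a - 1, by omega⟩
  have h1 : a + 1 + k - a = k + 1 := by omega
  have h2 : a + 1 + k - (a + 1) = k := by omega
  simp only [tDown, h1, h2, List.range'_succ, List.reverse_cons, List.map_append,
    List.prod_append, List.map_cons, List.map_nil, List.prod_singleton]

theorem tUp_top {a b : ℕ} (h : a ≤ b) : tUp X n a (b + 1) = tUp X n a b * t X n b := by
  obtain ⟨k, rfl⟩ : ∃ k, b = a + k := ⟨b - a, by omega⟩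
  have h1 : a + k + 1 - a = k + 1 := by omega
  have h2 : a + k - a = k := by omega
  simp only [tUp, h1, h2, List.range'_concat, List.map_append, List.prod_append, List.map_cons,
    List.map_nil, List.prod_singleton, one_mul]

theorem tDown_top {a b : ℕ} (h : a ≤ b) : tDown X n a (b + 1) = t X n b * tDown X n a b := by
  obtain ⟨k, rfl⟩ : ∃ k, b = a + k := ⟨b - a, by omega⟩
  have h1 : a + k + 1 - a = k + 1 := by omega
  have h2 : a + k - a = k := by omega
  simp only [tDown, h1, h2, List.range'_concat, List.reverse_append, List.reverse_cons,
    List.reverse_nil, List.nil_append, List.singleton_append, List.map_cons, List.prod_cons,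
    one_mul]

theorem coxeterEntry_chain {a b : ℕ} (h : a + 1 < n) (h' : b + 1 < n) : coxeterEntry X n a b =
    if a = b then 1 else if a + 1 = b ∨ b + 1 = a then 3 else 2 := by
  unfold coxeterEntry
  have h1 : ¬ (X = .B ∧ (a + 2 = n ∧ b + 1 = n ∨ b + 2 = n ∧ a + 1 = n)) := by omega
  have h2 : ¬ (X = .D ∧ (a + 1 = n ∨ b + 1 = n)) := by omega
  rw [if_neg h1, if_neg h2]

theorem lt_rank {a : ℕ} (h : a + 1 < n) : a < rank X n := by
  cases X <;> simp only [rank] <;> omega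

/-- In all three types the simple transpositions form the same chain; only the last generator of
types `B` and `D` lies outside it. -/
theorem spinChain : SpinChain (n - 1) (t X n) where
  sq a ha := t_sq (lt_rank (by omega))
  braid a ha := by
    refine t_three (lt_rank (by omega)) (lt_rank (by omega)) ?_
    rw [coxeterEntry_chain (by omega) (by omega), if_neg (by omega), if_pos (by omega)]
  far a b hab hb := by
    refine t_two (lt_rank (by omega)) (lt_rank (by omega)) ?_
    rw [coxeterEntry_chain (by omega) (by omega), if_neg (by omega), if_neg (by omega)]

theorem neg_one_pow_mul_conj {R : Type*} [Ring R] (k : ℕ) (s x : R) :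
    (-1) ^ (k + 1) * (s * x * s) = -(s * ((-1) ^ k * x) * s) := by
  rcases neg_one_pow_eq_or R k with h | h <;> simp [pow_succ, h]

theorem chainRoots : ChainRoots (n - 1) (t X n) (posBrk X n) where
  toSpinChain := spinChain
  base i hi := by simp [posBrk, tUp_self, tDown_self]
  step i j hij hj := by
    have e : j + 1 - i - 1 = j - i - 1 + 1 := by omega
    rw [posBrk, posBrk, tUp_top (by omega), tDown_top (by omega), e, ← neg_one_pow_mul_conj]
    simp only [mul_assoc]

theorem posBar_step {i j : ℕ} (hij : i < j) (hj : j < n - 1) :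
    posBar X n i j = -(t X n j * posBar X n i (j + 1) * t X n j) := by
  have e : j + 1 - i - 1 = j - i - 1 + 1 := by omega
  -- Lowering the second index lowers the exponent by one, whereas `neg_one_pow_mul_conj` raises it;
  -- parity allows adding two.
  have e' : ((-1) ^ (j - i - 1) : SpinWeyl X n) = (-1) ^ (j - i - 1 + 1 + 1) := by
    rw [pow_succ, pow_succ]; simp
  rw [posBar, posBar, tUp_bot hj, tDown_bot hj, e, e', ← neg_one_pow_mul_conj]
  simp only [mul_assoc]

theorem posBar_step_last {i : ℕ} (hi : i + 1 < n - 1) :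
    posBar X n i (n - 1) = -(t X n i * posBar X n (i + 1) (n - 1) * t X n i) := by
  have e : n - 1 - i - 1 = n - 1 - (i + 1) - 1 + 1 := by omega
  rw [posBar, posBar, tUp_bot (a := i) (by omega), tDown_bot (a := i) (by omega), e,
    ← neg_one_pow_mul_conj, tUp_self, tDown_self]
  simp only [mul_assoc, one_mul, mul_one]

theorem posBar_base {a : ℕ} (ha : a + 1 = n - 1) : posBar X n a (n - 1) = midBar X n := by
  have e : n - 1 - a - 1 = 0 := by omega
  have e' : n - 2 = a := by omega
  rw [posBar, e, e', tUp_self, tDown_self, tUp_self, tDown_self]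
  simp

theorem t_quad {a : ℕ} (ha : a + 1 = n - 1) :
    TwistBy (t .B n (n - 1)) (t .B n a * t .B n (n - 1) * t .B n a)
      (t .B n a * t .B n (n - 1) * t .B n a) := by
  have := t_four (X := .B) (n := n) (a := n - 1) (b := a) (by simp [rank]; omega)
    (by simp [rank]; omega) (by
      unfold coxeterEntry; rw [if_neg (by omega), if_pos ⟨rfl, by omega⟩])
  simp only [pow_two] at this
  simpa only [TwistBy, mul_assoc] using this

theorem tB_last_sq (hn : 0 < n) : t .B n (n - 1) * t .B n (n - 1) = 1 :=
  t_sq (by simp [rank]; omega)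

theorem tD_last_sq (hn : 0 < n) : t .D n (n - 1) * t .D n (n - 1) = 1 :=
  t_sq (by simp [rank]; omega)

theorem tB_last_far {a : ℕ} (ha : a + 1 < n - 1) :
    TwistBy (t .B n (n - 1)) (t .B n a) (t .B n a) := by
  refine t_two (by simp [rank]; omega) (by simp [rank]; omega) ?_
  unfold coxeterEntry
  rw [if_neg (by omega), if_neg (by omega), if_neg (by simp), if_neg (by omega)]

theorem tD_last_far {a : ℕ} (ha : a + 2 < n - 1 ∨ a + 1 = n - 1) :
    TwistBy (t .D n (n - 1)) (t .D n a) (t .D n a) := by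
  refine t_two (by simp [rank]; omega) (by simp [rank]; omega) ?_
  unfold coxeterEntry
  rw [if_neg (by omega), if_neg (by simp), if_pos ⟨rfl, by omega⟩, if_neg (by omega)]

theorem tD_last_braid {a : ℕ} (ha : a + 2 = n - 1) :
    t .D n (n - 1) * t .D n a * t .D n (n - 1) = t .D n a * t .D n (n - 1) * t .D n a := by
  refine t_three (by simp [rank]; omega) (by simp [rank]; omega) ?_
  unfold coxeterEntry
  rw [if_neg (by omega), if_neg (by simp), if_pos ⟨rfl, by omega⟩, if_pos (by omega)]

theorem chainCoroots_B (hn : 2 ≤ n) : ChainCoroots (n - 1) (t .B n) (posBar .B n) where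
  toSpinChain := spinChain
  step i j hij hj := posBar_step hij hj
  step_last i hi := posBar_step_last hi
  base_near a ha := by
    have e : n - 2 = a := by omega
    rw [posBar_base ha, midBar, e]
    refine TwistBy.neg ?_
    -- The relation of order four is symmetric in its two generators: read the other way, `t_a`
    -- anticommutes with `t_{n-1} t_a t_{n-1}`.
    have h := t_quad ha
    have hs : t .B n a * t .B n a = 1 := t_sq (lt_rank (by omega))
    unfold TwistBy at h ⊢
    rw [eq_neg_iff_add_eq_zero, add_comm, ← eq_neg_iff_add_eq_zero]
    simpa only [mul_assoc] using h
  base_far a b hb hab := by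
    have e : n - 2 = b := by omega
    rw [posBar_base hb, midBar, e]
    refine (TwistBy.conj ?_ ?_).neg
    · exact (tB_last_far (by omega)).swap
    · exact spinChain.far a b hab (by omega)

theorem chainCoroots_D : ChainCoroots (n - 1) (t .D n) (posBar .D n) where
  toSpinChain := spinChain
  step i j hij hj := posBar_step hij hj
  step_last i hi := posBar_step_last hi
  base_near a ha := by
    rw [posBar_base ha, midBar]
    exact (tD_last_far (by omega)).swap
  base_far a b hb hab := by
    rw [posBar_base hb, midBar]
    exact (tD_last_far (by omega)).swap

theorem posShort_last : posShort n (n - 1) = t .B n (n - 1) := by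
  simp [posShort, tUp_self, tDown_self]

theorem posShort_step {i : ℕ} (hi : i < n - 1) :
    posShort n i = -(t .B n i * posShort n (i + 1) * t .B n i) := by
  have e : n - 1 - i = n - 1 - (i + 1) + 1 := by omega
  rw [posShort, posShort, tUp_bot hi, tDown_bot hi, e, ← neg_one_pow_mul_conj]
  simp only [mul_assoc]

theorem chainShort : ChainShort (n - 1) (t .B n) (posShort n) where
  toSpinChain := spinChain
  step i hi := posShort_step hi
  base_far a ha := by
    rw [posShort_last]
    exact (tB_last_far ha).swap

theorem lastNodeB (hn : 2 ≤ n) :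
    LastNodeB (n - 1) (t .B n) (t .B n (n - 1)) (posBrk .B n) (posBar .B n) (posShort n) where
  roots := chainRoots
  coroots := chainCoroots_B hn
  short := chainShort
  sq := tB_last_sq (by omega)
  far a ha := tB_last_far ha
  quad a ha := t_quad ha
  q_base a ha := by
    have e : n - 2 = a := by omega
    rw [posBar_base ha, midBar, e]
  b_base := posShort_last

theorem lastNodeD (hn : 2 ≤ n) :
    LastNodeD (n - 1) (t .D n) (t .D n (n - 1)) (posBrk .D n) (posBar .D n) where
  roots := chainRoots
  coroots := chainCoroots_D
  sq := tD_last_sq (by omega)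
  near a ha := tD_last_far (by omega)
  braid a ha := tD_last_braid ha
  far a ha := tD_last_far (by omega)
  q_base a ha := by rw [posBar_base ha, midBar]

end Roots

/-! ### Reflections acting on polynomials and their conjugation identities. -/

section Reflections

open MvPolynomial

variable {n : ℕ}

theorem actS_X (k i m : Fin n) : actS k i (X m) = X (Equiv.swap k i m) := by
  simp [actS]

theorem actSbar_X (k i m : Fin n) :
    actSbar k i (X m) = if m = k then -X i else if m = i then -X k else X m := by
  simp [actSbar]

theorem actTau_X (i m : Fin n) : actTau i (X m) = if m = i then -X i else X m := by
  simp [actTau]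

theorem actS_comm (k i : Fin n) : actS k i = actS i k := by
  rw [actS, actS, Equiv.swap_comm]

theorem actSbar_comm (k i : Fin n) : actSbar k i = actSbar i k := by
  refine MvPolynomial.algHom_ext fun m => ?_
  simp only [actSbar_X]
  split_ifs <;> simp_all

theorem apply_ite_X {φ : MvPolynomial (Fin n) ℂ →ₐ[ℂ] MvPolynomial (Fin n) ℂ} {p : Prop}
    [Decidable p] (a b : MvPolynomial (Fin n) ℂ) :
    φ (if p then a else b) = if p then φ a else φ b := by
  split_ifs <;> rfl

theorem actS_conj_actS {i j l : Fin n} (hij : i ≠ j) (hil : i ≠ l) (hjl : j ≠ l) :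
    actS j l * actS i j * actS j l = actS i l := by
  refine MvPolynomial.algHom_ext fun m => ?_
  simp only [AlgHom.mul_apply, actS_X, Equiv.swap_apply_def]
  split_ifs <;> simp_all

theorem actS_conj_actSbar {i j l : Fin n} (hij : i ≠ j) (hil : i ≠ l) (hjl : j ≠ l) :
    actS j l * actSbar i l * actS j l = actSbar i j := by
  refine MvPolynomial.algHom_ext fun m => ?_
  simp only [AlgHom.mul_apply, actS_X, actSbar_X, Equiv.swap_apply_def]
  split_ifs <;> simp_all [actS_X, Equiv.swap_apply_def]

theorem actS_conj_actSbar' {i l m : Fin n} (hil : i ≠ l) (him : i ≠ m) (hlm : l ≠ m) :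
    actS i l * actSbar l m * actS i l = actSbar i m := by
  rw [actSbar_comm, actS_conj_actSbar him.symm hlm.symm hil, actSbar_comm]

theorem actTau_conj_actS {i m : Fin n} (him : i ≠ m) :
    actTau m * actS i m * actTau m = actSbar i m := by
  refine MvPolynomial.algHom_ext fun l => ?_
  simp only [AlgHom.mul_apply, actSbar_X, actTau_X, apply_ite_X, map_neg, actS_X,
    Equiv.swap_apply_def]
  split_ifs <;> simp_all

theorem actS_conj_actTau {i l : Fin n} (hil : i ≠ l) :
    actS i l * actTau l * actS i l = actTau i := by
  refine MvPolynomial.algHom_ext fun m => ?_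
  simp only [AlgHom.mul_apply, actS_X, actTau_X, Equiv.swap_apply_def]
  split_ifs <;> simp_all [actS_X, Equiv.swap_apply_def]

theorem actS_conj_actS' {i j l : Fin n} (hij : i ≠ j) (hil : i ≠ l) (hjl : j ≠ l) :
    actS i j * actS j l * actS i j = actS i l := by
  rw [actS_comm i j, actS_comm j l, actS_conj_actS hjl.symm hil.symm hij.symm, actS_comm]

theorem actSbar_conj_actS {i j l : Fin n} (hij : i ≠ j) (hil : i ≠ l) (hjl : j ≠ l) :
    actSbar j l * actS i j * actSbar j l = actSbar i l := by
  refine MvPolynomial.algHom_ext fun m => ?_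
  simp only [AlgHom.mul_apply, actS_X, actSbar_X, apply_ite_X, map_neg, Equiv.swap_apply_def]
  split_ifs <;> simp_all

theorem actS_mul_self (i j : Fin n) : actS i j * actS i j = 1 := by
  refine MvPolynomial.algHom_ext fun m => ?_
  simp only [AlgHom.mul_apply, actS_X, Equiv.swap_apply_self, AlgHom.one_apply]

theorem actSbar_mul_self {i j : Fin n} (h : i ≠ j) : actSbar i j * actSbar i j = 1 := by
  refine MvPolynomial.algHom_ext fun m => ?_
  simp only [AlgHom.mul_apply, actSbar_X, apply_ite_X, map_neg, AlgHom.one_apply]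
  split_ifs <;> simp_all

theorem actTau_mul_self (i : Fin n) : actTau i * actTau i = 1 := by
  refine MvPolynomial.algHom_ext fun m => ?_
  simp only [AlgHom.mul_apply, actTau_X, apply_ite_X, map_neg, AlgHom.one_apply]
  split_ifs <;> simp_all

theorem actS_commute {i j k l : Fin n} (hik : i ≠ k) (hil : i ≠ l) (hjk : j ≠ k) (hjl : j ≠ l) :
    actS i j * actS k l = actS k l * actS i j := by
  refine MvPolynomial.algHom_ext fun m => ?_
  simp only [AlgHom.mul_apply, actS_X, Equiv.swap_apply_def]
  split_ifs <;> simp_all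

theorem actS_commute_actSbar {i j k l : Fin n} (hik : i ≠ k) (hil : i ≠ l) (hjk : j ≠ k)
    (hjl : j ≠ l) : actS i j * actSbar k l = actSbar k l * actS i j := by
  refine MvPolynomial.algHom_ext fun m => ?_
  simp only [AlgHom.mul_apply, actS_X, actSbar_X, apply_ite_X, map_neg, Equiv.swap_apply_def]
  split_ifs <;> simp_all

theorem actS_commute_actSbar_self (i j : Fin n) :
    actS i j * actSbar i j = actSbar i j * actS i j := by
  refine MvPolynomial.algHom_ext fun m => ?_
  simp only [AlgHom.mul_apply, actS_X, actSbar_X, apply_ite_X, map_neg, Equiv.swap_apply_def]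
  split_ifs <;> simp_all

theorem actS_commute_actTau {i j k : Fin n} (hik : i ≠ k) (hjk : j ≠ k) :
    actS i j * actTau k = actTau k * actS i j := by
  refine MvPolynomial.algHom_ext fun m => ?_
  simp only [AlgHom.mul_apply, actS_X, actTau_X, apply_ite_X, map_neg, Equiv.swap_apply_def]
  split_ifs <;> simp_all

end Reflections

/-! ### Generators as signed permutations, brackets as reflections. -/

section Generators

variable {X : WeylType} {n : ℕ}

/-- `GenAct X n a π ε g` holds if `s_a` acts on the variables by `y_j ↦ ε_j y_{π j}`, extended to
the algebra endomorphism `g` of polynomials. -/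
inductive GenAct (X : WeylType) (n : ℕ) : ℕ → Equiv.Perm (Fin n) → (Fin n → ℂ) →
    (MvPolynomial (Fin n) ℂ →ₐ[ℂ] MvPolynomial (Fin n) ℂ) → Prop
  | simple (i j : Fin n) (h : (i : ℕ) + 1 = j) :
      GenAct X n i (Equiv.swap i j) (fun _ => 1) (actS i j)
  | lastB (hX : X = .B) (m : Fin n) (hm : (m : ℕ) + 1 = n) :
      GenAct X n (n - 1) 1 (fun j => if j = m then -1 else 1) (actTau m)
  | lastD (hX : X = .D) (l m : Fin n) (hl : (l : ℕ) + 2 = n) (hm : (m : ℕ) + 1 = n) :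
      GenAct X n (n - 1) (Equiv.swap l m) (fun j => if j = l ∨ j = m then -1 else 1) (actSbar l m)

theorem exists_genAct {a : ℕ} (ha : a < rank X n) (hn : X ≠ .A → 2 ≤ n) :
    ∃ π ε g, GenAct X n a π ε g := by
  by_cases h : a + 1 < n
  · exact ⟨_, _, _, GenAct.simple ⟨a, by omega⟩ ⟨a + 1, h⟩ rfl⟩
  · cases X with
    | A => simp only [rank] at ha; omega
    | B =>
      simp only [rank] at ha
      obtain rfl : a = n - 1 := by omega
      exact ⟨_, _, _, GenAct.lastB rfl ⟨n - 1, by omega⟩ (by simp; omega)⟩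
    | D =>
      simp only [rank] at ha
      -- The last generator of type `D` moves two variables, so it needs two indices.
      have := hn (by simp)
      obtain rfl : a = n - 1 := by omega
      exact ⟨_, _, _, GenAct.lastD rfl ⟨n - 2, by omega⟩ ⟨n - 1, by omega⟩ (by simp; omega)
        (by simp; omega)⟩

variable {a : ℕ} {π : Equiv.Perm (Fin n)} {ε : Fin n → ℂ}
  {g : MvPolynomial (Fin n) ℂ →ₐ[ℂ] MvPolynomial (Fin n) ℂ}

theorem GenAct.lt_rank (h : GenAct X n a π ε g) : a < rank X n := by
  cases h with
  | simple i j h => exact SpinDaHa.lt_rank (by omega)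
  | lastB hX m hm => subst hX; simp only [rank]; omega
  | lastD hX l m hl hm => subst hX; simp only [rank]; omega

theorem GenAct.apply_X (h : GenAct X n a π ε g) (j : Fin n) :
    g (MvPolynomial.X j) = ε j • MvPolynomial.X (π j) := by
  cases h with
  | simple i k h => rw [actS_X, one_smul]
  | lastB hX m hm =>
    rw [actTau_X]; split_ifs with h
    · simp [h]
    · simp [h]
  | lastD hX l m hl hm =>
    rw [actSbar_X, Equiv.swap_apply_def]
    split_ifs with h1 h2 <;> simp_all

theorem GenAct.t_sq (h : GenAct X n a π ε g) : t X n a * t X n a = 1 := SpinDaHa.t_sq h.lt_rank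

theorem GenAct.g_sq (h : GenAct X n a π ε g) : g * g = 1 := by
  cases h with
  | simple i j => exact actS_mul_self i j
  | lastB hX m => exact actTau_mul_self m
  | lastD hX l m hl hm => exact actSbar_mul_self (by rintro rfl; omega)

/-- `IsRefl X n x π g` holds if `x ∈ ℂW⁻` is, up to sign, obtained from some `t_a` by conjugation,
`π` is the permutation of the indices and `g` the endomorphism of polynomials given by the
corresponding reflection. -/
inductive IsRefl (X : WeylType) (n : ℕ) : SpinWeyl X n → Equiv.Perm (Fin n) →
    (MvPolynomial (Fin n) ℂ →ₐ[ℂ] MvPolynomial (Fin n) ℂ) → Prop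
  | gen {a : ℕ} {π : Equiv.Perm (Fin n)} {ε : Fin n → ℂ}
      {g : MvPolynomial (Fin n) ℂ →ₐ[ℂ] MvPolynomial (Fin n) ℂ} (h : GenAct X n a π ε g) :
      IsRefl X n (t X n a) π g
  | conj {a : ℕ} {x : SpinWeyl X n} {π π' : Equiv.Perm (Fin n)} {ε : Fin n → ℂ}
      {g g' : MvPolynomial (Fin n) ℂ →ₐ[ℂ] MvPolynomial (Fin n) ℂ} (hx : IsRefl X n x π' g')
      (h : GenAct X n a π ε g) :
      IsRefl X n (-(t X n a * x * t X n a)) (π * π' * π) (g * g' * g)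
  | neg {x : SpinWeyl X n} {π : Equiv.Perm (Fin n)}
      {g : MvPolynomial (Fin n) ℂ →ₐ[ℂ] MvPolynomial (Fin n) ℂ} (hx : IsRefl X n x π g) :
      IsRefl X n (-x) π g

theorem swap_conj {α : Type*} [DecidableEq α] {i j l : α} (hij : i ≠ j) (hil : i ≠ l) :
    Equiv.swap j l * Equiv.swap i j * Equiv.swap j l = Equiv.swap i l := by
  rw [Equiv.swap_mul_swap_mul_swap hij hil, Equiv.swap_comm]

theorem swap_conj_right {α : Type*} [DecidableEq α] {i j l : α} (hij : i ≠ j) (hil : i ≠ l)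
    (hjl : j ≠ l) : Equiv.swap j l * Equiv.swap i l * Equiv.swap j l = Equiv.swap i j := by
  ext m
  simp only [Equiv.Perm.mul_apply, Equiv.swap_apply_def]
  split_ifs <;> simp_all

theorem swap_conj_left {α : Type*} [DecidableEq α] {i l m : α} (him : i ≠ m) (hlm : l ≠ m)
    (hil : i ≠ l) : Equiv.swap i l * Equiv.swap l m * Equiv.swap i l = Equiv.swap i m := by
  ext k
  simp only [Equiv.Perm.mul_apply, Equiv.swap_apply_def]
  split_ifs <;> simp_all

theorem posBrk_isRefl (i j : Fin n) (hij : i < j) :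
    IsRefl X n (posBrk X n i j) (Equiv.swap i j) (actS i j) := by
  obtain ⟨i, hi⟩ := i
  obtain ⟨j, hj⟩ := j
  simp only [Fin.mk_lt_mk] at hij
  induction j, (show i + 1 ≤ j from hij) using Nat.le_induction with
  | base =>
    simp only
    rw [chainRoots.base i (by omega)]
    exact IsRefl.gen (GenAct.simple ⟨i, hi⟩ ⟨i + 1, hj⟩ rfl)
  | succ j hij' ih =>
    have h := (ih (by omega) (by omega)).conj
      (GenAct.simple (X := X) ⟨j, by omega⟩ ⟨j + 1, hj⟩ rfl)
    rw [swap_conj (by simp; omega) (by simp; omega), actS_conj_actS (by simp; omega)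
      (by simp; omega) (by simp)] at h
    simp only at h ⊢
    rwa [chainRoots.step i j (by omega) (by omega)]

theorem brk_isRefl {i j : Fin n} (hij : i ≠ j) :
    IsRefl X n (brk X n i j) (Equiv.swap i j) (actS i j) := by
  rcases lt_or_gt_of_ne hij with h | h
  · rw [brk_of_lt h]; exact posBrk_isRefl i j h
  · rw [brk_of_gt h, Equiv.swap_comm, actS_comm]; exact (posBrk_isRefl j i h).neg

/-- Two nested descents, of the second index from `n - 1` and then of the first from `n - 2`, each
step being conjugation by a simple transposition. The middle factor is the only input that depends
on the type. -/
theorem posBar_isRefl_of_base (hbase : ∀ l m : Fin n, (l : ℕ) + 2 = n → (m : ℕ) + 1 = n →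
      IsRefl X n (midBar X n) (Equiv.swap l m) (actSbar l m)) (i j : Fin n) (hij : i < j) :
    IsRefl X n (posBar X n i j) (Equiv.swap i j) (actSbar i j) := by
  obtain ⟨i, hi⟩ := i
  obtain ⟨j, hj⟩ := j
  simp only [Fin.mk_lt_mk] at hij
  have hj' : j ≤ n - 1 := by omega
  induction hj' using Nat.decreasingInduction with
  | self =>
    have hi' : i ≤ n - 2 := by omega
    induction hi' using Nat.decreasingInduction with
    | self =>
      simp only
      rw [posBar_base (by omega)]
      exact hbase _ _ (by simp; omega) (by simp; omega)
    | of_succ i hi' ih =>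
      have h := (ih (by omega) (by omega)).conj
        (GenAct.simple (X := X) ⟨i, by omega⟩ ⟨i + 1, by omega⟩ rfl)
      rw [swap_conj_left (by simp; omega) (by simp; omega) (by simp),
        actS_conj_actSbar' (by simp) (by simp; omega) (by simp; omega)] at h
      simp only at h ⊢
      rwa [posBar_step_last (by omega)]
  | of_succ j hj' ih =>
    have h := (ih (by omega) (by omega)).conj
      (GenAct.simple (X := X) ⟨j, by omega⟩ ⟨j + 1, by omega⟩ rfl)
    rw [swap_conj_right (by simp; omega) (by simp; omega) (by simp),
      actS_conj_actSbar (by simp; omega) (by simp; omega) (by simp)] at h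
    simp only at h ⊢
    rwa [posBar_step (by omega) (by omega)]

theorem posBar_isRefl (hX : X ≠ .A) (i j : Fin n) (hij : i < j) :
    IsRefl X n (posBar X n i j) (Equiv.swap i j) (actSbar i j) := by
  refine posBar_isRefl_of_base (fun l m hl hm => ?_) i j hij
  cases X with
  | A => exact absurd rfl hX
  | B =>
    -- In type `B` the middle factor is the transposition of the last two indices conjugated by the
    -- sign change at the last one, which is the reflection in `y_l + y_m`.
    have h := (IsRefl.gen (GenAct.simple (X := .B) l m (by omega))).conj (GenAct.lastB rfl m hm)
    rw [one_mul, mul_one, actTau_conj_actS (by rintro rfl; omega)] at h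
    have e : (l : ℕ) = n - 2 := by omega
    rw [e] at h
    exact h
  | D => exact IsRefl.gen (GenAct.lastD rfl l m hl hm)

theorem barBrk_isRefl (hX : X ≠ .A) {i j : Fin n} (hij : i ≠ j) :
    IsRefl X n (barBrk X n i j) (Equiv.swap i j) (actSbar i j) := by
  rcases lt_or_gt_of_ne hij with h | h
  · rw [barBrk_of_lt h]; exact posBar_isRefl hX i j h
  · rw [barBrk_of_gt h, Equiv.swap_comm, actSbar_comm]; exact posBar_isRefl hX j i h

theorem barOne_isRefl (i : Fin n) : IsRefl .B n (barOne n i) 1 (actTau i) := by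
  obtain ⟨i, hi⟩ := i
  have hi' : i ≤ n - 1 := by omega
  rw [barOne_eq]
  induction hi' using Nat.decreasingInduction with
  | self =>
    simp only
    rw [posShort_last]
    exact IsRefl.gen (GenAct.lastB rfl ⟨n - 1, hi⟩ (by simp; omega))
  | of_succ i hi' ih =>
    have h := (ih (by omega)).conj
      (GenAct.simple (X := .B) ⟨i, by omega⟩ ⟨i + 1, by omega⟩ rfl)
    rw [mul_one, Equiv.swap_mul_self, actS_conj_actTau (by simp)] at h
    simp only at h ⊢
    rwa [posShort_step (by omega)]

end Generators

/-! ### Generators permute the commutators of y's and ξ's up to sign. -/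

section Coefficients

variable {X : WeylType} {n : ℕ}

/-- The parameter `u`. -/
def Datum.long : Datum X → ℂ
  | .A u => u
  | .B u _ => u
  | .D u => u

/-- The parameter `v` (`0` except in type `B`). -/
def Datum.short : Datum X → ℂ
  | .A _ => 0
  | .B _ v => v
  | .D _ => 0

/-- The element `\overline{[i]}` in type `B`, and `0` in the other types. -/
def shortBrk (X : WeylType) (n : ℕ) (i : Fin n) : SpinWeyl X n :=
  match X with
  | .A => 0
  | .B => barOne n i
  | .D => 0

/-- The commutator `[y_j, ξ_i]`. -/
def crossComm (d : Datum X) (j i : Fin n) : SpinWeyl X n :=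
  if j = i then
    d.long • ∑ k ∈ Finset.univ.erase i, (brk X n i k + barBrk X n i k) +
      d.short • shortBrk X n i
  else d.long • (-brk X n i j + barBrk X n i j)

variable {a : ℕ} {π : Equiv.Perm (Fin n)} {ε : Fin n → ℂ}
  {g : MvPolynomial (Fin n) ℂ →ₐ[ℂ] MvPolynomial (Fin n) ℂ}

/-- A simple transposition preserves the order of a pair except when it exchanges the two members.
In that case the reversed bracket supplies the sign of `twist_self`. -/
theorem twist_simple_brk {k l : Fin n} (hkl : (k : ℕ) + 1 = l) {i j : Fin n} (hij : i ≠ j) :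
    TwistBy (t X n k) (brk X n i j) (brk X n (Equiv.swap k l i) (Equiv.swap k l j)) := by
  wlog h : i < j generalizing i j
  · rw [brk_swap j i, brk_swap (Equiv.swap k l j)]
    exact (this hij.symm (by omega)).neg
  have hC := chainRoots (X := X) (n := n)
  have hk : k < l := by omega
  have el : (l : ℕ) = k + 1 := hkl.symm
  rcases eq_or_ne i k with rfl | hik
  · rw [Equiv.swap_apply_left]
    rcases eq_or_ne j l with rfl | hjl
    · rw [Equiv.swap_apply_right, brk_swap i j, brk_of_lt h, el]
      exact hC.twist_self (by omega)
    · rw [Equiv.swap_apply_of_ne_of_ne hij.symm hjl, brk_of_lt h, brk_of_lt (by omega), el]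
      exact hC.twist_bot (by omega) (by omega)
  rcases eq_or_ne i l with rfl | hil
  · rw [Equiv.swap_apply_right, Equiv.swap_apply_of_ne_of_ne (by omega) hij.symm, brk_of_lt h,
      brk_of_lt (by omega), el]
    exact (hC.twist_bot (by omega) (by omega)).symm (t_sq (lt_rank (by omega)))
  rw [Equiv.swap_apply_of_ne_of_ne hik hil]
  rcases eq_or_ne j k with rfl | hjk
  · rw [Equiv.swap_apply_left, brk_of_lt h, brk_of_lt (by omega), el]
    exact hC.twist_top h (by omega)
  rcases eq_or_ne j l with rfl | hjl
  · rw [Equiv.swap_apply_right, brk_of_lt h, brk_of_lt (by omega), el]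
    exact (hC.twist_top (by omega) (by omega)).symm (t_sq (lt_rank (by omega)))
  rw [Equiv.swap_apply_of_ne_of_ne hjk hjl, brk_of_lt h]
  by_cases hm : i < k ∧ k < j
  · exact hC.twist_mid hm.1 (by omega) (by omega)
  · exact hC.twist_far h (by omega) (by omega) (by omega)

theorem twist_simple_barBrk (hX : X ≠ .A → 2 ≤ n) {k l : Fin n} (hkl : (k : ℕ) + 1 = l)
    {i j : Fin n} (hij : i ≠ j) :
    TwistBy (t X n k) (barBrk X n i j) (barBrk X n (Equiv.swap k l i) (Equiv.swap k l j)) := by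
  wlog h : i < j generalizing i j
  · rw [barBrk_swap j i, barBrk_swap (Equiv.swap k l j)]
    exact this hij.symm (by omega)
  have hC : X = .A ∨ ChainCoroots (n - 1) (t X n) (posBar X n) := by
    cases X with
    | A => exact Or.inl rfl
    | B => exact Or.inr (chainCoroots_B (hX (by simp)))
    | D => exact Or.inr chainCoroots_D
  rcases hC with rfl | hC
  · rw [barBrk_A, barBrk_A]; exact TwistBy.zero _
  have hk : k < l := by omega
  have el : (l : ℕ) = k + 1 := hkl.symm
  have ht : t X n k * t X n k = 1 := t_sq (lt_rank (by omega))
  rcases eq_or_ne i k with rfl | hik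
  · rw [Equiv.swap_apply_left]
    rcases eq_or_ne j l with rfl | hjl
    · rw [Equiv.swap_apply_right, barBrk_swap i j, barBrk_of_lt h, el]
      exact hC.twist_self (by omega)
    · rw [Equiv.swap_apply_of_ne_of_ne hij.symm hjl, barBrk_of_lt h, barBrk_of_lt (by omega), el]
      exact (hC.twist_bot (by omega) (by omega)).symm ht
  rcases eq_or_ne i l with rfl | hil
  · rw [Equiv.swap_apply_right, Equiv.swap_apply_of_ne_of_ne (by omega) hij.symm,
      barBrk_of_lt h, barBrk_of_lt (by omega), el]
    exact hC.twist_bot (by omega) (by omega)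
  rw [Equiv.swap_apply_of_ne_of_ne hik hil]
  rcases eq_or_ne j k with rfl | hjk
  · rw [Equiv.swap_apply_left, barBrk_of_lt h, barBrk_of_lt (by omega), el]
    exact (hC.twist_top h (by omega)).symm ht
  rcases eq_or_ne j l with rfl | hjl
  · rw [Equiv.swap_apply_right, barBrk_of_lt h, barBrk_of_lt (by omega), el]
    exact hC.twist_top (by omega) (by omega)
  rw [Equiv.swap_apply_of_ne_of_ne hjk hjl, barBrk_of_lt h]
  rcases lt_or_gt_of_ne hik with h1 | h1
  · rcases lt_or_gt_of_ne hjk with h2 | h2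
    · exact hC.twist_high h h2 (by omega)
    · exact hC.twist_mid h1 (by omega) (by omega)
  · exact hC.twist_low h (by omega) (by omega)

theorem twist_simple_short {k l : Fin n} (hkl : (k : ℕ) + 1 = l) (i : Fin n) :
    TwistBy (t X n k) (shortBrk X n i) (shortBrk X n (Equiv.swap k l i)) := by
  cases X with
  | A => exact TwistBy.zero _
  | D => exact TwistBy.zero _
  | B =>
    have hC := chainShort (n := n)
    have el : (l : ℕ) = k + 1 := hkl.symm
    have ht : t .B n k * t .B n k = 1 := t_sq (lt_rank (by omega))
    simp only [shortBrk, barOne_eq]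
    rcases eq_or_ne i k with rfl | hik
    · rw [Equiv.swap_apply_left, el]
      exact (hC.twist_near (by omega)).symm ht
    rcases eq_or_ne i l with rfl | hil
    · rw [Equiv.swap_apply_right, el]
      exact hC.twist_near (by omega)
    rw [Equiv.swap_apply_of_ne_of_ne hik hil]
    rcases lt_or_gt_of_ne hik with h1 | h1
    · exact hC.twist_high h1 (by omega)
    · exact hC.twist_low (by omega) (by omega)

theorem twist_lastB_brk (hn : 2 ≤ n) {m : Fin n} (hm : (m : ℕ) + 1 = n) {i j : Fin n}
    (hij : i ≠ j) : TwistBy (t .B n (n - 1)) (brk .B n i j)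
      (if j = m then barBrk .B n i j else if i = m then -barBrk .B n i j else brk .B n i j) := by
  have hC := lastNodeB hn
  have em : (m : ℕ) = n - 1 := by omega
  split_ifs with h1 h2
  · subst h1
    have h : i < j := by omega
    rw [brk_of_lt h, barBrk_of_lt h, em]
    exact hC.twist_root_last (by omega)
  · subst h2
    have h : j < i := by omega
    rw [brk_of_gt h, barBrk_of_gt h, em]
    exact (hC.twist_root_last (by omega)).neg
  · rcases lt_or_gt_of_ne hij with h | h
    · rw [brk_of_lt h]; exact hC.twist_root h (by omega)
    · rw [brk_of_gt h]; exact (hC.twist_root h (by omega)).neg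

/-- If the last index occurs, this is `twist_lastB_brk` read backwards, as the generator is an
involution. -/
theorem twist_lastB_barBrk (hn : 2 ≤ n) {m : Fin n} (hm : (m : ℕ) + 1 = n) {i j : Fin n}
    (hij : i ≠ j) : TwistBy (t .B n (n - 1)) (barBrk .B n i j)
      (if j = m then brk .B n i j else if i = m then -brk .B n i j else barBrk .B n i j) := by
  have hs := tB_last_sq (n := n) (by omega)
  have h := twist_lastB_brk hn hm hij
  split_ifs at h ⊢ with h1 h2
  · exact h.symm hs
  · have := (h.symm hs).neg
    rwa [neg_neg] at this
  · have hC := lastNodeB hn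
    rcases lt_or_gt_of_ne hij with h | h
    · rw [barBrk_of_lt h]; exact hC.twist_coroot h (by omega)
    · rw [barBrk_of_gt h]; exact hC.twist_coroot h (by omega)

theorem twist_lastB_short (hn : 2 ≤ n) {m : Fin n} (hm : (m : ℕ) + 1 = n) (i : Fin n) :
    TwistBy (t .B n (n - 1)) (barOne n i) (if i = m then -barOne n i else barOne n i) := by
  have hC := lastNodeB hn
  simp only [barOne_eq]
  split_ifs with h
  · have e : (i : ℕ) = n - 1 := by omega
    rw [e]
    exact hC.twist_short_last
  · exact hC.twist_short (by omega)

/-- As `i < j`, the case `i = l` forces `j = m`: the two reflections in the plane of the last two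
variables commute. If only `j` is one of the last two indices, the bracket becomes barred and that
index is exchanged with the other. -/
theorem twist_lastD_brk_of_lt (hn : 2 ≤ n) {l m : Fin n} (hl : (l : ℕ) + 2 = n)
    (hm : (m : ℕ) + 1 = n) {i j : Fin n} (hij : i < j) :
    TwistBy (t .D n (n - 1)) (brk .D n i j)
      (if i = l then brk .D n i j else if j = l ∨ j = m then barBrk .D n i (Equiv.swap l m j)
        else brk .D n i j) := by
  have hC := lastNodeD hn
  have em : (m : ℕ) = n - 1 := by omega
  have el : (l : ℕ) = n - 2 := by omega
  split_ifs with h1 h2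
  · subst h1
    obtain rfl : j = m := by omega
    rw [brk_of_lt hij, em]
    exact hC.twist_root_self (by omega)
  · rcases h2 with rfl | rfl
    · rw [Equiv.swap_apply_left, brk_of_lt hij, barBrk_of_lt (by omega), em]
      exact hC.twist_root_near hij (by omega)
    · rw [Equiv.swap_apply_right, brk_of_lt hij, barBrk_of_lt (by omega), em]
      exact hC.twist_root_last (by omega) (by omega)
  · rw [brk_of_lt hij]; exact hC.twist_root hij (by omega)

theorem twist_lastD_barBrk_of_lt (hn : 2 ≤ n) {l m : Fin n} (hl : (l : ℕ) + 2 = n)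
    (hm : (m : ℕ) + 1 = n) {i j : Fin n} (hij : i < j) :
    TwistBy (t .D n (n - 1)) (barBrk .D n i j)
      (if i = l then -barBrk .D n i j else if j = l ∨ j = m then brk .D n i (Equiv.swap l m j)
        else barBrk .D n i j) := by
  have hC := lastNodeD hn
  have em : (m : ℕ) = n - 1 := by omega
  have el : (l : ℕ) = n - 2 := by omega
  split_ifs with h1 h2
  · subst h1
    obtain rfl : j = m := by omega
    rw [barBrk_of_lt hij, em]
    exact hC.twist_coroot_self (by omega)
  · rcases h2 with rfl | rfl
    · rw [Equiv.swap_apply_left, barBrk_of_lt hij, brk_of_lt (by omega), em]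
      exact (hC.twist_root_last hij (by omega)).symm hC.sq
    · rw [Equiv.swap_apply_right, barBrk_of_lt hij, brk_of_lt (by omega), em]
      exact (hC.twist_root_near (by omega) (by omega)).symm hC.sq
  · rw [barBrk_of_lt hij]; exact hC.twist_coroot hij (by omega)

/-- Generators permute the elements `[i,j] + \overline{[i,j]}` up to sign. -/
theorem GenAct.twist_add (h : GenAct X n a π ε g) (hX : X ≠ .A → 2 ≤ n) {i j : Fin n}
    (hij : i ≠ j) : TwistBy (t X n a) (brk X n i j + barBrk X n i j)
      (ε i • (brk X n (π i) (π j) + barBrk X n (π i) (π j))) := by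
  cases h with
  | simple k l hkl =>
    rw [one_smul]
    exact (twist_simple_brk hkl hij).add (twist_simple_barBrk hX hkl hij)
  | lastB hX' m hm =>
    subst hX'
    have hn := hX (by simp)
    -- If one of the indices is the last, the two summands change places up to a common sign; hence
    -- the sum is transformed into a multiple of itself.
    convert (twist_lastB_brk hn hm hij).add (twist_lastB_barBrk hn hm hij) using 1
    have hij' : i = m → j ≠ m := fun h1 h2 => hij (h1.trans h2.symm)
    simp only [Equiv.Perm.one_apply]
    split_ifs with h1 h2 h2
    · exact absurd h2 (hij' h1)
    · rw [neg_smul, one_smul, neg_add, add_comm]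
    · rw [one_smul, add_comm]
    · rw [one_smul]
  | lastD hX' l m hl hm =>
    subst hX'
    have hn := hX (by simp)
    have hlm : l ≠ m := by rintro rfl; omega
    rcases lt_or_gt_of_ne hij with h | h
    · convert (twist_lastD_brk_of_lt hn hl hm h).add (twist_lastD_barBrk_of_lt hn hl hm h) using 1
      by_cases h1 : i = l
      · obtain rfl : j = m := by omega
        subst h1
        simp [brk_swap i j, barBrk_swap i j]
      · have h2 : i ≠ m := by omega
        simp only [h1, h2, if_false, or_self, one_smul, Equiv.swap_apply_of_ne_of_ne h1 h2]
        split_ifs with h3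
        · rw [add_comm]
        · rw [not_or] at h3
          rw [Equiv.swap_apply_of_ne_of_ne h3.1 h3.2]
    · rw [brk_swap j i, barBrk_swap j i]
      convert (twist_lastD_brk_of_lt hn hl hm h).neg.add
        (twist_lastD_barBrk_of_lt hn hl hm h) using 1
      by_cases h1 : j = l
      · obtain rfl : i = m := by omega
        subst h1
        simp
      · have h2 : j ≠ m := by omega
        simp only [h1, if_false, Equiv.swap_apply_of_ne_of_ne h1 h2]
        split_ifs with h3
        · rw [brk_swap j, barBrk_swap j, neg_smul, one_smul, neg_add, neg_neg, add_comm]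
        · rw [not_or] at h3
          rw [Equiv.swap_apply_of_ne_of_ne h3.1 h3.2, one_smul, brk_swap j i, barBrk_swap j i]

/-- Generators permute the elements `-[i,j] + \overline{[i,j]}` up to sign. -/
theorem GenAct.twist_sub (h : GenAct X n a π ε g) (hX : X ≠ .A → 2 ≤ n) {i j : Fin n}
    (hij : i ≠ j) : TwistBy (t X n a) (-brk X n i j + barBrk X n i j)
      (ε j • (-brk X n (π i) (π j) + barBrk X n (π i) (π j))) := by
  -- As `-[i,j] + \overline{[i,j]} = [j,i] + \overline{[j,i]}`, exchanging the indices suffices.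
  have := h.twist_add hX hij.symm
  rwa [brk_swap i j, barBrk_swap i j, brk_swap (π i) (π j), barBrk_swap (π i) (π j)] at this

theorem GenAct.twist_short (h : GenAct X n a π ε g) (hX : X ≠ .A → 2 ≤ n) (i : Fin n) :
    TwistBy (t X n a) (shortBrk X n i) (ε i • shortBrk X n (π i)) := by
  cases h with
  | simple k l hkl => rw [one_smul]; exact twist_simple_short hkl i
  | lastB hX' m hm =>
    subst hX'
    have := twist_lastB_short (hX (by simp)) hm i
    simp only [shortBrk, Equiv.Perm.one_apply]
    split_ifs at this ⊢ with h1 <;> simpa using this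
  | lastD hX' l m hl hm =>
    subst hX'
    simp only [shortBrk, smul_zero]
    exact TwistBy.zero _

/-- Generators permute the commutators `[y_j, ξ_i]` up to sign. -/
theorem GenAct.twist_crossComm (h : GenAct X n a π ε g) (hX : X ≠ .A → 2 ≤ n) (d : Datum X)
    (j i : Fin n) : TwistBy (t X n a) (crossComm d j i) (ε j • crossComm d (π j) (π i)) := by
  unfold crossComm
  by_cases hji : j = i
  · subst hji
    rw [if_pos rfl, if_pos rfl, smul_add, smul_comm (ε j), smul_comm (ε j)]
    refine (TwistBy.smul _ ?_).add ((h.twist_short hX j).smul _)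
    rw [Finset.smul_sum]
    have e : ∑ k ∈ Finset.univ.erase (π j), ε j • (brk X n (π j) k + barBrk X n (π j) k) =
        ∑ k ∈ Finset.univ.erase j, ε j • (brk X n (π j) (π k) + barBrk X n (π j) (π k)) := by
      symm
      refine Finset.sum_equiv π (fun k => ?_) fun k _ => rfl
      simp
    rw [e]
    exact TwistBy.sum fun k hk => h.twist_add hX (Finset.ne_of_mem_erase hk).symm
  · rw [if_neg hji, if_neg (π.injective.ne hji), smul_comm (ε j)]
    exact (h.twist_sub hX (Ne.symm hji)).smul _

end Coefficients

/-! ### Coxeter relations for the action on polynomials. -/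

section PolyAction

variable {X : WeylType} {n : ℕ}

theorem coxeterEntry_symm (a b : ℕ) : coxeterEntry X n a b = coxeterEntry X n b a := by
  cases X <;> simp only [coxeterEntry, true_and, reduceCtorEq, false_and, if_false] <;>
    split_ifs <;> omega

theorem coxeterEntry_self (a : ℕ) : coxeterEntry X n a a = 1 := by
  simp [coxeterEntry]

theorem coxeterEntry_B {a : ℕ} (ha : a + 1 < n) :
    coxeterEntry .B n a (n - 1) = if a + 2 = n then 4 else 2 := by
  unfold coxeterEntry
  simp only [true_and, reduceCtorEq, false_and, if_false]
  split_ifs <;> omega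

theorem coxeterEntry_D {a : ℕ} (ha : a + 1 < n) :
    coxeterEntry .D n a (n - 1) = if a + 3 = n then 3 else 2 := by
  unfold coxeterEntry
  simp only [true_and, reduceCtorEq, false_and, if_false]
  split_ifs <;> omega

variable {a b : ℕ} {π π' : Equiv.Perm (Fin n)} {ε ε' : Fin n → ℂ}
  {g g' : MvPolynomial (Fin n) ℂ →ₐ[ℂ] MvPolynomial (Fin n) ℂ}

/-- This makes the choice in `polyAct` harmless. -/
theorem GenAct.unique (h : GenAct X n a π ε g) (h' : GenAct X n b π' ε' g') (hab : a = b) :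
    g = g' := by
  cases h with
  | simple i j hij =>
    cases h' with
    | simple k l hkl =>
      obtain rfl : i = k := Fin.ext hab
      obtain rfl : j = l := by omega
      rfl
    | lastB => omega
    | lastD => omega
  | lastB hX m hm =>
    cases h' with
    | simple k l hkl => omega
    | lastB _ m' hm' =>
      obtain rfl : m = m' := by omega
      rfl
    | lastD hX' => simp [hX] at hX'
  | lastD hX l m hl hm =>
    cases h' with
    | simple k l hkl => omega
    | lastB hX' => simp [hX] at hX'
    | lastD _ l' m' hl' hm' =>
      obtain rfl : m = m' := by omega
      obtain rfl : l = l' := by omega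
      rfl

/-- On polynomials the Coxeter relations hold without signs. In type `D` a commuting pair need not
have disjoint support: the two reflections on the last two variables also commute. -/
theorem GenAct.commute (h : GenAct X n a π ε g) (h' : GenAct X n b π' ε' g')
    (hab : coxeterEntry X n a b = 2) : g * g' = g' * g := by
  cases h with
  | simple i j hij =>
    cases h' with
    | simple k l hkl =>
      rw [coxeterEntry_chain (by omega) (by omega)] at hab
      simp only [ite_eq_iff] at hab
      exact actS_commute (by omega) (by omega) (by omega) (by omega)
    | lastB hX m hm =>
      subst hX
      rw [coxeterEntry_B (by omega)] at hab
      simp only [ite_eq_iff] at hab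
      exact actS_commute_actTau (by omega) (by omega)
    | lastD hX l m hl hm =>
      subst hX
      rw [coxeterEntry_D (by omega)] at hab
      simp only [ite_eq_iff] at hab
      by_cases hil : i = l
      · obtain rfl : j = m := by omega
        subst hil
        exact actS_commute_actSbar_self _ _
      · exact actS_commute_actSbar (by omega) (by omega) (by omega) (by omega)
  | lastB hX m hm =>
    subst hX
    cases h' with
    | simple k l hkl =>
      rw [coxeterEntry_symm, coxeterEntry_B (by omega)] at hab
      simp only [ite_eq_iff] at hab
      exact (actS_commute_actTau (by omega) (by omega)).symm
    | lastB => simp [coxeterEntry_self] at hab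
    | lastD hX' => simp at hX'
  | lastD hX l m hl hm =>
    subst hX
    cases h' with
    | simple i j hij =>
      rw [coxeterEntry_symm, coxeterEntry_D (by omega)] at hab
      simp only [ite_eq_iff] at hab
      by_cases hil : i = l
      · obtain rfl : j = m := by omega
        subst hil
        exact (actS_commute_actSbar_self _ _).symm
      · exact (actS_commute_actSbar (by omega) (by omega) (by omega) (by omega)).symm
    | lastB hX' => simp at hX'
    | lastD => simp [coxeterEntry_self] at hab

theorem GenAct.braid (h : GenAct X n a π ε g) (h' : GenAct X n b π' ε' g')
    (hab : coxeterEntry X n a b = 3) : g * g' * g = g' * g * g' := by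
  cases h with
  | simple i j hij =>
    cases h' with
    | simple k l hkl =>
      rw [coxeterEntry_chain (by omega) (by omega)] at hab
      simp only [ite_eq_iff] at hab
      rcases (show (i : ℕ) + 1 = k ∨ (k : ℕ) + 1 = i by omega) with h2 | h2
      · obtain rfl : j = k := by omega
        rw [actS_conj_actS (by omega) (by omega) (by omega),
          actS_conj_actS' (by omega) (by omega) (by omega)]
      · obtain rfl : i = l := by omega
        rw [actS_conj_actS (by omega) (by omega) (by omega),
          actS_conj_actS' (by omega) (by omega) (by omega)]
    | lastB hX m hm =>
      subst hX
      rw [coxeterEntry_B (by omega)] at hab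
      simp only [ite_eq_iff] at hab
      omega
    | lastD hX l m hl hm =>
      subst hX
      rw [coxeterEntry_D (by omega)] at hab
      simp only [ite_eq_iff] at hab
      obtain rfl : j = l := by omega
      rw [actSbar_conj_actS (by omega) (by omega) (by omega),
        actS_conj_actSbar' (by omega) (by omega) (by omega)]
  | lastB hX m hm =>
    subst hX
    cases h' with
    | simple k l hkl =>
      rw [coxeterEntry_symm, coxeterEntry_B (by omega)] at hab
      simp only [ite_eq_iff] at hab
      omega
    | lastB => simp [coxeterEntry_self] at hab
    | lastD hX' => simp at hX'
  | lastD hX l m hl hm =>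
    subst hX
    cases h' with
    | simple i j hij =>
      rw [coxeterEntry_symm, coxeterEntry_D (by omega)] at hab
      simp only [ite_eq_iff] at hab
      obtain rfl : j = l := by omega
      rw [actSbar_conj_actS (by omega) (by omega) (by omega),
        actS_conj_actSbar' (by omega) (by omega) (by omega)]
    | lastB hX' => simp at hX'
    | lastD => simp [coxeterEntry_self] at hab

theorem actS_actTau_sq {i m : Fin n} (him : i ≠ m) :
    (actS i m * actTau m) ^ 2 = (actTau m * actS i m) ^ 2 := by
  calc (actS i m * actTau m) ^ 2 = actS i m * (actTau m * actS i m * actTau m) := by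
        simp only [pow_two, mul_assoc]
    _ = (actTau m * actS i m * actTau m) * actS i m := by
        rw [actTau_conj_actS him, actS_commute_actSbar_self]
    _ = _ := by simp only [pow_two, mul_assoc]

theorem GenAct.quad (h : GenAct X n a π ε g) (h' : GenAct X n b π' ε' g')
    (hab : coxeterEntry X n a b = 4) : (g * g') ^ 2 = (g' * g) ^ 2 := by
  cases h with
  | simple i j hij =>
    cases h' with
    | simple k l hkl =>
      rw [coxeterEntry_chain (by omega) (by omega)] at hab
      simp only [ite_eq_iff] at hab
      omega
    | lastB hX m hm =>
      subst hX
      rw [coxeterEntry_B (by omega)] at hab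
      simp only [ite_eq_iff] at hab
      obtain rfl : j = m := by omega
      exact actS_actTau_sq (by omega)
    | lastD hX l m hl hm =>
      subst hX
      rw [coxeterEntry_D (by omega)] at hab
      simp only [ite_eq_iff] at hab
      omega
  | lastB hX m hm =>
    subst hX
    cases h' with
    | simple k l hkl =>
      rw [coxeterEntry_symm, coxeterEntry_B (by omega)] at hab
      simp only [ite_eq_iff] at hab
      obtain rfl : l = m := by omega
      exact (actS_actTau_sq (by omega)).symm
    | lastB => simp [coxeterEntry_self] at hab
    | lastD hX' => simp at hX'
  | lastD hX l m hl hm =>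
    subst hX
    cases h' with
    | simple i j hij =>
      rw [coxeterEntry_symm, coxeterEntry_D (by omega)] at hab
      simp only [ite_eq_iff] at hab
      omega
    | lastB hX' => simp at hX'
    | lastD => simp [coxeterEntry_self] at hab

open Classical in
/-- The action of the simple reflection `s_a` on polynomials. -/
def polyAct (X : WeylType) (n a : ℕ) : MvPolynomial (Fin n) ℂ →ₐ[ℂ] MvPolynomial (Fin n) ℂ :=
  if h : ∃ g, ∃ π ε, GenAct X n a π ε g then h.choose else 1

theorem GenAct.polyAct_eq (h : GenAct X n a π ε g) : polyAct X n a = g := by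
  have h' : ∃ g, ∃ π ε, GenAct X n a π ε g := ⟨g, π, ε, h⟩
  rw [polyAct, dif_pos h']
  obtain ⟨π', ε', h2⟩ := h'.choose_spec
  exact h2.unique h rfl

end PolyAction

/-! ### The diagonal action of the spin Weyl group algebra. -/

section TensorAction

variable {X : WeylType} {n : ℕ}
variable (V : Type*) [AddCommGroup V] [Module ℂ V] [Module (SpinWeyl X n) V]
  [IsScalarTower ℂ (SpinWeyl X n) V]

/-- The operator `φ ⊗ x` on `ℂ[y_1, …, y_n] ⊗ V`, for a linear map `φ` and `x ∈ ℂW⁻`. -/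
def tensorOp (φ : MvPolynomial (Fin n) ℂ →ₗ[ℂ] MvPolynomial (Fin n) ℂ) (x : SpinWeyl X n) :
    Module.End ℂ (MvPolynomial (Fin n) ℂ ⊗[ℂ] V) :=
  TensorProduct.map φ (Algebra.lsmul ℂ ℂ V x)

theorem tensorOp_tmul (φ : MvPolynomial (Fin n) ℂ →ₗ[ℂ] MvPolynomial (Fin n) ℂ)
    (x : SpinWeyl X n) (f : MvPolynomial (Fin n) ℂ) (w : V) :
    tensorOp V φ x (f ⊗ₜ w) = φ f ⊗ₜ (x • w) := rfl

theorem tensorOp_mul (φ ψ : MvPolynomial (Fin n) ℂ →ₐ[ℂ] MvPolynomial (Fin n) ℂ)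
    (x y : SpinWeyl X n) :
    tensorOp V φ.toLinearMap x * tensorOp V ψ.toLinearMap y =
      tensorOp V (φ * ψ).toLinearMap (x * y) := by
  refine TensorProduct.ext' fun f w => ?_
  simp only [Module.End.mul_apply, tensorOp_tmul, mul_smul, AlgHom.toLinearMap_apply,
    AlgHom.mul_apply]

theorem tensorOp_neg (φ : MvPolynomial (Fin n) ℂ →ₗ[ℂ] MvPolynomial (Fin n) ℂ)
    (x : SpinWeyl X n) : tensorOp V φ (-x) = -tensorOp V φ x := by
  refine TensorProduct.ext' fun f w => ?_
  simp only [LinearMap.neg_apply, tensorOp_tmul, neg_smul, TensorProduct.tmul_neg]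

theorem tensorOp_one :
    tensorOp V (1 : MvPolynomial (Fin n) ℂ →ₐ[ℂ] MvPolynomial (Fin n) ℂ).toLinearMap
      (1 : SpinWeyl X n) = 1 := by
  refine TensorProduct.ext' fun f w => ?_
  simp [tensorOp_tmul]

/-- The operators by which the `t_a` act on `ℂ[y_1, …, y_n] ⊗ V`. -/
def genOp (X : WeylType) (n : ℕ) (V : Type*) [AddCommGroup V] [Module ℂ V]
    [Module (SpinWeyl X n) V] [IsScalarTower ℂ (SpinWeyl X n) V] (a : ℕ) :
    Module.End ℂ (MvPolynomial (Fin n) ℂ ⊗[ℂ] V) :=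
  tensorOp V (polyAct X n a).toLinearMap (t X n a)

/-- The polynomial factor satisfies the ordinary relations and the factor on `V` the spin relations,
so the signs of the latter appear exactly once in the tensor product. -/
theorem spinFamily_genOp (hX : X ≠ .A → 2 ≤ n) : SpinFamily X n (genOp X n V) where
  sq a ha := by
    obtain ⟨π, ε, g, h⟩ := exists_genAct ha hX
    rw [genOp, h.polyAct_eq, tensorOp_mul, h.g_sq, h.t_sq, tensorOp_one]
  two a ha b hb hab := by
    obtain ⟨π, ε, g, h⟩ := exists_genAct ha hX
    obtain ⟨π', ε', g', h'⟩ := exists_genAct hb hX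
    rw [genOp, genOp, h.polyAct_eq, h'.polyAct_eq, tensorOp_mul, tensorOp_mul, ← tensorOp_neg,
      h.commute h' hab, t_two ha hb hab]
  three a ha b hb hab := by
    obtain ⟨π, ε, g, h⟩ := exists_genAct ha hX
    obtain ⟨π', ε', g', h'⟩ := exists_genAct hb hX
    simp only [genOp, h.polyAct_eq, h'.polyAct_eq, tensorOp_mul]
    rw [h.braid h' hab, t_three ha hb hab]
  four a ha b hb hab := by
    obtain ⟨π, ε, g, h⟩ := exists_genAct ha hX
    obtain ⟨π', ε', g', h'⟩ := exists_genAct hb hX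
    simp only [genOp, h.polyAct_eq, h'.polyAct_eq, tensorOp_mul, pow_two]
    rw [← tensorOp_neg]
    have h1 := h.quad h' hab
    have h2 := t_four ha hb hab
    simp only [pow_two] at h1 h2
    rw [h1, h2]

/-- The diagonal action of `ℂW⁻` on `ℂ[y_1, …, y_n] ⊗ V`. -/
def spinAction (hX : X ≠ .A → 2 ≤ n) :
    SpinWeyl X n →ₐ[ℂ] Module.End ℂ (MvPolynomial (Fin n) ℂ ⊗[ℂ] V) :=
  (spinFamily_genOp V hX).lift

variable (hX : X ≠ .A → 2 ≤ n)

theorem spinAction_t {a : ℕ} {π : Equiv.Perm (Fin n)} {ε : Fin n → ℂ}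
    {g : MvPolynomial (Fin n) ℂ →ₐ[ℂ] MvPolynomial (Fin n) ℂ} (h : GenAct X n a π ε g) :
    spinAction V hX (t X n a) = tensorOp V g.toLinearMap (t X n a) := by
  rw [spinAction, (spinFamily_genOp V hX).lift_t h.lt_rank, genOp, h.polyAct_eq]

/-- A general element of `ℂW⁻` does not act by a pure tensor. Reflections do, because pure tensors
are stable under the conjugations that produce them. -/
theorem spinAction_of_isRefl {x : SpinWeyl X n} {π : Equiv.Perm (Fin n)}
    {g : MvPolynomial (Fin n) ℂ →ₐ[ℂ] MvPolynomial (Fin n) ℂ} (h : IsRefl X n x π g) :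
    spinAction V hX x = tensorOp V g.toLinearMap x := by
  induction h with
  | gen h => exact spinAction_t V hX h
  | conj hx h ih =>
    rw [map_neg, map_mul, map_mul, ih, spinAction_t V hX h, tensorOp_mul, tensorOp_mul,
      tensorOp_neg]
  | neg hx ih => rw [map_neg, ih, tensorOp_neg]

theorem spinAction_one_tmul (s : SpinWeyl X n) :
    ∀ w : V, spinAction V hX s ((1 : MvPolynomial (Fin n) ℂ) ⊗ₜ w) = 1 ⊗ₜ (s • w) := by
  let A : Subalgebra ℂ (SpinWeyl X n) :=
    { carrier := {s | ∀ w : V, spinAction V hX s (1 ⊗ₜ w) = 1 ⊗ₜ (s • w)}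
      mul_mem' := fun {r s} hr hs w => by
        rw [map_mul, Module.End.mul_apply, hs, hr, mul_smul]
      add_mem' := fun {r s} hr hs w => by
        rw [map_add, LinearMap.add_apply, hs, hr, add_smul, TensorProduct.tmul_add]
      algebraMap_mem' := fun c w => by
        rw [AlgHom.commutes, Module.algebraMap_end_apply, algebraMap_smul,
          TensorProduct.tmul_smul] }
  refine spin_induction A (fun a ha w => ?_) s
  obtain ⟨π, ε, g, h⟩ := exists_genAct ha hX
  rw [spinAction_t V hX h, tensorOp_tmul, AlgHom.toLinearMap_apply, map_one]

theorem spinAction_brk {i k : Fin n} (hik : i ≠ k) (f : MvPolynomial (Fin n) ℂ) (w : V) :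
    spinAction V hX (brk X n i k) (f ⊗ₜ w) = actS i k f ⊗ₜ (brk X n i k • w) := by
  rw [spinAction_of_isRefl V hX (brk_isRefl hik), tensorOp_tmul, AlgHom.toLinearMap_apply]

theorem spinAction_barBrk {i k : Fin n} (hik : i ≠ k) (f : MvPolynomial (Fin n) ℂ) (w : V) :
    spinAction V hX (barBrk X n i k) (f ⊗ₜ w) = actSbar i k f ⊗ₜ (barBrk X n i k • w) := by
  by_cases hA : X = .A
  · subst hA
    rw [barBrk_A, map_zero, LinearMap.zero_apply, zero_smul, TensorProduct.tmul_zero]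
  · rw [spinAction_of_isRefl V hX (barBrk_isRefl hA hik), tensorOp_tmul,
      AlgHom.toLinearMap_apply]

theorem spinAction_shortBrk (i : Fin n) (f : MvPolynomial (Fin n) ℂ) (w : V) :
    spinAction V hX (shortBrk X n i) (f ⊗ₜ w) = actTau i f ⊗ₜ (shortBrk X n i • w) := by
  cases X with
  | A =>
    simp only [shortBrk]
    rw [map_zero, LinearMap.zero_apply, zero_smul, TensorProduct.tmul_zero]
  | B =>
    simp only [shortBrk]
    rw [spinAction_of_isRefl V hX (barOne_isRefl i), tensorOp_tmul, AlgHom.toLinearMap_apply]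
  | D =>
    simp only [shortBrk]
    rw [map_zero, LinearMap.zero_apply, zero_smul, TensorProduct.tmul_zero]

end TensorAction

/-! ### Divided differences, Dunkl operators and their relations. -/

section Dunkl

open MvPolynomial

variable {X : WeylType} {n : ℕ}

/-- A divided difference, as a linear map. -/
def divDiff (φ : MvPolynomial (Fin n) ℂ →ₐ[ℂ] MvPolynomial (Fin n) ℂ)
    (p : MvPolynomial (Fin n) ℂ) (hp : p ≠ 0)
    (q : MvPolynomial (Fin n) ℂ → MvPolynomial (Fin n) ℂ) (hq : ∀ f, p * q f = f - φ f) :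
    MvPolynomial (Fin n) ℂ →ₗ[ℂ] MvPolynomial (Fin n) ℂ where
  toFun := q
  map_add' f g := mul_left_cancel₀ hp (by rw [mul_add, hq, hq, hq, map_add]; ring)
  map_smul' c f := mul_left_cancel₀ hp (by
    rw [RingHom.id_apply, mul_smul_comm, hq, hq, map_smul, smul_sub])

/-- The twisted Leibniz rule, with `h` in the role of the divided difference of `g`; it is checked
after multiplication by `p`. -/
theorem divDiff_mul {φ : MvPolynomial (Fin n) ℂ →ₐ[ℂ] MvPolynomial (Fin n) ℂ}
    {p : MvPolynomial (Fin n) ℂ} (hp : p ≠ 0)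
    {q : MvPolynomial (Fin n) ℂ → MvPolynomial (Fin n) ℂ} (hq : ∀ f, p * q f = f - φ f)
    (f g h : MvPolynomial (Fin n) ℂ) (hg : p * h = g - φ g) :
    q (g * f) = g * q f + h * φ f := by
  refine mul_left_cancel₀ hp ?_
  rw [hq, map_mul, mul_add, mul_left_comm, hq, ← mul_assoc, hg]
  ring

theorem divDiff_one {φ : MvPolynomial (Fin n) ℂ →ₐ[ℂ] MvPolynomial (Fin n) ℂ}
    {p : MvPolynomial (Fin n) ℂ} (hp : p ≠ 0)
    {q : MvPolynomial (Fin n) ℂ → MvPolynomial (Fin n) ℂ} (hq : ∀ f, p * q f = f - φ f) :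
    q 1 = 0 := by
  refine mul_left_cancel₀ hp ?_
  rw [hq, map_one, sub_self, mul_zero]

theorem X_sub_X_ne_zero {k i : Fin n} (h : k ≠ i) :
    (MvPolynomial.X i - MvPolynomial.X k : MvPolynomial (Fin n) ℂ) ≠ 0 := by
  rw [sub_ne_zero]
  exact fun e => h (MvPolynomial.X_injective e).symm

theorem X_add_X_ne_zero {k i : Fin n} (h : k ≠ i) :
    (MvPolynomial.X i + MvPolynomial.X k : MvPolynomial (Fin n) ℂ) ≠ 0 := by
  intro e
  have := congrArg (MvPolynomial.eval fun j => if j = i then (1 : ℂ) else 0) e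
  simp [h] at this

theorem two_mul_X_ne_zero (i : Fin n) :
    (2 * MvPolynomial.X i : MvPolynomial (Fin n) ℂ) ≠ 0 :=
  mul_ne_zero two_ne_zero (MvPolynomial.X_ne_zero i)

/-- `quotS k i` as a linear map (and `0` if `k = i`). -/
def quotSLin (k i : Fin n) : MvPolynomial (Fin n) ℂ →ₗ[ℂ] MvPolynomial (Fin n) ℂ :=
  if h : k ≠ i then divDiff _ _ (X_sub_X_ne_zero h) (quotS k i) (quotS_spec k i) else 0

/-- `quotSbar k i` as a linear map (and `0` if `k = i`). -/
def quotSbarLin (k i : Fin n) : MvPolynomial (Fin n) ℂ →ₗ[ℂ] MvPolynomial (Fin n) ℂ :=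
  if h : k ≠ i then divDiff _ _ (X_add_X_ne_zero h) (quotSbar k i) (quotSbar_spec k i) else 0

/-- `quotTau i` as a linear map. -/
def quotTauLin (i : Fin n) : MvPolynomial (Fin n) ℂ →ₗ[ℂ] MvPolynomial (Fin n) ℂ :=
  divDiff _ _ (two_mul_X_ne_zero i) (quotTau i) (quotTau_spec i)

theorem quotSLin_apply {k i : Fin n} (h : k ≠ i) (f : MvPolynomial (Fin n) ℂ) :
    quotSLin k i f = quotS k i f := by rw [quotSLin, dif_pos h]; rfl

theorem quotSbarLin_apply {k i : Fin n} (h : k ≠ i) (f : MvPolynomial (Fin n) ℂ) :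
    quotSbarLin k i f = quotSbar k i f := by rw [quotSbarLin, dif_pos h]; rfl

theorem quotTauLin_apply (i : Fin n) (f : MvPolynomial (Fin n) ℂ) :
    quotTauLin i f = quotTau i f := rfl

theorem quotS_X_mul {k i : Fin n} (h : k ≠ i) (j : Fin n) (f : MvPolynomial (Fin n) ℂ) :
    quotS k i (MvPolynomial.X j * f) = MvPolynomial.X j * quotS k i f +
      (if j = i then actS k i f else if j = k then -actS k i f else 0) := by
  rw [divDiff_mul (X_sub_X_ne_zero h) (quotS_spec k i) f (MvPolynomial.X j)
    (if j = i then 1 else if j = k then -1 else 0)]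
  · split_ifs <;> simp
  · rw [actS_X, Equiv.swap_apply_def]
    split_ifs <;> simp_all

theorem quotSbar_X_mul {k i : Fin n} (h : k ≠ i) (j : Fin n) (f : MvPolynomial (Fin n) ℂ) :
    quotSbar k i (MvPolynomial.X j * f) = MvPolynomial.X j * quotSbar k i f +
      (if j = i then actSbar k i f else if j = k then actSbar k i f else 0) := by
  rw [divDiff_mul (X_add_X_ne_zero h) (quotSbar_spec k i) f (MvPolynomial.X j)
    (if j = i then 1 else if j = k then 1 else 0)]
  · split_ifs <;> simp
  · rw [actSbar_X]
    split_ifs <;> simp_all [add_comm]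

theorem quotTau_X_mul (i j : Fin n) (f : MvPolynomial (Fin n) ℂ) :
    quotTau i (MvPolynomial.X j * f) = MvPolynomial.X j * quotTau i f +
      (if j = i then actTau i f else 0) := by
  rw [divDiff_mul (two_mul_X_ne_zero i) (quotTau_spec i) f (MvPolynomial.X j)
    (if j = i then 1 else 0)]
  · split_ifs <;> simp
  · rw [actTau_X]
    split_ifs with h
    · rw [h]; ring
    · simp

variable (V : Type*) [AddCommGroup V] [Module ℂ V] [Module (SpinWeyl X n) V]
  [IsScalarTower ℂ (SpinWeyl X n) V]

/-- The Dunkl operator by which `ξ_i` acts on `ℂ[y_1, …, y_n] ⊗ V`. -/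
def dunkl (d : Datum X) (i : Fin n) : Module.End ℂ (MvPolynomial (Fin n) ℂ ⊗[ℂ] V) :=
  d.long • ∑ k ∈ Finset.univ.erase i, (tensorOp V (quotSLin k i) (brk X n k i) -
      tensorOp V (quotSbarLin k i) (barBrk X n k i)) -
    d.short • tensorOp V (quotTauLin i) (shortBrk X n i)

theorem dunkl_tmul (d : Datum X) (i : Fin n) (f : MvPolynomial (Fin n) ℂ) (w : V) :
    dunkl V d i (f ⊗ₜ w) =
      d.long • ∑ k ∈ Finset.univ.erase i, (quotS k i f ⊗ₜ (brk X n k i • w) -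
        quotSbar k i f ⊗ₜ (barBrk X n k i • w)) -
      d.short • (quotTau i f ⊗ₜ[ℂ] (shortBrk X n i • w)) := by
  simp only [dunkl, LinearMap.sub_apply, LinearMap.smul_apply, LinearMap.sum_apply, tensorOp_tmul,
    quotTauLin_apply]
  congr 2
  refine Finset.sum_congr rfl fun k hk => ?_
  rw [quotSLin_apply (Finset.ne_of_mem_erase hk), quotSbarLin_apply (Finset.ne_of_mem_erase hk)]

theorem dunkl_one_tmul (d : Datum X) (i : Fin n) (w : V) :
    dunkl V d i ((1 : MvPolynomial (Fin n) ℂ) ⊗ₜ w) = 0 := by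
  rw [dunkl_tmul, divDiff_one (two_mul_X_ne_zero i) (quotTau_spec i), TensorProduct.zero_tmul,
    smul_zero, sub_zero, Finset.sum_eq_zero, smul_zero]
  intro k hk
  have hk := Finset.ne_of_mem_erase hk
  rw [divDiff_one (X_sub_X_ne_zero hk) (quotS_spec k i),
    divDiff_one (X_add_X_ne_zero hk) (quotSbar_spec k i), TensorProduct.zero_tmul,
    TensorProduct.zero_tmul, sub_zero]

/-- Multiplication by `y_j`. -/
def mulY (V : Type*) [AddCommGroup V] [Module ℂ V] (j : Fin n) :
    Module.End ℂ (MvPolynomial (Fin n) ℂ ⊗[ℂ] V) :=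
  TensorProduct.map (LinearMap.mulLeft ℂ (MvPolynomial.X j)) LinearMap.id

theorem mulY_tmul (V : Type*) [AddCommGroup V] [Module ℂ V] (j : Fin n)
    (f : MvPolynomial (Fin n) ℂ) (w : V) :
    mulY V j (f ⊗ₜ w) = (MvPolynomial.X j * f) ⊗ₜ w := rfl

theorem mulY_comm (V : Type*) [AddCommGroup V] [Module ℂ V] (i j : Fin n) :
    mulY V i * mulY V j = mulY V j * mulY V i := by
  refine TensorProduct.ext' fun f w => ?_
  simp only [Module.End.mul_apply, mulY_tmul, mul_left_comm]

variable (hX : X ≠ .A → 2 ≤ n)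

/-- The commutator of a multiplication operator and a Dunkl operator. -/
theorem mulY_dunkl (d : Datum X) (j i : Fin n) :
    mulY V j * dunkl V d i - dunkl V d i * mulY V j = spinAction V hX (crossComm d j i) := by
  refine TensorProduct.ext' fun f w => ?_
  have hterm : ∀ k ∈ Finset.univ.erase i,
      mulY V j (quotS k i f ⊗ₜ (brk X n k i • w) - quotSbar k i f ⊗ₜ (barBrk X n k i • w)) -
      (quotS k i (MvPolynomial.X j * f) ⊗ₜ (brk X n k i • w) -
        quotSbar k i (MvPolynomial.X j * f) ⊗ₜ (barBrk X n k i • w)) =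
      if j = i then spinAction V hX (brk X n i k + barBrk X n i k) (f ⊗ₜ w)
      else if j = k then spinAction V hX (-brk X n i k + barBrk X n i k) (f ⊗ₜ w) else 0 := by
    intro k hk
    have hk := Finset.ne_of_mem_erase hk
    rw [quotS_X_mul hk, quotSbar_X_mul hk]
    simp only [map_sub, mulY_tmul, TensorProduct.add_tmul, map_add, map_neg,
      LinearMap.add_apply, LinearMap.neg_apply, spinAction_brk V hX hk.symm,
      spinAction_barBrk V hX hk.symm]
    -- The operators contain `[k,i]` and the commutators `[i,k]`; this sign absorbs the one with
    -- which the Leibniz correction is subtracted.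
    rw [brk_swap k i, barBrk_swap k i, actS_comm i k, actSbar_comm i k]
    split_ifs
    · simp only [neg_smul, TensorProduct.tmul_neg]; abel
    · simp only [neg_smul, TensorProduct.tmul_neg, TensorProduct.neg_tmul]; abel
    · simp only [TensorProduct.zero_tmul]; abel
  have hshort : mulY V j (quotTau i f ⊗ₜ (shortBrk X n i • w)) -
      quotTau i (MvPolynomial.X j * f) ⊗ₜ (shortBrk X n i • w) =
      if j = i then -spinAction V hX (shortBrk X n i) (f ⊗ₜ w) else 0 := by
    rw [quotTau_X_mul, mulY_tmul, spinAction_shortBrk, TensorProduct.add_tmul]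
    split_ifs
    · abel
    · simp only [TensorProduct.zero_tmul]; abel
  have hsum := Finset.sum_congr rfl hterm
  rw [Finset.sum_sub_distrib, sub_eq_iff_eq_add] at hsum
  rw [sub_eq_iff_eq_add] at hshort
  simp only [LinearMap.sub_apply, Module.End.mul_apply, mulY_tmul, dunkl_tmul]
  rw [map_sub, map_smul, map_smul, map_sum, hsum, hshort]
  unfold crossComm
  by_cases hji : j = i
  · simp only [if_pos hji, map_add, map_smul, map_sum, LinearMap.add_apply, LinearMap.smul_apply,
      LinearMap.sum_apply, smul_add, smul_neg]
    abel
  · simp only [if_neg hji, zero_add, map_smul, LinearMap.smul_apply]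
    rw [Finset.sum_ite_eq, if_pos (by simp [hji]), smul_add]
    abel

/-- An operator that kills `1 ⊗ V` and is intertwined by the multiplications is zero. -/
theorem eq_zero_of_mulY {V : Type*} [AddCommGroup V] [Module ℂ V] {M : Type*} [AddCommGroup M]
    [Module ℂ M] (Z : MvPolynomial (Fin n) ℂ ⊗[ℂ] V →ₗ[ℂ] M) (L : Fin n → Module.End ℂ M)
    (h1 : ∀ w : V, Z (1 ⊗ₜ w) = 0) (hL : ∀ j m, Z (mulY V j m) = L j (Z m)) : Z = 0 := by
  refine TensorProduct.ext' fun f w => ?_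
  rw [LinearMap.zero_apply]
  induction f using MvPolynomial.induction_on with
  | C a =>
    rw [← mul_one (C a), ← MvPolynomial.smul_eq_C_mul, ← TensorProduct.smul_tmul', map_smul, h1,
      smul_zero]
  | add f g hf hg => rw [TensorProduct.add_tmul, map_add, hf, hg, add_zero]
  | mul_X f j hf => rw [mul_comm, ← mulY_tmul, hL, hf, map_zero]

theorem spinAction_t_mulY {a : ℕ} {π : Equiv.Perm (Fin n)} {ε : Fin n → ℂ}
    {g : MvPolynomial (Fin n) ℂ →ₐ[ℂ] MvPolynomial (Fin n) ℂ} (h : GenAct X n a π ε g)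
    (j : Fin n) : spinAction V hX (t X n a) * mulY V j =
      ε j • (mulY V (π j) * spinAction V hX (t X n a)) := by
  refine TensorProduct.ext' fun f w => ?_
  simp only [Module.End.mul_apply, spinAction_t V hX h, mulY_tmul, tensorOp_tmul,
    AlgHom.toLinearMap_apply, map_mul, h.apply_X, LinearMap.smul_apply]
  rw [smul_mul_assoc, TensorProduct.smul_tmul']

/-- Moving `Y` to the left past both summands leaves the corrections `-T c` and `-e c' T`, which
cancel by `hc`. -/
theorem twisted_sum_mul {B : Type*} [Ring B] [Algebra ℂ B] {T Y Y' D D' c c' : B} {e : ℂ}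
    (hT : T * Y = e • (Y' * T)) (h1 : Y * D - D * Y = c) (h2 : Y' * D' - D' * Y' = c')
    (hc : TwistBy T c (e • c')) :
    (T * D + D' * T) * Y = e • (Y' * (T * D + D' * T)) := by
  unfold TwistBy at hc
  have e1 : T * D * Y = T * (Y * D) - T * (Y * D - D * Y) := by noncomm_ring
  have e2 : T * (Y * D) = e • (Y' * T * D) := by rw [← mul_assoc, hT, smul_mul_assoc]
  have e3 : D' * T * Y = e • (D' * Y' * T) := by
    rw [mul_assoc, hT, mul_smul_comm, mul_assoc]
  rw [add_mul, e1, e2, e3, h1, hc, ← h2, smul_mul_assoc, mul_add, smul_add, sub_mul, smul_sub,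
    mul_assoc, mul_assoc, mul_assoc]
  abel

theorem spinAction_t_dunkl (d : Datum X) {a : ℕ} {π : Equiv.Perm (Fin n)} {ε : Fin n → ℂ}
    {g : MvPolynomial (Fin n) ℂ →ₐ[ℂ] MvPolynomial (Fin n) ℂ} (h : GenAct X n a π ε g)
    (i : Fin n) : TwistBy (spinAction V hX (t X n a)) (dunkl V d i) (dunkl V d (π i)) := by
  refine eq_neg_of_add_eq_zero_left ?_
  refine eq_zero_of_mulY _ (fun j => ε j • mulY V (π j)) (fun w => ?_) fun j m => ?_
  · rw [LinearMap.add_apply, Module.End.mul_apply, Module.End.mul_apply, dunkl_one_tmul,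
      spinAction_one_tmul, dunkl_one_tmul, map_zero, add_zero]
  · refine LinearMap.congr_fun (twisted_sum_mul
      (B := Module.End ℂ (MvPolynomial (Fin n) ℂ ⊗[ℂ] V)) (spinAction_t_mulY V hX h j)
      (mulY_dunkl V hX d j i) (mulY_dunkl V hX d (π j) (π i)) ?_) m
    have hc := congrArg (spinAction V hX) (h.twist_crossComm hX d j i)
    rwa [map_mul, map_neg, map_mul, map_smul] at hc

/-- A conjugate has three factors, so the signs multiply to a single minus. The `ξ_i` are permuted
without the signs `ε`, and so only `π` appears. -/
theorem spinAction_isRefl_dunkl (d : Datum X) {x : SpinWeyl X n} {π : Equiv.Perm (Fin n)}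
    {g : MvPolynomial (Fin n) ℂ →ₐ[ℂ] MvPolynomial (Fin n) ℂ} (h : IsRefl X n x π g) :
    ∀ i : Fin n, TwistBy (spinAction V hX x) (dunkl V d i) (dunkl V d (π i)) := by
  induction h with
  | gen h => exact fun i => spinAction_t_dunkl V hX d h i
  | @conj a x π π' ε g g' hx h ih =>
    intro i
    have h1 := spinAction_t_dunkl V hX d h i
    have h2 := ih (π i)
    have h3 := spinAction_t_dunkl V hX d h (π' (π i))
    rw [map_neg, map_mul, map_mul]
    refine TwistBy.neg_left ?_
    exact h1.mul_left₃ h2 h3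
  | neg hx ih =>
    intro i
    rw [map_neg]
    exact (ih i).neg_left

theorem spinAction_barBrk_dunkl (d : Datum X) {i k : Fin n} (hik : i ≠ k) (j : Fin n) :
    TwistBy (spinAction V hX (barBrk X n i k)) (dunkl V d j) (dunkl V d (Equiv.swap i k j)) := by
  by_cases hA : X = .A
  · subst hA
    rw [barBrk_A, map_zero]; exact TwistBy.zero_left _ _
  · exact spinAction_isRefl_dunkl V hX d (barBrk_isRefl hA hik) j

theorem spinAction_shortBrk_dunkl (d : Datum X) (i j : Fin n) :
    TwistBy (spinAction V hX (shortBrk X n i)) (dunkl V d j) (dunkl V d j) := by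
  cases X with
  | B => exact spinAction_isRefl_dunkl V hX d (barOne_isRefl i) j
  | A =>
    have e : shortBrk .A n i = 0 := rfl
    rw [e, map_zero]; exact TwistBy.zero_left _ _
  | D =>
    have e : shortBrk .D n i = 0 := rfl
    rw [e, map_zero]; exact TwistBy.zero_left _ _

/-- Elements of an algebra that `ℂW⁻` permutes up to sign satisfy the relation that makes the
anticommutators of the `ξ_i` central over the `y_k`. -/
theorem crossComm_anticomm {B : Type*} [Ring B] [Algebra ℂ B] (σ : SpinWeyl X n →ₐ[ℂ] B)
    (D : Fin n → B) (d : Datum X)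
    (hb : ∀ i k, i ≠ k → ∀ j, TwistBy (σ (brk X n i k)) (D j) (D (Equiv.swap i k j)))
    (hbar : ∀ i k, i ≠ k → ∀ j, TwistBy (σ (barBrk X n i k)) (D j) (D (Equiv.swap i k j)))
    (hs : ∀ i j, TwistBy (σ (shortBrk X n i)) (D j) (D j)) {i j : Fin n} (hij : i ≠ j)
    (k : Fin n) :
    σ (crossComm d k i) * D j + D j * σ (crossComm d k i) +
      (σ (crossComm d k j) * D i + D i * σ (crossComm d k j)) = 0 := by
  have hadd : ∀ i k, i ≠ k → ∀ j, TwistBy (σ (brk X n i k + barBrk X n i k)) (D j)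
      (D (Equiv.swap i k j)) := fun i k hik j => by
    rw [map_add]; exact (hb i k hik j).add_left (hbar i k hik j)
  have hsub : ∀ i k, i ≠ k → ∀ j, TwistBy (σ (-brk X n i k + barBrk X n i k)) (D j)
      (D (Equiv.swap i k j)) := fun i k hik j => by
    rw [map_add, map_neg]; exact (hb i k hik j).neg_left.add_left (hbar i k hik j)
  -- For `k` different from both indices, the commutator involves only reflections exchanging `i`
  -- and `k`; these fix `j`, so each anticommutator vanishes separately.
  have hfar : ∀ {i j k : Fin n}, k ≠ i → k ≠ j → i ≠ j →
      σ (crossComm d k i) * D j + D j * σ (crossComm d k i) = 0 := fun {i j k} hki hkj hij => by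
    have h := hsub i k hki.symm j
    rw [Equiv.swap_apply_of_ne_of_ne hij.symm hkj.symm] at h
    rw [crossComm, if_neg hki, map_smul, smul_mul_assoc, mul_smul_comm, h, smul_neg,
      neg_add_cancel]
  have hnear : ∀ {i j : Fin n}, i ≠ j →
      σ (crossComm d i i) * D j + D j * σ (crossComm d i i) +
        (σ (crossComm d i j) * D i + D i * σ (crossComm d i j)) = 0 := fun {i j} hij => by
    have h1 : σ (crossComm d i i) * D j + D j * σ (crossComm d i i) =
        d.long • (σ (brk X n i j + barBrk X n i j) * D j +
          D j * σ (brk X n i j + barBrk X n i j)) := by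
      rw [crossComm, if_pos rfl, map_add, map_smul, map_smul, map_sum, add_mul, mul_add,
        smul_mul_assoc, smul_mul_assoc, mul_smul_comm, mul_smul_comm, hs, smul_neg, add_add_add_comm,
        neg_add_cancel, add_zero, ← smul_add, Finset.sum_mul, Finset.mul_sum,
        ← Finset.sum_add_distrib]
      congr 1
      -- The term of any other `k` anticommutes with `D j`, its transposition fixing `j`.
      refine Finset.sum_eq_single_of_mem j (by simp [hij.symm]) fun k hk hkj => ?_
      have hk := Finset.ne_of_mem_erase hk
      have h := hadd i k hk.symm j
      rw [Equiv.swap_apply_of_ne_of_ne hij.symm hkj.symm] at h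
      rw [h, neg_add_cancel]
    have h2 : σ (crossComm d i j) = d.long • σ (brk X n i j + barBrk X n i j) := by
      rw [crossComm, if_neg hij, map_smul, brk_swap i j, barBrk_swap i j, neg_neg]
    have h3 := hadd i j hij j
    have h4 := hadd i j hij i
    rw [Equiv.swap_apply_right] at h3
    rw [Equiv.swap_apply_left] at h4
    -- The element `x = [i,j] + \overline{[i,j]}` exchanges `D i` and `D j` with a sign: `x D_j`
    -- cancels `D_i x`, and `x D_i` cancels `D_j x`.
    rw [h1, h2, smul_mul_assoc, mul_smul_comm, ← smul_add, ← smul_add, h3, h4]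
    simp
  rcases eq_or_ne k i with rfl | hki
  · exact hnear hij
  rcases eq_or_ne k j with rfl | hkj
  · rw [add_comm]; exact hnear hij.symm
  rw [hfar hki hkj hij, hfar hkj hki hij.symm, add_zero]

/-- The commutator with `Y` is a derivation, and its value on `D D' + D' D` is the left side of
`hc`. -/
theorem anticomm_mul {B : Type*} [Ring B] {D D' Y c c' : B} (h : Y * D - D * Y = c)
    (h' : Y * D' - D' * Y = c') (hc : c * D' + D' * c + (c' * D + D * c') = 0) :
    (D * D' + D' * D) * Y = Y * (D * D' + D' * D) := by
  subst h h'
  rw [← sub_eq_zero, ← neg_eq_zero, ← hc]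
  noncomm_ring

theorem dunkl_anticomm (d : Datum X) {i j : Fin n} (hij : i ≠ j) :
    TwistBy (dunkl V d i) (dunkl V d j) (dunkl V d j) := by
  -- Two distinct indices exist.
  have hX : X ≠ .A → 2 ≤ n := fun _ => by omega
  have hc := fun k => crossComm_anticomm
    (B := Module.End ℂ (MvPolynomial (Fin n) ℂ ⊗[ℂ] V)) (spinAction V hX) (dunkl V d) d
    (fun i k hik => spinAction_isRefl_dunkl V hX d (brk_isRefl hik))
    (fun i k hik => spinAction_barBrk_dunkl V hX d hik)
    (spinAction_shortBrk_dunkl V hX d) hij k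
  have hY := fun k => anticomm_mul (B := Module.End ℂ (MvPolynomial (Fin n) ℂ ⊗[ℂ] V))
    (mulY_dunkl V hX d k i) (mulY_dunkl V hX d k j) (hc k)
  refine eq_neg_of_add_eq_zero_left ?_
  refine eq_zero_of_mulY _ (mulY V) (fun w => ?_) fun k m => LinearMap.congr_fun (hY k) m
  rw [LinearMap.add_apply, Module.End.mul_apply, Module.End.mul_apply, dunkl_one_tmul,
    dunkl_one_tmul, map_zero, map_zero, add_zero]

end Dunkl

/-! ### The universal property of the algebra and consequences of its relations. -/

section Relations

variable {X : WeylType} {n : ℕ}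

/-- Elements `ξ_i`, `y_i` of an algebra and a homomorphism from `ℂW⁻` to it that satisfy the
defining relations of the rational spin double affine Hecke algebra. -/
structure Realization (d : Datum X) {B : Type*} [Ring B] [Algebra ℂ B] (ξ y : Fin n → B)
    (σ : SpinWeyl X n →ₐ[ℂ] B) : Prop where
  y_comm : ∀ i j, y i * y j = y j * y i
  xi_anti : ∀ i j, i ≠ j → TwistBy (ξ i) (ξ j) (ξ j)
  gen_y : ∀ {a : ℕ} {π : Equiv.Perm (Fin n)} {ε : Fin n → ℂ}
    {g : MvPolynomial (Fin n) ℂ →ₐ[ℂ] MvPolynomial (Fin n) ℂ}, GenAct X n a π ε g → ∀ j,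
      σ (t X n a) * y j = ε j • (y (π j) * σ (t X n a))
  gen_xi : ∀ {a : ℕ} {π : Equiv.Perm (Fin n)} {ε : Fin n → ℂ}
    {g : MvPolynomial (Fin n) ℂ →ₐ[ℂ] MvPolynomial (Fin n) ℂ}, GenAct X n a π ε g → ∀ j,
      TwistBy (σ (t X n a)) (ξ j) (ξ (π j))
  cross : ∀ j i, y j * ξ i - ξ i * y j = σ (crossComm d j i)

namespace Realization

variable {d : Datum X} {B : Type*} [Ring B] [Algebra ℂ B] {ξ y : Fin n → B}
  {σ : SpinWeyl X n →ₐ[ℂ] B}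

/-- The images of the generators of the free algebra. -/
def genMap (ξ y : Fin n → B) (σ : SpinWeyl X n →ₐ[ℂ] B) : Gen X n → B
  | .xi i => ξ i
  | .y i => y i
  | .w s => σ s

theorem lift_common (h : Realization d ξ y σ) {a b : Free X n} (hab : CommonRel X n a b) :
    FreeAlgebra.lift ℂ (genMap ξ y σ) a = FreeAlgebra.lift ℂ (genMap ξ y σ) b := by
  cases hab with
  | w_add r s => simp [genMap]
  | w_mul r s => simp [genMap]
  | w_scalar c => simp [genMap]
  | y_comm i j => simpa [genMap] using h.y_comm i j
  | xi_anti i j hij => simpa [genMap, TwistBy] using h.xi_anti i j hij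
  | t_y i j hij => simpa [genMap] using h.gen_y (GenAct.simple i j hij) i
  | t_xi i j hij => simpa [genMap, TwistBy] using h.gen_xi (GenAct.simple i j hij) i
  | t_y_far a j ha h1 h2 =>
    have := h.gen_y (GenAct.simple (X := X) ⟨a, by omega⟩ ⟨a + 1, ha⟩ rfl) j
    rw [Equiv.swap_apply_of_ne_of_ne (Fin.ne_of_val_ne h1) (Fin.ne_of_val_ne h2)] at this
    simpa [genMap] using this
  | t_xi_far a j ha h1 h2 =>
    have := h.gen_xi (GenAct.simple (X := X) ⟨a, by omega⟩ ⟨a + 1, ha⟩ rfl) j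
    rw [Equiv.swap_apply_of_ne_of_ne (Fin.ne_of_val_ne h1) (Fin.ne_of_val_ne h2)] at this
    simpa [genMap, TwistBy] using this

theorem lift_rel (h : Realization d ξ y σ) {a b : Free X n} (hab : Rel n d a b) :
    FreeAlgebra.lift ℂ (genMap ξ y σ) a = FreeAlgebra.lift ℂ (genMap ξ y σ) b := by
  cases d with
  | A u =>
    cases hab with
    | common hab => exact h.lift_common hab
    | cross i j hij =>
      simpa [genMap, Ring.lie_def, crossComm, hij.symm, barBrk_A, Datum.long] using h.cross j i
    | diag i =>
      simpa [genMap, Ring.lie_def, crossComm, barBrk_A, Datum.long, Datum.short]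
        using h.cross i i
  | B u v =>
    cases hab with
    | common hab => exact h.lift_common hab
    | tn_y i hi => simpa [genMap] using h.gen_y (GenAct.lastB rfl i hi) i
    | tn_xi i hi => simpa [genMap, TwistBy] using h.gen_xi (GenAct.lastB rfl i hi) i
    | tn_y_far j hj =>
      have := h.gen_y (GenAct.lastB rfl ⟨n - 1, by omega⟩ (by simp; omega)) j
      rw [if_neg fun e => hj (by rw [e]; simp; omega)] at this
      simpa [genMap] using this
    | tn_xi_far j hj =>
      have := h.gen_xi (GenAct.lastB rfl ⟨n - 1, by omega⟩ (by simp; omega)) j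
      simpa [genMap, TwistBy] using this
    | cross i j hij =>
      simpa [genMap, Ring.lie_def, crossComm, hij.symm, Datum.long] using h.cross j i
    | diag i =>
      simpa [genMap, Ring.lie_def, crossComm, Datum.long, Datum.short, shortBrk]
        using h.cross i i
  | D u =>
    cases hab with
    | common hab => exact h.lift_common hab
    | tn_y i j hi hj => simpa [genMap] using h.gen_y (GenAct.lastD rfl j i hj hi) i
    | tn_xi i j hi hj => simpa [genMap, TwistBy] using h.gen_xi (GenAct.lastD rfl j i hj hi) i
    | tn_y_far j h1 h2 =>
      -- With a single variable the only index is the last one, which is excluded here.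
      by_cases hn : 2 ≤ n
      · have := h.gen_y (GenAct.lastD rfl ⟨n - 2, by omega⟩ ⟨n - 1, by omega⟩ (by simp; omega)
          (by simp; omega)) j
        have h3 : j ≠ ⟨n - 2, by omega⟩ := by rintro rfl; simp at h2; omega
        have h4 : j ≠ ⟨n - 1, by omega⟩ := by rintro rfl; simp at h1; omega
        rw [Equiv.swap_apply_of_ne_of_ne h3 h4, if_neg (by tauto)] at this
        simpa [genMap] using this
      · omega
    | tn_xi_far j h1 h2 =>
      by_cases hn : 2 ≤ n
      · have := h.gen_xi (GenAct.lastD rfl ⟨n - 2, by omega⟩ ⟨n - 1, by omega⟩ (by simp; omega)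
          (by simp; omega)) j
        have h3 : j ≠ ⟨n - 2, by omega⟩ := by rintro rfl; simp at h2; omega
        have h4 : j ≠ ⟨n - 1, by omega⟩ := by rintro rfl; simp at h1; omega
        rw [Equiv.swap_apply_of_ne_of_ne h3 h4] at this
        simpa [genMap, TwistBy] using this
      · omega
    | cross i j hij =>
      simpa [genMap, Ring.lie_def, crossComm, hij.symm, Datum.long] using h.cross j i
    | diag i =>
      simpa [genMap, Ring.lie_def, crossComm, Datum.long, Datum.short]
        using h.cross i i

/-- The homomorphism from the rational spin double affine Hecke algebra given by a
realization. -/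
def lift (h : Realization d ξ y σ) : SDaHa n d →ₐ[ℂ] B :=
  RingQuot.liftAlgHom ℂ ⟨FreeAlgebra.lift ℂ (genMap ξ y σ), fun _ _ => h.lift_rel⟩

theorem lift_mk (h : Realization d ξ y σ) (x : Free X n) :
    h.lift (SpinDaHa.mk d x) = FreeAlgebra.lift ℂ (genMap ξ y σ) x :=
  RingQuot.liftAlgHom_mkAlgHom_apply ℂ _ _ _

theorem lift_xi (h : Realization d ξ y σ) (i : Fin n) : h.lift (xi d i) = ξ i := by
  rw [xi, h.lift_mk, FreeAlgebra.lift_ι_apply, genMap]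

theorem lift_y (h : Realization d ξ y σ) (i : Fin n) : h.lift (SpinDaHa.y d i) = y i := by
  rw [SpinDaHa.y, h.lift_mk, FreeAlgebra.lift_ι_apply, genMap]

theorem lift_ofSpin (h : Realization d ξ y σ) (s : SpinWeyl X n) :
    h.lift (ofSpin d s) = σ s := by
  change h.lift (SpinDaHa.mk d (fw s)) = σ s
  rw [h.lift_mk, FreeAlgebra.lift_ι_apply, genMap]

end Realization

theorem mk_fw (d : Datum X) (s : SpinWeyl X n) : mk d (fw s) = ofSpin d s := rfl

theorem mk_fy (d : Datum X) (i : Fin n) : mk d (fy X n i) = y d i := rfl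

theorem mk_fxi (d : Datum X) (i : Fin n) : mk d (fxi X n i) = xi d i := rfl

theorem y_mul_xi (d : Datum X) (j i : Fin n) :
    y d j * xi d i - xi d i * y d j = ofSpin d (crossComm d j i) := by
  unfold crossComm
  cases d with
  | A u =>
    split_ifs with h
    · subst h
      have := mk_eq (.A u) (RelA.diag (n := n) (u := u) j)
      simpa [Ring.lie_def, mk_fw, mk_fy, mk_fxi, barBrk_A, Datum.long, Datum.short] using this
    · have := mk_eq (.A u) (RelA.cross (n := n) (u := u) i j (Ne.symm h))
      simpa [Ring.lie_def, mk_fw, mk_fy, mk_fxi, barBrk_A, Datum.long] using this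
  | B u v =>
    split_ifs with h
    · subst h
      have := mk_eq (.B u v) (RelB.diag (n := n) (u := u) (v := v) j)
      simpa [Ring.lie_def, mk_fw, mk_fy, mk_fxi, Datum.long, Datum.short, shortBrk] using this
    · have := mk_eq (.B u v) (RelB.cross (n := n) (u := u) (v := v) i j (Ne.symm h))
      simpa [Ring.lie_def, mk_fw, mk_fy, mk_fxi, Datum.long] using this
  | D u =>
    split_ifs with h
    · subst h
      have := mk_eq (.D u) (RelD.diag (n := n) (u := u) j)
      simpa [Ring.lie_def, mk_fw, mk_fy, mk_fxi, Datum.long, Datum.short] using this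
    · have := mk_eq (.D u) (RelD.cross (n := n) (u := u) i j (Ne.symm h))
      simpa [Ring.lie_def, mk_fw, mk_fy, mk_fxi, Datum.long] using this

/-- The presentation states the relation of `t_a` with one of the two variables it exchanges; this
supplies the other. -/
theorem mul_eq_of_involution {B : Type*} [Ring B] {T y y' : B} (hT : T * T = 1)
    (h : T * y = y' * T) : T * y' = y * T := by
  calc T * y' = T * (y' * T) * T := by simp only [mul_assoc, hT, mul_one]
    _ = (T * T) * y * T := by rw [← h]; simp only [mul_assoc]
    _ = _ := by rw [hT, one_mul]

theorem ofSpin_t_mul_y (d : Datum X) {a : ℕ} {π : Equiv.Perm (Fin n)} {ε : Fin n → ℂ}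
    {g : MvPolynomial (Fin n) ℂ →ₐ[ℂ] MvPolynomial (Fin n) ℂ} (h : GenAct X n a π ε g)
    (j : Fin n) : ofSpin d (t X n a) * y d j = ε j • (y d (π j) * ofSpin d (t X n a)) := by
  have hT : ofSpin d (t X n a) * ofSpin d (t X n a) = 1 := by
    rw [← map_mul, h.t_sq, map_one]
  cases h with
  | simple i k hik =>
    rw [one_smul]
    have h1 := mk_eq d (Rel.of_common d (CommonRel.t_y (X := X) i k hik))
    simp only [map_mul, mk_fw, mk_fy] at h1
    rcases eq_or_ne j i with rfl | hji
    · rw [Equiv.swap_apply_left, h1]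
    rcases eq_or_ne j k with rfl | hjk
    · rw [Equiv.swap_apply_right]
      exact mul_eq_of_involution hT h1
    rw [Equiv.swap_apply_of_ne_of_ne hji hjk]
    have h2 := mk_eq d (Rel.of_common d (CommonRel.t_y_far (X := X) (i : ℕ) j (by omega)
      (Fin.val_ne_of_ne hji) (by rw [hik]; exact Fin.val_ne_of_ne hjk)))
    simpa only [map_mul, mk_fw, mk_fy] using h2
  | lastB hX m hm =>
    subst hX
    cases d with
    | B u v =>
      by_cases hj : j = m
      · have h1 := mk_eq (.B u v) (RelB.tn_y (u := u) (v := v) m hm)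
        simp only [map_mul, map_neg, mk_fw, mk_fy] at h1
        simp only [hj, if_true, Equiv.Perm.one_apply, h1, neg_smul, one_smul]
      · have h1 := mk_eq (.B u v) (RelB.tn_y_far (u := u) (v := v) j (by omega))
        simp only [map_mul, mk_fw, mk_fy] at h1
        simp only [hj, if_false, Equiv.Perm.one_apply, h1, one_smul]
  | lastD hX l m hl hm =>
    subst hX
    cases d with
    | D u =>
      have h1 := mk_eq (.D u) (RelD.tn_y (u := u) m l hm hl)
      simp only [map_mul, map_neg, mk_fw, mk_fy] at h1
      by_cases hjm : j = m
      · subst hjm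
        simp only [or_true, if_true, Equiv.swap_apply_right, h1, neg_smul, one_smul]
      by_cases hjl : j = l
      · subst hjl
        simp only [true_or, if_true, Equiv.swap_apply_left, neg_smul, one_smul]
        rw [← neg_mul] at h1
        rw [← neg_mul, ← mul_eq_of_involution hT (y := -y (.D u) m) (y' := y (.D u) j)
          (by rw [mul_neg, h1, neg_mul, neg_neg])]
      · have h2 := mk_eq (.D u) (RelD.tn_y_far (u := u) j (by omega) (by omega))
        simp only [map_mul, mk_fw, mk_fy] at h2
        simp only [hjm, hjl, or_self, if_false, Equiv.swap_apply_of_ne_of_ne hjl hjm, h2, one_smul]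

theorem ofSpin_t_mul_polyHom (d : Datum X) {a : ℕ} {π : Equiv.Perm (Fin n)} {ε : Fin n → ℂ}
    {g : MvPolynomial (Fin n) ℂ →ₐ[ℂ] MvPolynomial (Fin n) ℂ} (h : GenAct X n a π ε g)
    (f : MvPolynomial (Fin n) ℂ) :
    ofSpin d (t X n a) * polyHom d f = polyHom d (g f) * ofSpin d (t X n a) := by
  induction f using MvPolynomial.induction_on with
  | C c =>
    have e : MvPolynomial.C c = algebraMap ℂ (MvPolynomial (Fin n) ℂ) c := rfl
    rw [e, AlgHom.commutes, AlgHom.commutes, AlgHom.commutes, Algebra.commutes]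
  | add f f' hf hf' => rw [map_add, map_add, map_add, mul_add, add_mul, hf, hf']
  | mul_X f j hf =>
    rw [map_mul, map_mul, map_mul, polyHom_X, h.apply_X, map_smul, polyHom_X, ← mul_assoc, hf,
      mul_assoc, ofSpin_t_mul_y d h, mul_smul_comm, mul_smul_comm, smul_mul_assoc, mul_assoc]

end Relations

/-! ### Calculation in the induced module. -/

section Induced

variable {X : WeylType} {n : ℕ} {d : Datum X} {V : Type*} [AddCommGroup V] [Module ℂ V]
  {ρ : hXi n d →ₐ[ℂ] Module.End ℂ V}

theorem canon_tmul (f : MvPolynomial (Fin n) ℂ) (w : V) :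
    canon ρ (f ⊗ₜ w) = (balanced ρ).mkQ (polyHom d f ⊗ₜ w) := rfl

theorem smul_mkQ_tmul (h h' : SDaHa n d) (w : V) :
    h • (balanced ρ).mkQ (h' ⊗ₜ w) = (balanced ρ).mkQ ((h * h') ⊗ₜ w) := by
  rw [← map_smul, TensorProduct.smul_tmul', smul_eq_mul]

theorem mkQ_mul_tmul (h : SDaHa n d) (a : hXi n d) (w : V) :
    (balanced ρ).mkQ ((h * (a : SDaHa n d)) ⊗ₜ w) = (balanced ρ).mkQ (h ⊗ₜ ρ a w) := by
  rw [← sub_eq_zero, ← map_sub, Submodule.mkQ_apply, Submodule.Quotient.mk_eq_zero]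
  exact Submodule.subset_span ⟨h, a, w, rfl⟩

theorem canon_mulY (j : Fin n) (m : MvPolynomial (Fin n) ℂ ⊗[ℂ] V) :
    canon ρ (mulY V j m) = y d j • canon ρ m := by
  induction m with
  | zero => rw [map_zero, map_zero, smul_zero]
  | tmul f w => rw [mulY_tmul, canon_tmul, canon_tmul, smul_mkQ_tmul, map_mul, polyHom_X]
  | add x y hx hy => rw [map_add, map_add, hx, hy, map_add, smul_add]

end Induced

/-! ### Uniqueness of the extension. -/

section Uniqueness

variable {X : WeylType} {n : ℕ} {d : Datum X} {V : Type*} [AddCommGroup V] [Module ℂ V]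
  [Module (SpinWeyl X n) V]

theorem IsTrivialExtension.unique {ρ ρ' : hXi n d →ₐ[ℂ] Module.End ℂ V}
    (h : IsTrivialExtension d ρ) (h' : IsTrivialExtension d ρ') : ρ = ρ' := by
  refine AlgHom.adjoin_ext fun x hx => ?_
  rcases hx with ⟨i, rfl⟩ | ⟨s, rfl⟩
  · exact (h.2 i).trans (h'.2 i).symm
  · ext w
    exact (h.1 s w).trans (h'.1 s w).symm

end Uniqueness

/-! ### The Dunkl representation, the extension to V and bijectivity of `canon`. -/

section Representation

variable {X : WeylType} {n : ℕ}
variable (V : Type*) [AddCommGroup V] [Module ℂ V] [Module (SpinWeyl X n) V]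
  [IsScalarTower ℂ (SpinWeyl X n) V] (hX : X ≠ .A → 2 ≤ n) (d : Datum X)

theorem dunkl_realization : Realization (B := Module.End ℂ (MvPolynomial (Fin n) ℂ ⊗[ℂ] V)) d
    (dunkl V d) (mulY V) (spinAction V hX) where
  y_comm := mulY_comm V
  xi_anti _ _ hij := dunkl_anticomm V d hij
  gen_y h j := spinAction_t_mulY V hX h j
  gen_xi h j := spinAction_t_dunkl V hX d h j
  cross j i := mulY_dunkl V hX d j i

/-- The representation of the rational spin double affine Hecke algebra on
`ℂ[y_1, …, y_n] ⊗ V` by Dunkl operators. -/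
def dunklRep : SDaHa n d →ₐ[ℂ] Module.End ℂ (MvPolynomial (Fin n) ℂ ⊗[ℂ] V) :=
  (dunkl_realization V hX d).lift

theorem dunklRep_polyHom (f : MvPolynomial (Fin n) ℂ) (m : MvPolynomial (Fin n) ℂ) (w : V) :
    dunklRep V hX d (polyHom d f) (m ⊗ₜ w) = (f * m) ⊗ₜ w := by
  induction f using MvPolynomial.induction_on generalizing m with
  | C c =>
    have e : MvPolynomial.C c = algebraMap ℂ (MvPolynomial (Fin n) ℂ) c := rfl
    rw [e, AlgHom.commutes, AlgHom.commutes, Module.algebraMap_end_apply,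
      TensorProduct.smul_tmul', Algebra.smul_def]
  | add f f' hf hf' =>
    rw [map_add, map_add, LinearMap.add_apply, hf, hf', add_mul, TensorProduct.add_tmul]
  | mul_X f j hf =>
    rw [map_mul, map_mul, Module.End.mul_apply, polyHom_X, dunklRep, Realization.lift_y,
      mulY_tmul, ← dunklRep, hf, mul_assoc]

/-- The projection of `ℂ[y_1, …, y_n] ⊗ V` to `V` by the constant term. -/
def constTerm (n : ℕ) (V : Type*) [AddCommGroup V] [Module ℂ V] :
    MvPolynomial (Fin n) ℂ ⊗[ℂ] V →ₗ[ℂ] V :=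
  (TensorProduct.lid ℂ V).toLinearMap ∘ₗ
    TensorProduct.map (MvPolynomial.aeval (0 : Fin n → ℂ)).toLinearMap LinearMap.id

theorem constTerm_one_tmul (w : V) : constTerm n V (1 ⊗ₜ w) = w := by
  simp [constTerm]

/-- The subspace `1 ⊗ V` is stable under the subalgebra generated by the `ξ_i` and `ℂW⁻`. -/
theorem dunklRep_one_tmul {a : SDaHa n d} (ha : a ∈ hXi n d) :
    ∀ w : V, dunklRep V hX d a (1 ⊗ₜ w) =
      1 ⊗ₜ constTerm n V (dunklRep V hX d a (1 ⊗ₜ w)) := by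
  induction ha using Algebra.adjoin_induction with
  | mem x hx =>
    intro w
    rcases hx with ⟨i, rfl⟩ | ⟨s, rfl⟩
    · rw [dunklRep, Realization.lift_xi, dunkl_one_tmul, map_zero, TensorProduct.tmul_zero]
    · rw [dunklRep, Realization.lift_ofSpin, spinAction_one_tmul, constTerm_one_tmul]
  | algebraMap c =>
    intro w
    rw [AlgHom.commutes, Module.algebraMap_end_apply, ← TensorProduct.tmul_smul,
      constTerm_one_tmul]
  | add x y _ _ hx hy =>
    intro w
    rw [map_add, LinearMap.add_apply, hx, hy, ← TensorProduct.tmul_add, constTerm_one_tmul]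
  | mul x y _ _ hx hy =>
    intro w
    rw [map_mul, Module.End.mul_apply, hy, hx, constTerm_one_tmul]

/-- The action on `V` extending that of `ℂW⁻`, in which every `ξ_i` acts by zero. -/
def trivialExtension : hXi n d →ₐ[ℂ] Module.End ℂ V :=
  AlgHom.ofLinearMap
    { toFun := fun a => constTerm n V ∘ₗ dunklRep V hX d a ∘ₗ TensorProduct.mk ℂ _ V 1
      map_add' := fun a b => by
        ext w
        simp
      map_smul' := fun c a => by
        ext w
        simp }
    (by ext w; simp [constTerm_one_tmul])
    (fun a b => by
      ext w
      simp only [LinearMap.coe_mk, AddHom.coe_mk, LinearMap.comp_apply, TensorProduct.mk_apply,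
        Module.End.mul_apply, MulMemClass.coe_mul, map_mul]
      -- Multiplicativity is the stability of `1 ⊗ V`: the constant term of `b (1 ⊗ w)`, placed back
      -- in `1 ⊗ V`, recovers `b (1 ⊗ w)`.
      rw [← dunklRep_one_tmul V hX d b.2])

theorem trivialExtension_apply (a : hXi n d) (w : V) :
    trivialExtension V hX d a w = constTerm n V (dunklRep V hX d a (1 ⊗ₜ w)) := rfl

theorem trivialExtension_isTrivialExtension :
    IsTrivialExtension d (trivialExtension V hX d) := by
  refine ⟨fun s w => ?_, fun i => ?_⟩
  · rw [trivialExtension_apply, dunklRep, Realization.lift_ofSpin, spinAction_one_tmul,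
      constTerm_one_tmul]
  · ext w
    rw [trivialExtension_apply, dunklRep, Realization.lift_xi, dunkl_one_tmul, map_zero,
      LinearMap.zero_apply]

variable {V} {d}

theorem existsUnique_trivialExtension (hX : X ≠ .A → 2 ≤ n) :
    ∃! ρ : hXi n d →ₐ[ℂ] Module.End ℂ V, IsTrivialExtension d ρ :=
  ⟨trivialExtension V hX d, trivialExtension_isTrivialExtension V hX d,
    fun _ h => h.unique (trivialExtension_isTrivialExtension V hX d)⟩

theorem IsTrivialExtension.dunklRep_one_tmul (hX : X ≠ .A → 2 ≤ n) {ρ : hXi n d →ₐ[ℂ] Module.End ℂ V}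
    (h : IsTrivialExtension d ρ) (a : hXi n d) (w : V) :
    dunklRep V hX d a (1 ⊗ₜ w) = 1 ⊗ₜ ρ a w := by
  rw [h.unique (trivialExtension_isTrivialExtension V hX d), trivialExtension_apply]
  exact SpinDaHa.dunklRep_one_tmul V hX d a.2 w

variable {ρ : hXi n d →ₐ[ℂ] Module.End ℂ V}

/-- The map `h ⊗ w ↦ h (1 ⊗ w)`. -/
def dunklEval (V : Type*) [AddCommGroup V] [Module ℂ V] [Module (SpinWeyl X n) V]
    [IsScalarTower ℂ (SpinWeyl X n) V] (hX : X ≠ .A → 2 ≤ n) (d : Datum X) :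
    SDaHa n d ⊗[ℂ] V →ₗ[ℂ] MvPolynomial (Fin n) ℂ ⊗[ℂ] V :=
  TensorProduct.lift (LinearMap.lcomp ℂ _ (TensorProduct.mk ℂ (MvPolynomial (Fin n) ℂ) V 1) ∘ₗ
    (dunklRep V hX d).toLinearMap)

theorem dunklEval_tmul (h : SDaHa n d) (w : V) :
    dunklEval V hX d (h ⊗ₜ w) = dunklRep V hX d h (1 ⊗ₜ w) := rfl

theorem dunklEval_smul (h : SDaHa n d) (x : SDaHa n d ⊗[ℂ] V) :
    dunklEval V hX d (h • x) = dunklRep V hX d h (dunklEval V hX d x) := by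
  induction x with
  | zero => rw [smul_zero, map_zero, map_zero]
  | tmul h' w =>
    rw [TensorProduct.smul_tmul', smul_eq_mul, dunklEval_tmul, dunklEval_tmul, map_mul,
      Module.End.mul_apply]
  | add x y hx hy => rw [smul_add, map_add, hx, hy, map_add, map_add]

/-- As `a (1 ⊗ w) = 1 ⊗ ρ a w` for `a` in the subalgebra, the evaluation `h ⊗ w ↦ h (1 ⊗ w)`
respects the balanced relations. -/
theorem IsTrivialExtension.dunklEval_balanced (hρ : IsTrivialExtension d ρ)
    {x : SDaHa n d ⊗[ℂ] V} (hx : x ∈ balanced ρ) : dunklEval V hX d x = 0 := by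
  induction hx using Submodule.span_induction with
  | mem x hx =>
    obtain ⟨h, a, w, rfl⟩ := hx
    rw [map_sub, dunklEval_tmul, dunklEval_tmul, map_mul, Module.End.mul_apply,
      hρ.dunklRep_one_tmul hX, sub_self]
  | zero => exact map_zero _
  | add x y _ _ hx hy => rw [map_add, hx, hy, add_zero]
  | smul h x _ hx => rw [dunklEval_smul, hx, map_zero]

theorem dunklEval_map_polyHom (m : MvPolynomial (Fin n) ℂ ⊗[ℂ] V) :
    dunklEval V hX d (TensorProduct.map (polyHom d).toLinearMap LinearMap.id m) = m := by
  induction m with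
  | zero => rw [map_zero, map_zero]
  | tmul f w =>
    rw [TensorProduct.map_tmul, dunklEval_tmul, AlgHom.toLinearMap_apply, dunklRep_polyHom,
      mul_one, LinearMap.id_apply]
  | add x y hx hy => rw [map_add, map_add, hx, hy]

/-- An element killed by `canon` has its representative in `balanced ρ`, where `dunklEval` vanishes;
but `dunklEval` returns the element itself. -/
theorem IsTrivialExtension.canon_injective (hX : X ≠ .A → 2 ≤ n) (hρ : IsTrivialExtension d ρ) :
    Function.Injective (canon ρ) := by
  refine (injective_iff_map_eq_zero _).2 fun m hm => ?_
  rw [← dunklEval_map_polyHom hX (d := d) m]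
  exact hρ.dunklEval_balanced hX ((Submodule.Quotient.mk_eq_zero _).1 hm)

theorem IsTrivialExtension.canon_spinAction_t (hρ : IsTrivialExtension d ρ) {a : ℕ}
    {π : Equiv.Perm (Fin n)} {ε : Fin n → ℂ}
    {g : MvPolynomial (Fin n) ℂ →ₐ[ℂ] MvPolynomial (Fin n) ℂ} (h : GenAct X n a π ε g)
    (m : MvPolynomial (Fin n) ℂ ⊗[ℂ] V) :
    canon ρ (spinAction V hX (t X n a) m) = ofSpin d (t X n a) • canon ρ m := by
  induction m with
  | zero => rw [map_zero, map_zero, smul_zero]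
  | tmul f w =>
    rw [spinAction_t V hX h, tensorOp_tmul, canon_tmul, canon_tmul, smul_mkQ_tmul,
      ofSpin_t_mul_polyHom d h, AlgHom.toLinearMap_apply, ← hρ.1, ← mkQ_mul_tmul]
  | add x y hx hy => rw [map_add, map_add, hx, hy, map_add, smul_add]

theorem IsTrivialExtension.canon_spinAction (hρ : IsTrivialExtension d ρ) (s : SpinWeyl X n) :
    ∀ m : MvPolynomial (Fin n) ℂ ⊗[ℂ] V,
      canon ρ (spinAction V hX s m) = ofSpin d s • canon ρ m := by
  let A : Subalgebra ℂ (SpinWeyl X n) :=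
    { carrier := {s | ∀ m : MvPolynomial (Fin n) ℂ ⊗[ℂ] V,
        canon ρ (spinAction V hX s m) = ofSpin d s • canon ρ m}
      mul_mem' := fun {r s} hr hs m => by
        rw [map_mul, Module.End.mul_apply, hr, hs, map_mul, mul_smul]
      add_mem' := fun {r s} hr hs m => by
        rw [map_add, LinearMap.add_apply, map_add, hr, hs, map_add, add_smul]
      algebraMap_mem' := fun c m => by
        rw [AlgHom.commutes, AlgHom.commutes, Module.algebraMap_end_apply, map_smul,
          algebraMap_smul] }
  refine spin_induction A (fun a ha m => ?_) s
  obtain ⟨π, ε, g, h⟩ := exists_genAct ha hX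
  exact hρ.canon_spinAction_t hX h m

/-- The elements `ξ_i` act on the induced module by Dunkl operators. -/
theorem IsTrivialExtension.canon_dunkl (hX : X ≠ .A → 2 ≤ n) (hρ : IsTrivialExtension d ρ) (i : Fin n)
    (m : MvPolynomial (Fin n) ℂ ⊗[ℂ] V) :
    canon ρ (dunkl V d i m) = xi d i • canon ρ m := by
  -- Both terms kill `1 ⊗ V`. Both have the same commutator with `y_j`, given by `crossComm d j i`
  -- and transported by the equivariance of `canon`, so their difference is intertwined by the
  -- `y_j`.
  have key : canon ρ ∘ₗ dunkl V d i - Algebra.lsmul ℂ ℂ (Induced ρ) (xi d i) ∘ₗ canon ρ = 0 := by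
    refine eq_zero_of_mulY _ (fun j => Algebra.lsmul ℂ ℂ (Induced ρ) (y d j)) (fun w => ?_)
      fun j m => ?_
    · have e : xi d i = 1 * ((⟨xi d i, xi_mem d i⟩ : hXi n d) : SDaHa n d) := (one_mul _).symm
      rw [LinearMap.sub_apply, LinearMap.comp_apply, LinearMap.comp_apply, dunkl_one_tmul,
        map_zero, zero_sub, neg_eq_zero]
      change xi d i • canon ρ (1 ⊗ₜ w) = 0
      rw [canon_tmul, smul_mkQ_tmul, map_one, mul_one, e, mkQ_mul_tmul, hρ.2, LinearMap.zero_apply, TensorProduct.tmul_zero, map_zero]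
    · have h1 := LinearMap.congr_fun (mulY_dunkl V hX d j i) m
      have h2 := congrArg (fun x => x • canon ρ m) (y_mul_xi d j i)
      simp only [LinearMap.sub_apply, Module.End.mul_apply] at h1
      simp only [sub_smul, mul_smul, ← hρ.canon_spinAction hX, ← h1, map_sub, canon_mulY] at h2
      simp only [LinearMap.sub_apply, LinearMap.comp_apply, Algebra.lsmul_coe, canon_mulY,
        smul_sub]
      rw [sub_eq_sub_iff_add_eq_add] at h2 ⊢
      rw [← h2, add_comm]
  exact sub_eq_zero.1 (LinearMap.congr_fun key m)

theorem mk_surjective (d : Datum X) : Function.Surjective (mk (n := n) d) :=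
  RingQuot.mkAlgHom_surjective ℂ _

theorem IsTrivialExtension.canon_dunklRep (hρ : IsTrivialExtension d ρ) (h : SDaHa n d) :
    ∀ m : MvPolynomial (Fin n) ℂ ⊗[ℂ] V, canon ρ (dunklRep V hX d h m) = h • canon ρ m := by
  obtain ⟨x, rfl⟩ := mk_surjective d h
  induction x using FreeAlgebra.induction with
  | grade0 c =>
    intro m
    rw [AlgHom.commutes, AlgHom.commutes, Module.algebraMap_end_apply, map_smul, algebraMap_smul]
  | grade1 s =>
    intro m
    cases s with
    | xi i =>
      rw [mk_fxi, dunklRep, Realization.lift_xi]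
      exact hρ.canon_dunkl hX i m
    | y i =>
      rw [mk_fy, dunklRep, Realization.lift_y]
      exact canon_mulY i m
    | w s =>
      rw [mk_fw, dunklRep, Realization.lift_ofSpin]
      exact hρ.canon_spinAction hX s m
  | mul a b ha hb =>
    intro m
    rw [map_mul, map_mul, Module.End.mul_apply, ha, hb, mul_smul]
  | add a b ha hb =>
    intro m
    rw [map_add, map_add, LinearMap.add_apply, map_add, ha, hb, add_smul]

/-- Equivariance gives the preimage: the class of `h ⊗ w` is `h` applied to `canon (1 ⊗ w)`, hence
`canon` of `h (1 ⊗ w)` in the Dunkl representation. -/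
theorem IsTrivialExtension.canon_surjective (hX : X ≠ .A → 2 ≤ n) (hρ : IsTrivialExtension d ρ) :
    Function.Surjective (canon ρ) := by
  intro x
  obtain ⟨x, rfl⟩ := (balanced ρ).mkQ_surjective x
  induction x with
  | zero => exact ⟨0, by rw [map_zero, map_zero]⟩
  | tmul h w =>
    refine ⟨dunklRep V hX d h (1 ⊗ₜ w), ?_⟩
    rw [hρ.canon_dunklRep hX, canon_tmul, smul_mkQ_tmul, map_one, mul_one]
  | add x y hx hy =>
    obtain ⟨a, ha⟩ := hx
    obtain ⟨b, hb⟩ := hy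
    exact ⟨a + b, by rw [map_add, map_add, ha, hb]⟩

end Representation

end SpinDaHa

end

theorem proposition6 (n : ℕ) (u v : ℂ) :
    -- type A_{n-1}
    (∀ (V : Type*) [AddCommGroup V] [Module ℂ V] [Module (SpinWeyl .A n) V]
        [IsScalarTower ℂ (SpinWeyl .A n) V],
      (∃! ρ : hXi n (Datum.A u) →ₐ[ℂ] Module.End ℂ V, IsTrivialExtension (.A u) ρ) ∧
      ∀ ρ : hXi n (Datum.A u) →ₐ[ℂ] Module.End ℂ V, IsTrivialExtension (.A u) ρ →
        Function.Bijective (canon ρ) ∧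
        ∀ (i : Fin n) (f : MvPolynomial (Fin n) ℂ) (w : V),
          xi (.A u) i • canon ρ (f ⊗ₜ[ℂ] w) =
            canon ρ (u • ∑ k ∈ Finset.univ.erase i,
              quotS k i f ⊗ₜ[ℂ] (brk .A n k i • w))) ∧
    -- type B_n
    (2 ≤ n → ∀ (V : Type*) [AddCommGroup V] [Module ℂ V] [Module (SpinWeyl .B n) V]
        [IsScalarTower ℂ (SpinWeyl .B n) V],
      (∃! ρ : hXi n (Datum.B u v) →ₐ[ℂ] Module.End ℂ V, IsTrivialExtension (.B u v) ρ) ∧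
      ∀ ρ : hXi n (Datum.B u v) →ₐ[ℂ] Module.End ℂ V, IsTrivialExtension (.B u v) ρ →
        Function.Bijective (canon ρ) ∧
        ∀ (i : Fin n) (f : MvPolynomial (Fin n) ℂ) (w : V),
          xi (.B u v) i • canon ρ (f ⊗ₜ[ℂ] w) =
            canon ρ (u • ∑ k ∈ Finset.univ.erase i,
                quotS k i f ⊗ₜ[ℂ] (brk .B n k i • w)
              - u • ∑ k ∈ Finset.univ.erase i,
                quotSbar k i f ⊗ₜ[ℂ] (barBrk .B n k i • w)
              - v • (quotTau i f ⊗ₜ[ℂ] (barOne n i • w)))) ∧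
    -- type D_n
    (4 ≤ n → ∀ (V : Type*) [AddCommGroup V] [Module ℂ V] [Module (SpinWeyl .D n) V]
        [IsScalarTower ℂ (SpinWeyl .D n) V],
      (∃! ρ : hXi n (Datum.D u) →ₐ[ℂ] Module.End ℂ V, IsTrivialExtension (.D u) ρ) ∧
      ∀ ρ : hXi n (Datum.D u) →ₐ[ℂ] Module.End ℂ V, IsTrivialExtension (.D u) ρ →
        Function.Bijective (canon ρ) ∧
        ∀ (i : Fin n) (f : MvPolynomial (Fin n) ℂ) (w : V),
          xi (.D u) i • canon ρ (f ⊗ₜ[ℂ] w) =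
            canon ρ (u • ∑ k ∈ Finset.univ.erase i,
                quotS k i f ⊗ₜ[ℂ] (brk .D n k i • w)
              - u • ∑ k ∈ Finset.univ.erase i,
                quotSbar k i f ⊗ₜ[ℂ] (barBrk .D n k i • w))) := by
  refine ⟨fun V _ _ _ _ => ?_, fun hn V _ _ _ _ => ?_, fun hn V _ _ _ _ => ?_⟩
  · have hX : WeylType.A ≠ .A → 2 ≤ n := fun h => absurd rfl h
    refine ⟨existsUnique_trivialExtension hX, fun ρ hρ =>
      ⟨⟨hρ.canon_injective hX, hρ.canon_surjective hX⟩, fun i f w => ?_⟩⟩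
    rw [← hρ.canon_dunkl hX, dunkl_tmul]
    simp only [Datum.long, Datum.short, barBrk_A, zero_smul, TensorProduct.tmul_zero, sub_zero]
  · have hX : WeylType.B ≠ .A → 2 ≤ n := fun _ => hn
    refine ⟨existsUnique_trivialExtension hX, fun ρ hρ =>
      ⟨⟨hρ.canon_injective hX, hρ.canon_surjective hX⟩, fun i f w => ?_⟩⟩
    rw [← hρ.canon_dunkl hX, dunkl_tmul, Finset.sum_sub_distrib, smul_sub]
    rfl
  · have hX : WeylType.D ≠ .A → 2 ≤ n := fun _ => by omega
    refine ⟨existsUnique_trivialExtension hX, fun ρ hρ =>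
      ⟨⟨hρ.canon_injective hX, hρ.canon_surjective hX⟩, fun i f w => ?_⟩⟩
    rw [← hρ.canon_dunkl hX, dunkl_tmul, Finset.sum_sub_distrib, smul_sub]
    simp only [Datum.long, Datum.short, zero_smul, sub_zero]
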